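/- For $\alpha\in\mathbb R^d$ let $T_\alpha f=f(\cdot-\alpha)$, and for an invertible real $d\times d$ matrix $A$ let $D_Af=|\det A|^{1/2}f(A\,\cdot)$ and $\widetilde D_Af=|\det A|\,f(A\,\cdot)$, acting on $L^2(\mathbb R^d)$; let $\hat f(\xi)=\int f(x)e^{-2\pi i x\cdot\xi}\,dx$, extended to $L^2(\mathbb R^d)$, and let $A^*$ be the transpose of $A$. For a finite family $\Psi=(\psi_1,\dots,\psi_r)$ in $L^2(\mathbb R^d)$ the affine system is the family $\mathcal U_A(\Psi)=(D_A^nT_z\psi_i)_{n\in\mathbb Z,\,z\in\mathbb Z^d,\,1\le i\le r}$, and the quasi-affine system $\mathcal U^q_A(\Psi)$ is the family with the same index set whose members are $D_A^nT_z\psi_i$ for $n\ge 0$ and $T_z\widetilde D_A^n\psi_i$ for $n<0$. A family $(x_j)$ in a Hilbert space is Bessel if $\sum_j|\langle v,x_j\rangle|^2\le M\|v\|^2$ for all $v$ and some constant $M$; for two Bessel families with the same index set the mixed Gramian is the bounded operator $\Theta_Y^*\Theta_X v=\sum_j\langle v,x_j\rangle y_j$. Theorem. Let $A$ be an integer matrix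 all of whose eigenvalues have modulus greater than $1$, and let $\Psi=(\psi_1,\dots,\psi_r)$, $\Phi=(\phi_1,\dots,\phi_r)$ be finite families in $L^2(\mathbb R^d)$ such that $\mathcal U_A(\Psi)$ and $\mathcal U_A(\Phi)$ are Bessel. Then $\mathcal U^q_A(\Psi)$ and $\mathcal U^q_A(\Phi)$ are Bessel as well; the series over $j$ in condition 6 (for every $q\in\mathbb Z^d$ and every $i$) and in the formula for $s$ (for every $i$) converge absolutely for almost every $\xi$. Write $\theta=\theta_\Phi^*\theta_\Psi=\sum\langle\,\cdot\,,D_A^nT_z\psi_i\rangle D_A^nT_z\phi_i$ for the mixed Gramian of the affine systems, $\theta^q=\theta_\Phi^{q*}\theta^q_\Psi$ for the corresponding one of the quasi-affine systems, and $$s(\xi)=\sum_{i=1}^r\sum_{j\in\mathbb Z}\overline{\hat\psi_i(A^{*j}\xi)}\,\hat\phi_i(A^{*j}\xi).$$ The following are equivalent: 1. $\theta$ commutes with $T_z$ for all $z\in\mathbb Z^d$; 2. $\theta^q$ commutes with $D_A$; 3. $\theta$ commutes with $T_\beta$ for all $\beta\in\mathbb R^d$; 4. $\theta^q$ commutes with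 $T_\beta$ for all $\beta\in\mathbb R^d$; 5. $\theta=\theta^q$; 6. for every $q\in\mathbb Z^d\setminus A^*\mathbb Z^d$, $\displaystyle\sum_{i=1}^r\sum_{j=0}^\infty\overline{\hat\phi_i(A^{*j}\xi)}\,\hat\psi_i(A^{*j}(\xi+q))=0$ for a.e. $\xi$; 7. $\theta$ is the Fourier multiplier with symbol $s$, i.e. $s\in L^\infty(\mathbb R^d)$ and $\widehat{\theta f}(\xi)=s(\xi)\hat f(\xi)$ a.e. for all $f\in L^2(\mathbb R^d)$; 8. $\theta^q$ is the Fourier multiplier with the same symbol $s$, in the same sense. -/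

import Mathlib

open MeasureTheory
open scoped ENNReal FourierTransform InnerProductSpace ComplexConjugate

noncomputable section

/-! ### Bessel sequences and mixed Gramians in a Hilbert space -/

section Bessel

variable {H : Type*} [NormedAddCommGroup H] [InnerProductSpace ℂ H] {J : Type*}

/-- A family `x` is a Bessel sequence if `∑ j, |⟨v, x j⟩|² ≤ M ‖v‖²` for some constant `M`. -/
def IsBesselSeq (x : J → H) : Prop :=
  ∃ M : ℝ, ∀ v : H, Summable (fun j => ‖⟪x j, v⟫_ℂ‖ ^ 2) ∧ ∑' j, ‖⟪x j, v⟫_ℂ‖ ^ 2 ≤ M * ‖v‖ ^ 2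

theorem IsBesselSeq.memℓp {x : J → H} (hx : IsBesselSeq x) (v : H) :
    Memℓp (fun j => ⟪x j, v⟫_ℂ) 2 := by
  obtain ⟨M, hM⟩ := hx
  refine memℓp_gen ?_
  simpa using (hM v).1

/-- The analysis operator `v ↦ (⟨v, x j⟩)_j` (Mathlib's inner product is linear in its second
argument). -/
def analysisOp (x : J → H) (hx : IsBesselSeq x) : H →L[ℂ] lp (fun _ : J => ℂ) 2 :=
  LinearMap.mkContinuousOfExistsBound
    { toFun := fun v => ⟨fun j => ⟪x j, v⟫_ℂ, hx.memℓp v⟩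
      map_add' := fun v w => by
        ext j
        exact inner_add_right (x j) v w
      map_smul' := fun c v => by
        ext j
        exact inner_smul_right (x j) v c }
    (by
      obtain ⟨M, hM⟩ := hx
      refine ⟨Real.sqrt M, fun v => ?_⟩
      have h0 : 0 ≤ M * ‖v‖ ^ 2 := le_trans (tsum_nonneg fun j => sq_nonneg _) (hM v).2
      refine lp.norm_le_of_tsum_le (by norm_num) (by positivity) ?_
      rcases eq_or_ne v 0 with rfl | hv
      · simp
      · have hM0 : 0 ≤ M := by
          by_contra hneg
          have : 0 < ‖v‖ ^ 2 := by positivity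
          nlinarith
        have := (hM v).2
        simp only [ENNReal.toReal_ofNat, Real.rpow_two]
        rw [mul_pow, Real.sq_sqrt hM0]
        exact this)

@[simp] theorem analysisOp_apply (x : J → H) (hx : IsBesselSeq x) (v : H) (j : J) :
    analysisOp x hx v j = ⟪x j, v⟫_ℂ := rfl

/-- The synthesis operator, the adjoint of the analysis operator. -/
def synthesisOp [CompleteSpace H] (x : J → H) (hx : IsBesselSeq x) :
    lp (fun _ : J => ℂ) 2 →L[ℂ] H :=
  (analysisOp x hx).adjoint

/-- The synthesis operator is `c ↦ ∑ j, c j • x j`. -/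
theorem hasSum_synthesisOp [CompleteSpace H] (x : J → H) (hx : IsBesselSeq x)
    (c : lp (fun _ : J => ℂ) 2) : HasSum (fun j => c j • x j) (synthesisOp x hx c) := by
  classical
  have key : ∀ (j : J) (a : ℂ), synthesisOp x hx (lp.single 2 j a) = a • x j := by
    intro j a
    refine ext_inner_right ℂ fun v => ?_
    rw [synthesisOp, ContinuousLinearMap.adjoint_inner_left, lp.inner_single_left,
      analysisOp_apply, inner_smul_left, RCLike.inner_apply, mul_comm]
  have h := (lp.hasSum_single (p := 2) (by norm_num) c).mapL (synthesisOp x hx)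
  simpa only [key] using h

/-- The mixed Gramian `Θ_y^* Θ_x`, that is, `v ↦ ∑ j, ⟨v, x j⟩ y j`. -/
def mixedGramian [CompleteSpace H] {x y : J → H} (hx : IsBesselSeq x) (hy : IsBesselSeq y) :
    H →L[ℂ] H :=
  synthesisOp y hy ∘L analysisOp x hx

theorem hasSum_mixedGramian [CompleteSpace H] {x y : J → H} (hx : IsBesselSeq x)
    (hy : IsBesselSeq y) (v : H) :
    HasSum (fun j => ⟪x j, v⟫_ℂ • y j) (mixedGramian hx hy v) :=
  hasSum_synthesisOp y hy (analysisOp x hx v)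

end Bessel

/-! ### Translations and dilations on `L²(ℝᵈ)` -/

section Euclid

variable {d : ℕ}

/-- `ℝᵈ` with its Euclidean structure. -/
abbrev Rd (d : ℕ) : Type := EuclideanSpace ℝ (Fin d)

/-- `L²(ℝᵈ)`, complex valued, with respect to Lebesgue measure. -/
abbrev L2 (d : ℕ) : Type := Lp (α := Rd d) ℂ 2 volume

/-- The point of `ℤᵈ` with the given integer coordinates, as a vector of `ℝᵈ`. -/
def intVec (k : Fin d → ℤ) : Rd d := WithLp.toLp 2 fun i => (k i : ℝ)

/-- The linear action of a square matrix on `ℝᵈ`. -/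
def matAct (M : Matrix (Fin d) (Fin d) ℝ) : Rd d →ₗ[ℝ] Rd d := Matrix.toEuclideanLin M

/-- The translation `T_α f = f(· - α)`. -/
def translation (α : Rd d) : L2 d →L[ℂ] L2 d :=
  (Lp.compMeasurePreservingₗᵢ ℂ (fun x : Rd d => x - α)
    (measurePreserving_sub_right volume α)).toContinuousLinearMap

theorem translation_ae (α : Rd d) (f : L2 d) : translation α f =ᵐ[volume] fun x => f (x - α) :=
  Lp.coeFn_compMeasurePreserving f (measurePreserving_sub_right volume α)

theorem det_matAct (M : Matrix (Fin d) (Fin d) ℝ) : LinearMap.det (matAct M) = M.det := by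
  rw [matAct, Matrix.toEuclideanLin_eq_toLin_orthonormal, LinearMap.det_toLin]

theorem gl_det_ne_zero (A : GL (Fin d) ℝ) : A.val.det ≠ 0 :=
  ((Matrix.isUnit_iff_isUnit_det _).1 A.isUnit).ne_zero

theorem map_matAct (A : GL (Fin d) ℝ) :
    Measure.map (matAct A.val) (volume : Measure (Rd d))
      = ENNReal.ofReal |A.val.det⁻¹| • volume := by
  have h := Measure.map_linearMap_addHaar_eq_smul_addHaar (volume : Measure (Rd d))
    (f := matAct A.val) (by rw [det_matAct]; exact gl_det_ne_zero A)
  rwa [det_matAct] at h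

theorem measurable_matAct (M : Matrix (Fin d) (Fin d) ℝ) : Measurable (matAct M) :=
  (LinearMap.continuous_of_finiteDimensional _).measurable

theorem quasiMeasurePreserving_matAct (A : GL (Fin d) ℝ) :
    Measure.QuasiMeasurePreserving (matAct A.val) (volume : Measure (Rd d)) volume := by
  refine ⟨measurable_matAct _, ?_⟩
  rw [map_matAct]
  exact Measure.smul_absolutelyContinuous

theorem memLp_comp_matAct (A : GL (Fin d) ℝ) (f : L2 d) :
    MemLp (fun x => f (matAct A.val x)) 2 volume := by
  refine MemLp.comp_of_map (f := matAct A.val) ?_ (measurable_matAct _).aemeasurable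
  rw [map_matAct]
  exact (Lp.memLp f).smul_measure ENNReal.ofReal_ne_top

theorem norm_comp_matAct (A : GL (Fin d) ℝ) (f : L2 d) :
    ‖(memLp_comp_matAct A f).toLp‖ = (ENNReal.ofReal |A.val.det⁻¹|).toReal ^ (1 / 2 : ℝ) * ‖f‖ := by
  have h : eLpNorm (fun x => f (matAct A.val x)) 2 volume
      = eLpNorm f 2 (Measure.map (matAct A.val) (volume : Measure (Rd d))) := by
    refine (eLpNorm_map_measure ?_ (measurable_matAct _).aemeasurable).symm
    rw [map_matAct]
    exact (Lp.aestronglyMeasurable f).mono_ac Measure.smul_absolutelyContinuous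
  rw [Lp.norm_toLp, h, map_matAct, eLpNorm_smul_measure_of_ne_top (by norm_num), Lp.norm_def,
    smul_eq_mul, ENNReal.toReal_mul, ENNReal.toReal_rpow]
  norm_num

/-- Composition `f ↦ f(A ·)` with an invertible matrix. -/
def compCLM (A : GL (Fin d) ℝ) : L2 d →L[ℂ] L2 d :=
  LinearMap.mkContinuousOfExistsBound
    { toFun := fun f => (memLp_comp_matAct A f).toLp
      map_add' := fun f g => by
        rw [← MemLp.toLp_add]
        exact MemLp.toLp_congr _ _
          ((quasiMeasurePreserving_matAct A).ae_eq_comp (Lp.coeFn_add f g))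
      map_smul' := fun c f => by
        rw [RingHom.id_apply, ← MemLp.toLp_const_smul]
        exact MemLp.toLp_congr _ _
          ((quasiMeasurePreserving_matAct A).ae_eq_comp (Lp.coeFn_smul c f)) }
    ⟨_, fun f => (norm_comp_matAct A f).le⟩

theorem compCLM_ae (A : GL (Fin d) ℝ) (f : L2 d) :
    compCLM A f =ᵐ[volume] fun x => f (matAct A.val x) :=
  MemLp.coeFn_toLp (memLp_comp_matAct A f)

theorem compCLM_compCLM_of_mul_eq_one (A B : GL (Fin d) ℝ) (h : A * B = 1) (f : L2 d) :
    compCLM B (compCLM A f) = f := by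
  have hAB : ∀ x, matAct A.val (matAct B.val x) = x := fun x => by
    have h1 : A.val * B.val = 1 := by rw [← Units.val_mul, h, Units.val_one]
    simp [matAct, Matrix.toLpLin_apply, Matrix.mulVec_mulVec, h1]
  refine Lp.ext ?_
  filter_upwards [compCLM_ae B (compCLM A f),
    (quasiMeasurePreserving_matAct B).ae_eq_comp (compCLM_ae A f)] with x h1 h2
  rw [h1]
  simpa [hAB] using h2

/-- The bounded invertible operator `f ↦ c f(A ·)`, for an invertible matrix `A` and `c ≠ 0`. -/
def scaledComp (c : ℝ) (hc : c ≠ 0) (A : GL (Fin d) ℝ) : L2 d ≃L[ℂ] L2 d :=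
  (ContinuousLinearEquiv.equivOfInverse (compCLM A) (compCLM A⁻¹)
      (compCLM_compCLM_of_mul_eq_one A A⁻¹ (mul_inv_cancel A))
      (compCLM_compCLM_of_mul_eq_one A⁻¹ A (inv_mul_cancel A))).trans
    (ContinuousLinearEquiv.smulLeft (Units.mk0 (c : ℂ) (Complex.ofReal_ne_zero.2 hc)))

theorem scaledComp_ae (c : ℝ) (hc : c ≠ 0) (A : GL (Fin d) ℝ) (f : L2 d) :
    scaledComp c hc A f =ᵐ[volume] fun x => (c : ℂ) * f (matAct A.val x) := by
  filter_upwards [Lp.coeFn_smul (c : ℂ) (compCLM A f), compCLM_ae A f] with x h1 h2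
  rw [← h2]
  exact h1

theorem abs_det_ne_zero (A : GL (Fin d) ℝ) : |A.val.det| ≠ 0 := abs_ne_zero.2 (gl_det_ne_zero A)

/-- The dilation `D_A f = |det A|^{1/2} f(A ·)`. -/
def dilation (A : GL (Fin d) ℝ) : L2 d ≃L[ℂ] L2 d :=
  scaledComp (Real.sqrt |A.val.det|)
    (Real.sqrt_ne_zero'.2 (abs_pos.2 (gl_det_ne_zero A))) A

/-- The renormalized dilation `f ↦ |det A| f(A ·)`. -/
def dilationR (A : GL (Fin d) ℝ) : L2 d ≃L[ℂ] L2 d :=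
  scaledComp |A.val.det| (abs_det_ne_zero A) A

/-- All (complex) eigenvalues of `A` have modulus strictly greater than `1`. -/
def IsExpansive (A : GL (Fin d) ℝ) : Prop :=
  ∀ μ : ℂ, Module.End.HasEigenvalue (Matrix.toLin' (A.val.map (fun t : ℝ => (t : ℂ)))) μ → 1 < ‖μ‖

/-- All entries of `A` are integers. -/
def IsIntegralMatrix (A : GL (Fin d) ℝ) : Prop :=
  ∀ i j, ∃ n : ℤ, A.val i j = (n : ℝ)

variable {r : ℕ}

/-- The affine system `D_A^n T_z ψ_i`, with `n ∈ ℤ`, `z ∈ ℤᵈ`, `1 ≤ i ≤ r`. -/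
def affineSystem (A : GL (Fin d) ℝ) (Ψ : Fin r → L2 d) : ℤ × (Fin d → ℤ) × Fin r → L2 d :=
  fun p => (dilation A ^ p.1) (translation (intVec p.2.1) (Ψ p.2.2))

/-- The quasi-affine system: `D_A^n T_z ψ_i` for `n ≥ 0`, and `T_z (dilationR A)^n ψ_i`
for `n < 0`. -/
def quasiAffineSystem (A : GL (Fin d) ℝ) (Ψ : Fin r → L2 d) :
    ℤ × (Fin d → ℤ) × Fin r → L2 d :=
  fun p =>
    if 0 ≤ p.1 then (dilation A ^ p.1) (translation (intVec p.2.1) (Ψ p.2.2))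
    else translation (intVec p.2.1) ((dilationR A ^ p.1) (Ψ p.2.2))

/-- The vector `A^{*j} ξ`, where `A^*` is the transpose of `A`. -/
def adjPow (A : GL (Fin d) ℝ) (j : ℤ) (ξ : Rd d) : Rd d := matAct ((A ^ j).val.transpose) ξ

/-- The lattice `A^* ℤᵈ`. -/
def dualLattice (A : GL (Fin d) ℝ) : Set (Rd d) :=
  Set.range fun k : Fin d → ℤ => adjPow A 1 (intVec k)

/-- The bounded operator `S` is a Fourier multiplier with the (essentially bounded) symbol `s`:
`(S f)^ = s f^` almost everywhere, for every `f` in `L²(ℝᵈ)`. -/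
def IsFourierMultiplier (S : L2 d →L[ℂ] L2 d) (s : Rd d → ℂ) : Prop :=
  MemLp s ∞ volume ∧
    ∀ f : L2 d, ⇑(𝓕 (S f) : L2 d) =ᵐ[volume] fun ξ => s ξ * (𝓕 f : L2 d) ξ

/-- The term `conj (f^(A^{*j} ξ)) g^(A^{*j} η)`. -/
def crossTerm (A : GL (Fin d) ℝ) (f g : L2 d) (j : ℤ) (ξ η : Rd d) : ℂ :=
  conj ((𝓕 f : L2 d) (adjPow A j ξ)) * (𝓕 g : L2 d) (adjPow A j η)

end Euclid

end

/-
Averaging over the digits of `A` expresses the Bessel sum of the quasi-affine system over the scales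
`n ≥ -(N + 1)` through those over `n ≥ -N`, so the affine Bessel bound carries over to the
quasi-affine system, and the Calderón sums `∑ j, |ψ^(A^{*j} ξ)|²` are essentially bounded.

The function `β ↦ ⟪T_β g, θ^q T_β f⟫` is `ℤᵈ`-periodic. Its Fourier coefficient at `k`, here called
a frequency-shift component, pairs `f^(ξ + k)` with `g^(ξ)`: at `k = 0` through the symbol `s`, at
`k ∉ A^* ℤᵈ` through the symbol of condition 6, and all other `k ≠ 0` are reduced to the latter by
dilation because `A` is expansive. Hence condition 6 says that `θ^q` is the multiplier of `s`.

The operators `θ` and `θ^q` differ only in layers of negative index, whose contribution to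
`⟪D_A^N g, · D_A^N f⟫` vanishes as `N → ∞`, since `D_A^N f` concentrates at a point. If `θ^q`
commutes with `D_A`, the difference `θ - θ^q` is therefore zero. If `θ` commutes with all `T_β`, the
same limit shows that the components of `θ^q` at `k ≠ 0` vanish. Finally, `θ` always commutes with
`D_A`, so that commuting with `ℤᵈ`-translations extends to the lattices `A^{-N} ℤᵈ`, whose union is
dense.
-/

noncomputable section

/-! ### Translations, dilations and the Fourier transform -/

section Operators

variable {d : ℕ}

theorem matAct_mul_apply (M N : Matrix (Fin d) (Fin d) ℝ) (x : Rd d) :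
    matAct (M * N) x = matAct M (matAct N x) := by
  simp [matAct, Matrix.toLpLin_apply, Matrix.mulVec_mulVec]

@[simp] theorem matAct_one_apply (x : Rd d) : matAct (1 : Matrix (Fin d) (Fin d) ℝ) x = x := by
  simp [matAct]

theorem inner_matAct_left (M : Matrix (Fin d) (Fin d) ℝ) (x y : Rd d) :
    ⟪matAct M x, y⟫_ℝ = ⟪x, matAct M.transpose y⟫_ℝ := by
  have := LinearMap.adjoint_inner_right (matAct M) x y
  rw [← this, matAct, ← Matrix.toEuclideanLin_conjTranspose_eq_adjoint,
    Matrix.conjTranspose_eq_transpose_of_trivial, matAct]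

@[fun_prop] theorem continuous_matAct (M : Matrix (Fin d) (Fin d) ℝ) : Continuous (matAct M) :=
  LinearMap.continuous_of_finiteDimensional _

theorem matAct_inv_matAct (A : GL (Fin d) ℝ) (x : Rd d) :
    matAct (A⁻¹).val (matAct A.val x) = x := by
  rw [← matAct_mul_apply, ← Units.val_mul, inv_mul_cancel, Units.val_one, matAct_one_apply]

theorem matAct_matAct_inv (A : GL (Fin d) ℝ) (x : Rd d) :
    matAct A.val (matAct (A⁻¹).val x) = x := by
  rw [← matAct_mul_apply, ← Units.val_mul, mul_inv_cancel, Units.val_one, matAct_one_apply]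

theorem adjPow_zero (A : GL (Fin d) ℝ) (ξ : Rd d) : adjPow A 0 ξ = ξ := by
  simp [adjPow]

theorem adjPow_adjPow (A : GL (Fin d) ℝ) (j k : ℤ) (ξ : Rd d) :
    adjPow A j (adjPow A k ξ) = adjPow A (j + k) ξ := by
  rw [adjPow, adjPow, ← matAct_mul_apply, ← Matrix.transpose_mul, ← Units.val_mul, ← zpow_add,
    add_comm, adjPow]

theorem adjPow_add (A : GL (Fin d) ℝ) (j : ℤ) (ξ η : Rd d) :
    adjPow A j (ξ + η) = adjPow A j ξ + adjPow A j η := map_add _ _ _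

theorem adjPow_injective (A : GL (Fin d) ℝ) (j : ℤ) : Function.Injective (adjPow A j) := by
  intro x y h
  have := congrArg (adjPow A (-j)) h
  simpa [adjPow_adjPow, adjPow_zero] using this

@[fun_prop] theorem continuous_adjPow (A : GL (Fin d) ℝ) (j : ℤ) : Continuous (adjPow A j) :=
  continuous_matAct _

/-- The transposed matrix as an element of the general linear group. -/
def glTranspose (A : GL (Fin d) ℝ) : GL (Fin d) ℝ where
  val := A.val.transpose
  inv := (A⁻¹).val.transpose
  val_inv := by rw [← Matrix.transpose_mul, ← Units.val_mul, inv_mul_cancel, Units.val_one,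
    Matrix.transpose_one]
  inv_val := by rw [← Matrix.transpose_mul, ← Units.val_mul, mul_inv_cancel, Units.val_one,
    Matrix.transpose_one]

theorem quasiMeasurePreserving_adjPow (A : GL (Fin d) ℝ) (j : ℤ) :
    Measure.QuasiMeasurePreserving (adjPow A j) (volume : Measure (Rd d)) volume :=
  quasiMeasurePreserving_matAct (glTranspose (A ^ j))

/-- An invertible matrix as a homeomorphic linear automorphism. -/
def matActCLE (A : GL (Fin d) ℝ) : Rd d ≃L[ℝ] Rd d :=
  (LinearEquiv.ofLinearMap (matAct A.val) (matAct (A⁻¹).val)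
    (LinearMap.ext (matAct_matAct_inv A))
    (LinearMap.ext (matAct_inv_matAct A))).toContinuousLinearEquiv

theorem measurableEmbedding_matAct (A : GL (Fin d) ℝ) : MeasurableEmbedding (matAct A.val) :=
  (matActCLE A).toHomeomorph.measurableEmbedding

theorem abs_det_pos (A : GL (Fin d) ℝ) : 0 < |A.val.det| := abs_pos.2 (gl_det_ne_zero A)

theorem integral_comp_matAct {E : Type*} [NormedAddCommGroup E] [NormedSpace ℝ E]
    (A : GL (Fin d) ℝ) (u : Rd d → E) :
    ∫ x, u (matAct A.val x) = |A.val.det|⁻¹ • ∫ x, u x := by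
  rw [← (measurableEmbedding_matAct A).integral_map, map_matAct, integral_smul_measure,
    abs_inv, ENNReal.toReal_ofReal (by positivity)]

theorem lintegral_comp_matAct (A : GL (Fin d) ℝ) (u : Rd d → ℝ≥0∞) :
    ∫⁻ x, u (matAct A.val x) = ENNReal.ofReal |A.val.det|⁻¹ * ∫⁻ x, u x := by
  rw [← (measurableEmbedding_matAct A).lintegral_map, map_matAct, lintegral_smul_measure,
    abs_inv, smul_eq_mul]

theorem integral_comp_adjPow {E : Type*} [NormedAddCommGroup E] [NormedSpace ℝ E]
    (A : GL (Fin d) ℝ) (j : ℤ) (u : Rd d → E) :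
    ∫ x, u (adjPow A j x) = |(A ^ j).val.det|⁻¹ • ∫ x, u x := by
  have := integral_comp_matAct (glTranspose (A ^ j)) u
  rwa [show (glTranspose (A ^ j)).val.det = (A ^ j).val.det from Matrix.det_transpose _] at this

theorem dilation_ae (A : GL (Fin d) ℝ) (f : L2 d) :
    dilation A f =ᵐ[volume] fun x => (Real.sqrt |A.val.det| : ℂ) * f (matAct A.val x) :=
  scaledComp_ae _ _ _ _

theorem dilationR_ae (A : GL (Fin d) ℝ) (f : L2 d) :
    dilationR A f =ᵐ[volume] fun x => ((|A.val.det| : ℝ) : ℂ) * f (matAct A.val x) :=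
  scaledComp_ae _ _ _ _

theorem scaledComp_mul {a b c : ℝ} (ha : a ≠ 0) (hb : b ≠ 0) (hc : c ≠ 0) (hcab : c = a * b)
    (A B : GL (Fin d) ℝ) : scaledComp c hc (A * B) = scaledComp b hb B * scaledComp a ha A := by
  refine ContinuousLinearEquiv.ext (funext fun f => Lp.ext ?_)
  filter_upwards [scaledComp_ae c hc (A * B) f, scaledComp_ae b hb B (scaledComp a ha A f),
    (quasiMeasurePreserving_matAct B).ae_eq_comp (scaledComp_ae a ha A f)] with x hAB hB hA
  simp only [Function.comp_apply] at hA
  refine hAB.trans (Eq.trans ?_ hB.symm)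
  rw [hA, Units.val_mul, matAct_mul_apply, hcab]
  push_cast
  ring

theorem dilation_mul (A B : GL (Fin d) ℝ) : dilation (A * B) = dilation B * dilation A :=
  scaledComp_mul _ _ _
    (by rw [Units.val_mul, Matrix.det_mul, abs_mul, Real.sqrt_mul (abs_nonneg _)]) A B

theorem dilationR_mul (A B : GL (Fin d) ℝ) : dilationR (A * B) = dilationR B * dilationR A :=
  scaledComp_mul _ _ _ (by rw [Units.val_mul, Matrix.det_mul, abs_mul]) A B

theorem zpow_map_of_map_mul_rev {G K : Type*} [Group G] [Group K] (φ : G → K)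
    (h : ∀ a b, φ (a * b) = φ b * φ a) (a : G) (n : ℤ) : φ a ^ n = φ (a ^ n) := by
  have := map_zpow (MonoidHom.mk' (fun g => MulOpposite.op (φ g))
    (fun a b => by rw [h, MulOpposite.op_mul])) a n
  simp only [MonoidHom.mk'_apply] at this
  exact (MulOpposite.op_injective (by rw [this, MulOpposite.op_zpow])).symm

theorem dilation_zpow (A : GL (Fin d) ℝ) (n : ℤ) : dilation A ^ n = dilation (A ^ n) :=
  zpow_map_of_map_mul_rev dilation dilation_mul A n

theorem dilationR_zpow (A : GL (Fin d) ℝ) (n : ℤ) : dilationR A ^ n = dilationR (A ^ n) :=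
  zpow_map_of_map_mul_rev dilationR dilationR_mul A n

theorem dilation_dilation (A B : GL (Fin d) ℝ) (f : L2 d) :
    dilation A (dilation B f) = dilation (B * A) f := by
  rw [dilation_mul]; rfl

theorem dilation_one (f : L2 d) : dilation (1 : GL (Fin d) ℝ) f = f := by
  have := dilation_zpow (1 : GL (Fin d) ℝ) 0
  rw [zpow_zero, zpow_zero] at this
  rw [← this]; rfl

theorem dilationR_eq (A : GL (Fin d) ℝ) (f : L2 d) :
    dilationR A f = (Real.sqrt |A.val.det| : ℂ) • dilation A f := by
  refine Lp.ext ?_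
  filter_upwards [dilationR_ae A f, dilation_ae A f,
    Lp.coeFn_smul (Real.sqrt |A.val.det| : ℂ) (dilation A f)] with x hR hD hsmul
  rw [hR, hsmul, Pi.smul_apply, hD, smul_eq_mul, ← mul_assoc, ← Complex.ofReal_mul,
    Real.mul_self_sqrt (abs_nonneg _)]

theorem inner_dilation_dilation (A : GL (Fin d) ℝ) (f g : L2 d) :
    ⟪dilation A f, dilation A g⟫_ℂ = ⟪f, g⟫_ℂ := by
  have hsq : (Real.sqrt |A.val.det| : ℂ) * Real.sqrt |A.val.det| = (|A.val.det| : ℝ) := by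
    rw [← Complex.ofReal_mul, Real.mul_self_sqrt (abs_nonneg _)]
  have hpt : ∀ᵐ x : Rd d, ⟪dilation A f x, dilation A g x⟫_ℂ
      = (|A.val.det| : ℝ) * ⟪f (matAct A.val x), g (matAct A.val x)⟫_ℂ := by
    filter_upwards [dilation_ae A f, dilation_ae A g] with x hf hg
    rw [hf, hg, ← hsq]
    simp only [RCLike.inner_apply, map_mul, Complex.conj_ofReal]
    ring
  rw [L2.inner_def, L2.inner_def, integral_congr_ae hpt, integral_const_mul,
    integral_comp_matAct A fun y => ⟪f y, g y⟫_ℂ, Complex.real_smul, ← mul_assoc,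
    ← Complex.ofReal_mul, mul_inv_cancel₀ (abs_det_ne_zero A), Complex.ofReal_one, one_mul]

theorem norm_dilation (A : GL (Fin d) ℝ) (f : L2 d) : ‖dilation A f‖ = ‖f‖ := by
  rw [@norm_eq_sqrt_re_inner ℂ, inner_dilation_dilation, ← @norm_eq_sqrt_re_inner ℂ]

theorem inner_dilation_left (A : GL (Fin d) ℝ) (f g : L2 d) :
    ⟪dilation A f, g⟫_ℂ = ⟪f, dilation A⁻¹ g⟫_ℂ := by
  rw [← inner_dilation_dilation A f, dilation_dilation, inv_mul_cancel, dilation_one]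

theorem inner_dilation_right (A : GL (Fin d) ℝ) (f g : L2 d) :
    ⟪f, dilation A g⟫_ℂ = ⟪dilation A⁻¹ f, g⟫_ℂ := by
  rw [inner_dilation_left, inv_inv]

theorem norm_translation (α : Rd d) (f : L2 d) : ‖translation α f‖ = ‖f‖ :=
  (Lp.compMeasurePreservingₗᵢ ℂ (fun x : Rd d => x - α)
    (measurePreserving_sub_right volume α)).norm_map f

theorem inner_translation_translation (α : Rd d) (f g : L2 d) :
    ⟪translation α f, translation α g⟫_ℂ = ⟪f, g⟫_ℂ :=
  (Lp.compMeasurePreservingₗᵢ ℂ (fun x : Rd d => x - α)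
    (measurePreserving_sub_right volume α)).inner_map_map f g

theorem translation_translation (α β : Rd d) (f : L2 d) :
    translation α (translation β f) = translation (α + β) f := by
  refine Lp.ext ?_
  filter_upwards [translation_ae α (translation β f), translation_ae (α + β) f,
    (measurePreserving_sub_right volume α).quasiMeasurePreserving.ae_eq_comp
      (translation_ae β f)] with x hα hαβ hβ
  rw [hα, hαβ]
  simpa [sub_sub] using hβ

theorem translation_zero (f : L2 d) : translation (0 : Rd d) f = f := by
  refine Lp.ext ?_
  filter_upwards [translation_ae 0 f] with x hx
  rw [hx, sub_zero]

theorem inner_translation_left (α : Rd d) (f g : L2 d) :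
    ⟪translation α f, g⟫_ℂ = ⟪f, translation (-α) g⟫_ℂ := by
  rw [← inner_translation_translation α f, translation_translation, add_neg_cancel,
    translation_zero]

theorem dilation_translation (A : GL (Fin d) ℝ) (α : Rd d) (f : L2 d) :
    dilation A (translation α f) = translation (matAct (A⁻¹).val α) (dilation A f) := by
  refine Lp.ext ?_
  filter_upwards [translation_ae (matAct (A⁻¹).val α) (dilation A f),
    dilation_ae A (translation α f),
    (quasiMeasurePreserving_matAct A).ae_eq_comp (translation_ae α f),
    (measurePreserving_sub_right volume (matAct (A⁻¹).val α)).quasiMeasurePreserving.ae_eq_comp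
      (dilation_ae A f)] with x hTD hDT hT hD
  simp only [Function.comp_apply] at hT hD
  rw [hTD, hDT, hT, hD, map_sub, matAct_matAct_inv]

theorem translation_dilation (A : GL (Fin d) ℝ) (α : Rd d) (f : L2 d) :
    translation α (dilation A f) = dilation A (translation (matAct A.val α) f) := by
  rw [dilation_translation, matAct_inv_matAct]

theorem continuous_translation (f : L2 d) : Continuous fun α : Rd d => translation α f := by
  have hg : Continuous fun α : Rd d =>
      (⟨fun x => x - α, by fun_prop⟩ : C(Rd d, Rd d)) :=
    ContinuousMap.continuous_of_continuous_uncurry _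
      (continuous_snd.sub continuous_fst)
  exact continuous_const.compMeasurePreservingLp hg
    (fun α => measurePreserving_sub_right volume α) (by norm_num)

end Operators

section Fourier

variable {d : ℕ}

/-- The exponential `ξ ↦ exp (2 π i a · ξ)`. -/
def planeWave (a ξ : Rd d) : ℂ := (Real.fourierChar ⟪a, ξ⟫_ℝ : ℂ)

@[simp] theorem norm_planeWave (a ξ : Rd d) : ‖planeWave a ξ‖ = 1 := Circle.norm_coe _

theorem planeWave_add_left (a b ξ : Rd d) :
    planeWave (a + b) ξ = planeWave a ξ * planeWave b ξ := by
  simp [planeWave, inner_add_left, AddChar.map_add_eq_mul]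

theorem planeWave_comm (a ξ : Rd d) : planeWave a ξ = planeWave ξ a := by
  rw [planeWave, real_inner_comm, planeWave]

theorem planeWave_add_right (a ξ η : Rd d) :
    planeWave a (ξ + η) = planeWave a ξ * planeWave a η := by
  rw [planeWave_comm, planeWave_add_left, planeWave_comm ξ, planeWave_comm η]

@[simp] theorem planeWave_zero_left (ξ : Rd d) : planeWave 0 ξ = 1 := by simp [planeWave]

theorem planeWave_neg_left (a ξ : Rd d) : planeWave (-a) ξ = conj (planeWave a ξ) := by
  rw [planeWave, inner_neg_left, AddChar.map_neg_eq_inv, Circle.coe_inv_eq_conj, planeWave]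

theorem planeWave_neg_right (a ξ : Rd d) : planeWave a (-ξ) = conj (planeWave a ξ) := by
  rw [planeWave_comm, planeWave_neg_left, planeWave_comm]

@[fun_prop] theorem continuous_planeWave (a : Rd d) : Continuous (planeWave a) := by
  unfold planeWave
  fun_prop

theorem memLp_planeWave (a : Rd d) : MemLp (planeWave a) ∞ volume :=
  memLp_top_of_bound (by fun_prop) 1 (.of_forall fun ξ => (norm_planeWave a ξ).le)

theorem planeWave_mul_conj (a ξ : Rd d) : planeWave a ξ * conj (planeWave a ξ) = 1 := by
  rw [← planeWave_neg_left, ← planeWave_add_left, add_neg_cancel, planeWave_zero_left]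

/-- Multiplication by an essentially bounded function, as an operator on `L²`. -/
def mulOp (s : Rd d → ℂ) (hs : MemLp s ∞ volume) : L2 d →L[ℂ] L2 d :=
  (ContinuousLinearMap.mul ℂ ℂ).holderL volume ∞ 2 2 hs.toLp

theorem mulOp_ae (s : Rd d → ℂ) (hs : MemLp s ∞ volume) (f : L2 d) :
    mulOp s hs f =ᵐ[volume] fun ξ => s ξ * f ξ := by
  filter_upwards [(ContinuousLinearMap.mul ℂ ℂ).coeFn_holder (r := 2) hs.toLp f,
    hs.coeFn_toLp] with x hmul hs
  rw [mulOp, ContinuousLinearMap.holderL_apply_apply, hmul, hs, ContinuousLinearMap.mul_apply']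

theorem L2_induction_schwartz {p : L2 d → Prop} (hp : IsClosed {f | p f})
    (h : ∀ u : SchwartzMap (Rd d) ℂ, p (u.toLp 2)) (f : L2 d) : p f :=
  DenseRange.induction_on (p := p)
    (SchwartzMap.denseRange_toLpCLM (E := Rd d) (F := ℂ) (p := 2) (μ := volume)
      ENNReal.ofNat_ne_top) f hp h

theorem continuous_fourier_L2 : Continuous fun f : L2 d => (𝓕 f : L2 d) :=
  (Lp.fourierTransformₗᵢ (Rd d) ℂ).continuous

theorem fourier_smul_L2 (c : ℂ) (f : L2 d) : (𝓕 (c • f) : L2 d) = c • (𝓕 f : L2 d) :=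
  (Lp.fourierTransformₗᵢ (Rd d) ℂ).map_smul c f

theorem fourier_L2_injective {f g : L2 d} (h : (𝓕 f : L2 d) =ᵐ[volume] (𝓕 g : L2 d)) : f = g :=
  (Lp.fourierTransformₗᵢ (Rd d) ℂ).injective (Lp.ext h)

theorem inner_eq_integral_fourier (f g : L2 d) :
    ⟪f, g⟫_ℂ = ∫ ξ, conj ((𝓕 f : L2 d) ξ) * (𝓕 g : L2 d) ξ := by
  rw [← Lp.inner_fourier_eq, L2.inner_def]
  exact integral_congr_ae (.of_forall fun ξ => mul_comm _ _)

theorem fourier_toLp_ae (u : SchwartzMap (Rd d) ℂ) :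
    (𝓕 (u.toLp 2 : L2 d) : L2 d) =ᵐ[volume] 𝓕 (u : Rd d → ℂ) := by
  rw [SchwartzMap.toLp_fourier_eq]
  exact SchwartzMap.coeFn_toLp _ _ _

theorem fourier_comp_sub (u : Rd d → ℂ) (α ξ : Rd d) :
    𝓕 (fun x => u (x - α)) ξ = planeWave (-α) ξ * 𝓕 u ξ := by
  rw [Real.fourier_eq, Real.fourier_eq, ← integral_const_mul, ← integral_add_right_eq_self _ α]
  refine integral_congr_ae (.of_forall fun x => ?_)
  have hchar : ((Real.fourierChar (-⟪x + α, ξ⟫_ℝ) : Circle) : ℂ)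
      = planeWave (-α) ξ * (Real.fourierChar (-⟪x, ξ⟫_ℝ) : ℂ) := by
    rw [planeWave, ← Circle.coe_mul, ← AddChar.map_add_eq_mul, inner_add_left, inner_neg_left,
      neg_add, add_comm]
  simp only [Circle.smul_def, hchar, smul_eq_mul, mul_assoc, add_sub_cancel_right]

theorem fourier_comp_matAct (M : GL (Fin d) ℝ) (u : Rd d → ℂ) (ξ : Rd d) :
    𝓕 (fun x => u (matAct M.val x)) ξ
      = ((|M.val.det|⁻¹ : ℝ) : ℂ) * 𝓕 u (matAct (glTranspose M⁻¹).val ξ) := by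
  have hinner : ∀ x, ⟪matAct M.val x, matAct (glTranspose M⁻¹).val ξ⟫_ℝ = ⟪x, ξ⟫_ℝ := fun x => by
    rw [real_inner_comm]
    change ⟪matAct (M⁻¹).val.transpose ξ, _⟫_ℝ = _
    rw [inner_matAct_left, Matrix.transpose_transpose, matAct_inv_matAct, real_inner_comm]
  rw [Real.fourier_eq, Real.fourier_eq, ← Complex.real_smul, ← integral_comp_matAct M]
  simp only [hinner]

theorem fourier_translation_ae (α : Rd d) (f : L2 d) :
    (𝓕 (translation α f) : L2 d) =ᵐ[volume] fun ξ => planeWave (-α) ξ * (𝓕 f : L2 d) ξ := by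
  suffices h : (𝓕 (translation α f) : L2 d)
      = mulOp (planeWave (-α)) (memLp_planeWave _) (𝓕 f : L2 d) by
    rw [h]
    exact mulOp_ae _ _ _
  refine L2_induction_schwartz (p := fun f => (𝓕 (translation α f) : L2 d)
    = mulOp (planeWave (-α)) (memLp_planeWave _) (𝓕 f : L2 d)) ?_ (fun u => ?_) f
  · exact isClosed_eq (continuous_fourier_L2.comp (translation α).continuous)
      ((mulOp _ _).continuous.comp continuous_fourier_L2)
  · have hg : (fun x : Rd d => x - α).HasTemperateGrowth := by fun_prop
    let v : SchwartzMap (Rd d) ℂ := SchwartzMap.compCLMOfAntilipschitz ℂ hg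
      (Isometry.of_dist_eq fun x y => dist_sub_right x y α).antilipschitz u
    have hv : translation α (u.toLp 2) = v.toLp 2 := by
      refine Lp.ext ?_
      filter_upwards [translation_ae α (u.toLp 2), v.coeFn_toLp 2,
        (measurePreserving_sub_right volume α).quasiMeasurePreserving.ae_eq_comp
          (u.coeFn_toLp 2)] with x htrans hvx hux
      exact htrans.trans (hux.trans hvx.symm)
    rw [hv]
    refine Lp.ext ?_
    filter_upwards [fourier_toLp_ae u, fourier_toLp_ae v,
      mulOp_ae (planeWave (-α)) (memLp_planeWave _) (𝓕 (u.toLp 2 : L2 d) : L2 d)]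
      with ξ hu hvξ hmul
    rw [hmul, hvξ, hu]
    exact fourier_comp_sub u α ξ

theorem fourier_compCLM (M : GL (Fin d) ℝ) (f : L2 d) :
    (𝓕 (compCLM M f) : L2 d)
      = ((|M.val.det|⁻¹ : ℝ) : ℂ) • compCLM (glTranspose M⁻¹) (𝓕 f : L2 d) := by
  refine L2_induction_schwartz (p := fun f => (𝓕 (compCLM M f) : L2 d)
      = ((|M.val.det|⁻¹ : ℝ) : ℂ) • compCLM (glTranspose M⁻¹) (𝓕 f : L2 d)) ?_ (fun u => ?_) f
  · exact isClosed_eq (continuous_fourier_L2.comp (compCLM M).continuous)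
      (((compCLM (glTranspose M⁻¹)).continuous.comp continuous_fourier_L2).const_smul
        ((|M.val.det|⁻¹ : ℝ) : ℂ))
  · let v : SchwartzMap (Rd d) ℂ :=
      SchwartzMap.compCLMOfContinuousLinearEquiv ℂ (matActCLE M) u
    have hv : compCLM M (u.toLp 2) = v.toLp 2 := by
      refine Lp.ext ?_
      filter_upwards [compCLM_ae M (u.toLp 2), v.coeFn_toLp 2,
        (quasiMeasurePreserving_matAct M).ae_eq_comp (u.coeFn_toLp 2)] with x hcomp hvx hux
      exact hcomp.trans (hux.trans hvx.symm)
    rw [hv]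
    refine Lp.ext ?_
    filter_upwards [fourier_toLp_ae v, Lp.coeFn_smul ((|M.val.det|⁻¹ : ℝ) : ℂ)
      (compCLM (glTranspose M⁻¹) (𝓕 (u.toLp 2 : L2 d) : L2 d)),
      compCLM_ae (glTranspose M⁻¹) (𝓕 (u.toLp 2 : L2 d) : L2 d),
      (quasiMeasurePreserving_matAct (glTranspose M⁻¹)).ae_eq_comp (fourier_toLp_ae u)]
      with ξ hvξ hsmul hcomp hu
    rw [hvξ, hsmul, Pi.smul_apply, hcomp, smul_eq_mul]
    exact (fourier_comp_matAct M u ξ).trans (congrArg _ hu.symm)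

theorem dilationR_eq_smul_compCLM (M : GL (Fin d) ℝ) (f : L2 d) :
    dilationR M f = ((|M.val.det| : ℝ) : ℂ) • compCLM M f := rfl

theorem dilation_eq_smul_compCLM (M : GL (Fin d) ℝ) (f : L2 d) :
    dilation M f = ((Real.sqrt |M.val.det| : ℝ) : ℂ) • compCLM M f := rfl

theorem matAct_glTranspose_inv_zpow (A : GL (Fin d) ℝ) (n : ℤ) (ξ : Rd d) :
    matAct (glTranspose (A ^ n)⁻¹).val ξ = adjPow A (-n) ξ := by
  rw [← zpow_neg]
  rfl

theorem fourier_dilationR_zpow_ae (A : GL (Fin d) ℝ) (n : ℤ) (f : L2 d) :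
    (𝓕 ((dilationR A ^ n) f) : L2 d) =ᵐ[volume] fun ξ => (𝓕 f : L2 d) (adjPow A (-n) ξ) := by
  rw [dilationR_zpow, dilationR_eq_smul_compCLM, fourier_smul_L2, fourier_compCLM, smul_smul,
    ← Complex.ofReal_mul, mul_inv_cancel₀ (abs_det_ne_zero _), Complex.ofReal_one, one_smul]
  filter_upwards [compCLM_ae (glTranspose (A ^ n)⁻¹) (𝓕 f : L2 d)] with ξ h
  rw [h, matAct_glTranspose_inv_zpow]

theorem fourier_dilation_zpow_ae (A : GL (Fin d) ℝ) (n : ℤ) (f : L2 d) :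
    (𝓕 ((dilation A ^ n) f) : L2 d) =ᵐ[volume]
      fun ξ => (((Real.sqrt |(A ^ n).val.det|)⁻¹ : ℝ) : ℂ) * (𝓕 f : L2 d) (adjPow A (-n) ξ) := by
  rw [dilation_zpow, dilation_eq_smul_compCLM, fourier_smul_L2, fourier_compCLM, smul_smul,
    ← Complex.ofReal_mul]
  have : Real.sqrt |(A ^ n).val.det| * |(A ^ n).val.det|⁻¹ = (Real.sqrt |(A ^ n).val.det|)⁻¹ := by
    have h := Real.sqrt_pos.2 (abs_det_pos (A ^ n))
    nth_rewrite 2 [← Real.mul_self_sqrt (abs_nonneg (A ^ n).val.det)]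
    field_simp
  rw [this]
  filter_upwards [compCLM_ae (glTranspose (A ^ n)⁻¹) (𝓕 f : L2 d),
    Lp.coeFn_smul (((Real.sqrt |(A ^ n).val.det|)⁻¹ : ℝ) : ℂ)
      (compCLM (glTranspose (A ^ n)⁻¹) (𝓕 f : L2 d))] with ξ hcomp hsmul
  rw [hsmul, Pi.smul_apply, hcomp, matAct_glTranspose_inv_zpow, smul_eq_mul]

end Fourier

/-! ### Fourier series on the unit cube -/

section Parseval

variable {d : ℕ}

/-- The unit cube `(0, 1]ᵈ`, a fundamental domain of `ℤᵈ`. -/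
def unitCube (d : ℕ) : Set (Rd d) := {x | ∀ i, x i ∈ Set.Ioc (0 : ℝ) 1}

theorem preimage_toLp_unitCube :
    (WithLp.toLp 2 : (Fin d → ℝ) → Rd d) ⁻¹' unitCube d
      = {x : Fin d → ℝ | ∀ i, x i ∈ Set.Ioc (0 : ℝ) (0 + 1)} := by
  ext x
  simp [unitCube]

theorem measurableSet_unitCube : MeasurableSet (unitCube d) := by
  have hInter : unitCube d = ⋂ i, (fun x : Rd d => x i) ⁻¹' Set.Ioc (0 : ℝ) 1 := by
    ext x; simp [unitCube]
  rw [hInter]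
  exact MeasurableSet.iInter fun i =>
    (by fun_prop : Measurable fun x : Rd d => x i) measurableSet_Ioc

theorem volume_unitCube : volume (unitCube d) = 1 := by
  rw [← (PiLp.volume_preserving_toLp (Fin d)).measure_preimage
    measurableSet_unitCube.nullMeasurableSet, preimage_toLp_unitCube,
    show {x : Fin d → ℝ | ∀ i, x i ∈ Set.Ioc (0 : ℝ) (0 + 1)}
      = Set.univ.pi fun _ => Set.Ioc (0 : ℝ) (0 + 1) by ext x; simp, Real.volume_pi_Ioc]
  simp

instance isFiniteMeasure_restrict_unitCube :
    IsFiniteMeasure ((volume : Measure (Rd d)).restrict (unitCube d)) :=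
  ⟨by simp [volume_unitCube]⟩

attribute [local instance] instMeasureSpaceUnitAddCircle

/-- The section of `ℝᵈ → ℝᵈ / ℤᵈ` with values in the unit cube, through which the Fourier series
of the torus act on functions on the cube. -/
def torusSection (t : UnitAddTorus (Fin d)) : Rd d :=
  WithLp.toLp 2 (UnitAddTorus.measurableEquivPiIoc (fun _ => (0 : ℝ)) t).1

theorem measurableSet_setOf_forall_mem_Ioc :
    MeasurableSet {x : Fin d → ℝ | ∀ i, x i ∈ Set.Ioc (0 : ℝ) (0 + 1)} :=
  MeasurableSet.univ_pi' fun _ => measurableSet_Ioc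

theorem measurableEmbedding_torusSection : MeasurableEmbedding (torusSection (d := d)) :=
  (MeasurableEquiv.toLp 2 (Fin d → ℝ)).measurableEmbedding.comp
    ((MeasurableEmbedding.subtype_coe measurableSet_setOf_forall_mem_Ioc).comp
      (UnitAddTorus.measurableEquivPiIoc (fun _ : Fin d => (0 : ℝ))).measurableEmbedding)

theorem measurePreserving_torusSection :
    MeasurePreserving (torusSection (d := d)) volume (volume.restrict (unitCube d)) := by
  have hcoe : MeasurePreserving (Subtype.val :
      {x : Fin d → ℝ // ∀ i, x i ∈ Set.Ioc (0 : ℝ) (0 + 1)} → Fin d → ℝ)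
      (Measure.comap Subtype.val volume)
      (volume.restrict {x : Fin d → ℝ | ∀ i, x i ∈ Set.Ioc (0 : ℝ) (0 + 1)}) :=
    ⟨measurable_subtype_coe, map_comap_subtype_coe measurableSet_setOf_forall_mem_Ioc volume⟩
  have htoLp := (PiLp.volume_preserving_toLp (Fin d)).restrict_preimage
    (measurableSet_unitCube (d := d))
  rw [preimage_toLp_unitCube] at htoLp
  exact htoLp.comp (hcoe.comp (UnitAddTorus.measurePreserving_equivPiIoc fun _ : Fin d => (0 : ℝ)))

theorem mFourier_eq_planeWave (n : Fin d → ℤ) (t : UnitAddTorus (Fin d)) :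
    UnitAddTorus.mFourier n t = planeWave (intVec n) (torusSection t) := by
  have hcoe : ∀ i, ((torusSection t i : ℝ) : UnitAddCircle) = t i := fun i =>
    (AddCircle.equivIoc 1 (0 : ℝ)).symm_apply_apply (t i)
  have hcoord : ∀ i, fourier (n i) (t i)
      = Complex.exp (2 * Real.pi * Complex.I * (n i * torusSection t i)) := by
    intro i
    rw [← hcoe i, fourier_coe_apply]
    congr 1
    push_cast
    ring
  simp only [UnitAddTorus.mFourier, ContinuousMap.coe_mk]
  rw [Finset.prod_congr rfl fun i _ => hcoord i, ← Complex.exp_sum, planeWave,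
    Real.fourierChar_apply, ← Finset.mul_sum]
  congr 1
  simp only [intVec, PiLp.inner_apply, RCLike.inner_apply, conj_trivial]
  push_cast
  rw [Finset.sum_congr rfl fun i _ => mul_comm _ _]
  ring

theorem intVec_neg (k : Fin d → ℤ) : intVec (-k) = -intVec k := by
  ext i; simp [intVec]

theorem intVec_add (k l : Fin d → ℤ) : intVec (k + l) = intVec k + intVec l := by
  ext i; simp [intVec]

theorem intVec_sub (k l : Fin d → ℤ) : intVec (k - l) = intVec k - intVec l := by
  ext i; simp [intVec]

@[simp] theorem intVec_zero : intVec (0 : Fin d → ℤ) = 0 := by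
  ext i; simp [intVec]

theorem intVec_injective : Function.Injective (intVec (d := d)) := by
  intro k l h
  ext i
  have hi := congrArg (fun x : Rd d => x i) h
  simpa [intVec] using hi

theorem planeWave_intVec_intVec (k l : Fin d → ℤ) : planeWave (intVec k) (intVec l) = 1 := by
  have hinner : ⟪intVec k, intVec l⟫_ℝ = ((∑ i, l i * k i : ℤ) : ℝ) := by
    simp [intVec, PiLp.inner_apply]
  rw [planeWave, hinner, Real.fourierChar_apply, Complex.exp_eq_one_iff]
  exact ⟨∑ i, l i * k i, by push_cast; ring⟩

theorem mFourierCoeff_toLp_comp_torusSection {W : Rd d → ℂ}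
    (hW : MemLp (W ∘ torusSection) 2 (volume : Measure (UnitAddTorus (Fin d)))) (n : Fin d → ℤ) :
    UnitAddTorus.mFourierCoeff hW.toLp (-n)
      = ∫ x in unitCube d, planeWave (intVec n) x * W x := by
  rw [UnitAddTorus.mFourierCoeff, ← measurePreserving_torusSection.integral_comp
    measurableEmbedding_torusSection]
  refine integral_congr_ae ?_
  filter_upwards [hW.coeFn_toLp] with t ht
  rw [ht, neg_neg, mFourier_eq_planeWave, smul_eq_mul, Function.comp]

theorem hasSum_unitCube_parseval {U V : Rd d → ℂ}
    (hU : MemLp U 2 (volume.restrict (unitCube d)))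
    (hV : MemLp V 2 (volume.restrict (unitCube d))) :
    HasSum (fun z : Fin d → ℤ => (∫ x in unitCube d, planeWave (intVec z) x * U x)
      * conj (∫ x in unitCube d, planeWave (intVec z) x * V x))
      (∫ x in unitCube d, U x * conj (V x)) := by
  have hU' := hU.comp_measurePreserving measurePreserving_torusSection
  have hV' := hV.comp_measurePreserving measurePreserving_torusSection
  have hinner : ∫ t : UnitAddTorus (Fin d), conj ((MemLp.toLp _ hV') t) * (MemLp.toLp _ hU') t
      = ∫ x in unitCube d, U x * conj (V x) := by
    rw [← measurePreserving_torusSection.integral_comp measurableEmbedding_torusSection]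
    refine integral_congr_ae ?_
    filter_upwards [hU'.coeFn_toLp, hV'.coeFn_toLp] with t htU htV
    rw [htU, htV, mul_comm]
    rfl
  have hparseval := UnitAddTorus.hasSum_prod_mFourierCoeff hV'.toLp hU'.toLp
  rw [hinner] at hparseval
  refine ((Equiv.neg (Fin d → ℤ)).hasSum_iff.2 hparseval).congr_fun fun z => ?_
  simp only [Function.comp, Equiv.neg_apply]
  rw [mFourierCoeff_toLp_comp_torusSection hU', mFourierCoeff_toLp_comp_torusSection hV', mul_comm]

theorem integral_unitCube_planeWave (k : Fin d → ℤ) :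
    ∫ x in unitCube d, planeWave (intVec k) x = if k = 0 then 1 else 0 := by
  have hortho := (orthonormal_iff_ite.1 (UnitAddTorus.orthonormal_mFourier (d := Fin d))) 0 k
  rw [ContinuousMap.inner_toLp] at hortho
  simp only [UnitAddTorus.mFourier_zero] at hortho
  rw [← measurePreserving_torusSection.integral_comp measurableEmbedding_torusSection]
  simp only [eq_comm (a := k)]
  rw [← hortho]
  refine integral_congr_ae (.of_forall fun t => ?_)
  simp [mFourier_eq_planeWave]

end Parseval

section Periodization

variable {d : ℕ}

/-- The lattice points all of whose coordinates have modulus at most `N`; they index the finitely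
many nonzero terms of the periodization of a boundedly supported function. -/
def latticeBox (d N : ℕ) : Finset (Fin d → ℤ) :=
  Fintype.piFinset fun _ => Finset.Icc (-N : ℤ) N

theorem mem_latticeBox {N : ℕ} {k : Fin d → ℤ} : k ∈ latticeBox d N ↔ ∀ i, |k i| ≤ (N : ℤ) := by
  simp [latticeBox, abs_le]

theorem abs_coord_le_norm (x : Rd d) (i : Fin d) : |x i| ≤ ‖x‖ := by
  simpa using PiLp.norm_apply_le x i

theorem mem_latticeBox_of_norm_le {N : ℕ} {k : Fin d → ℤ} (h : ‖intVec k‖ ≤ N) :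
    k ∈ latticeBox d N := by
  refine mem_latticeBox.2 fun i => ?_
  have hi := (abs_coord_le_norm (intVec k) i).trans h
  simp only [intVec] at hi
  exact_mod_cast hi

/-- The translate of the unit cube by the lattice point `k`. -/
def latticeCell (k : Fin d → ℤ) : Set (Rd d) := (fun x : Rd d => x - intVec k) ⁻¹' unitCube d

theorem iUnion_latticeCell : (⋃ k : Fin d → ℤ, latticeCell k) = Set.univ := by
  refine Set.eq_univ_of_forall fun x => Set.mem_iUnion.2 ⟨fun i => ⌈x i⌉ - 1, fun i => ?_⟩
  have hlt := Int.ceil_lt_add_one (x i)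
  have hle := Int.le_ceil (x i)
  simp only [intVec, PiLp.sub_apply, Int.cast_sub, Int.cast_one, Set.mem_Ioc]
  constructor <;> linarith

theorem pairwise_disjoint_latticeCell :
    Pairwise (Function.onFun Disjoint (latticeCell (d := d))) := by
  intro k l hkl
  refine Set.disjoint_left.2 fun x hk hl => hkl (funext fun i => ?_)
  have hki := hk i
  have hli := hl i
  simp only [intVec, PiLp.sub_apply, Set.mem_Ioc] at hki hli
  have hlt : (k i : ℝ) < l i + 1 := by linarith
  have hgt : (l i : ℝ) < k i + 1 := by linarith
  norm_cast at hlt hgt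
  omega

theorem measurableSet_latticeCell (k : Fin d → ℤ) : MeasurableSet (latticeCell k) :=
  (measurable_id.sub_const _) measurableSet_unitCube

theorem setIntegral_latticeCell (w : Rd d → ℂ) (k : Fin d → ℤ) :
    ∫ x in latticeCell k, w x = ∫ x in unitCube d, w (x + intVec k) := by
  have hsub := measurePreserving_sub_right (volume : Measure (Rd d)) (intVec k)
  simpa [latticeCell] using hsub.setIntegral_preimage_emb
    (MeasurableEquiv.subRight (intVec k)).measurableEmbedding (fun x => w (x + intVec k))
    (unitCube d)

theorem hasSum_setIntegral_unitCube {w : Rd d → ℂ} (hw : Integrable w) :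
    HasSum (fun k : Fin d → ℤ => ∫ x in unitCube d, w (x + intVec k)) (∫ x, w x) := by
  have h := hasSum_integral_iUnion (f := w) (μ := volume) measurableSet_latticeCell
    (pairwise_disjoint_latticeCell (d := d)) (by rw [iUnion_latticeCell]; exact hw.integrableOn)
  rw [iUnion_latticeCell, setIntegral_univ] at h
  simpa only [setIntegral_latticeCell] using h

theorem le_norm_add_intVec_of_notMem_latticeBox {N : ℕ} {k : Fin d → ℤ} (hk : k ∉ latticeBox d N)
    {x : Rd d} (hx : x ∈ unitCube d) : (N : ℝ) ≤ ‖x + intVec k‖ := by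
  rw [mem_latticeBox] at hk
  push Not at hk
  obtain ⟨i, hi⟩ := hk
  refine le_trans ?_ (abs_coord_le_norm _ i)
  have hxi := hx i
  simp only [PiLp.add_apply, intVec, Set.mem_Ioc] at hxi ⊢
  rcases le_or_gt 0 (k i) with hki | hki
  · rw [abs_of_nonneg hki] at hi
    have hNk : (N : ℝ) < k i := by exact_mod_cast hi
    rw [abs_of_nonneg] <;> linarith
  · rw [abs_of_neg hki] at hi
    have hNk : (N : ℝ) + 1 ≤ -k i := by exact_mod_cast hi
    rw [abs_of_nonpos] <;> linarith

theorem integral_eq_sum_latticeBox {w : Rd d → ℂ} (hw : Integrable w) {R : ℝ} {N : ℕ}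
    (hN : R < N) (hR : ∀ ξ, R < ‖ξ‖ → w ξ = 0) :
    ∫ x, w x = ∑ k ∈ latticeBox d N, ∫ x in unitCube d, w (x + intVec k) := by
  rw [← (hasSum_setIntegral_unitCube hw).tsum_eq]
  refine tsum_eq_sum fun k hk => setIntegral_eq_zero_of_forall_eq_zero fun x hx => ?_
  exact hR _ (hN.trans_le (le_norm_add_intVec_of_notMem_latticeBox hk hx))

theorem integrable_of_memLp_two_of_bounded_support {u : Rd d → ℂ} (hu : MemLp u 2 volume) {R : ℝ}
    (hR : ∀ ξ, R < ‖ξ‖ → u ξ = 0) : Integrable u := by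
  have hball : IntegrableOn u (Metric.closedBall 0 R) := by
    have : Fact (volume (Metric.closedBall (0 : Rd d) R) < ∞) := ⟨measure_closedBall_lt_top⟩
    exact (hu.restrict _).integrable (by norm_num)
  refine hball.integrable_of_forall_notMem_eq_zero fun x hx => hR x ?_
  simpa using hx

theorem lt_norm_add_of_add_lt_norm {R R' : ℝ} {ξ a : Rd d} (hξ : ‖ξ‖ ≤ R') (ha : R + R' < ‖a‖) :
    R < ‖ξ + a‖ := by
  have htri := norm_sub_le (ξ + a) ξ
  rw [add_sub_cancel_left] at htri
  linarith

theorem mul_conj_eq_zero_of_add_lt_norm {u v : Rd d → ℂ} {R R' : ℝ}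
    (hRu : ∀ ξ, R < ‖ξ‖ → u ξ = 0) (hRv : ∀ ξ, R' < ‖ξ‖ → v ξ = 0) {a : Rd d}
    (ha : R + R' < ‖a‖) (ξ : Rd d) : u (ξ + a) * conj (v ξ) = 0 := by
  rcases lt_or_ge R' ‖ξ‖ with hξ | hξ
  · simp [hRv ξ hξ]
  · rw [hRu _ (lt_norm_add_of_add_lt_norm hξ ha), zero_mul]

/-- The periodization `∑ k, w (x + k)` over the lattice `ℤᵈ`. -/
def periodization (w : Rd d → ℂ) (x : Rd d) : ℂ := ∑' k : Fin d → ℤ, w (x + intVec k)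

theorem periodization_add_intVec (w : Rd d → ℂ) (x : Rd d) (k : Fin d → ℤ) :
    periodization w (x + intVec k) = periodization w x := by
  rw [periodization, periodization, ← (Equiv.addLeft k).tsum_eq fun l => w (x + intVec l)]
  simp [intVec_add, add_assoc]

theorem periodization_eq_sum_of_mem_unitCube {w : Rd d → ℂ} {R : ℝ} {N : ℕ} (hN : R < N)
    (hR : ∀ ξ, R < ‖ξ‖ → w ξ = 0) {x : Rd d} (hx : x ∈ unitCube d) :
    periodization w x = ∑ k ∈ latticeBox d N, w (x + intVec k) :=
  tsum_eq_sum fun _ hk => hR _ (hN.trans_le (le_norm_add_intVec_of_notMem_latticeBox hk hx))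

theorem periodization_eq_sum_of_norm_le {w : Rd d → ℂ} {R R' : ℝ} {N : ℕ} (hN : R + R' ≤ N)
    (hR : ∀ ξ, R < ‖ξ‖ → w ξ = 0) {x : Rd d} (hx : ‖x‖ ≤ R') :
    periodization w x = ∑ k ∈ latticeBox d N, w (x + intVec k) := by
  refine tsum_eq_sum fun k hk => hR _ (lt_norm_add_of_add_lt_norm hx (hN.trans_lt ?_))
  by_contra! hle
  exact hk (mem_latticeBox_of_norm_le hle)

theorem memLp_comp_add_right {w : Rd d → ℂ} (hw : MemLp w 2 volume) (a : Rd d) :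
    MemLp (fun x => w (x + a)) 2 volume :=
  hw.comp_measurePreserving (measurePreserving_add_right volume a)

theorem memLp_periodization {w : Rd d → ℂ} (hw : MemLp w 2 volume) {R : ℝ}
    (hR : ∀ ξ, R < ‖ξ‖ → w ξ = 0) :
    MemLp (periodization w) 2 (volume.restrict (unitCube d)) := by
  obtain ⟨N, hN⟩ := exists_nat_gt R
  have hsum : MemLp (fun x => ∑ k ∈ latticeBox d N, w (x + intVec k)) 2
      (volume.restrict (unitCube d)) :=
    memLp_finsetSum _ fun k _ => (memLp_comp_add_right hw (intVec k)).restrict _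
  refine hsum.ae_eq (ae_restrict_of_forall_mem measurableSet_unitCube fun x hx => ?_)
  exact (periodization_eq_sum_of_mem_unitCube hN hR hx).symm

theorem integral_periodic_mul {g w : Rd d → ℂ} (hg : ∀ x k, g (x + intVec k) = g x)
    (hgw : Integrable fun x => g x * w x) {R : ℝ} (hR : ∀ ξ, R < ‖ξ‖ → w ξ = 0) :
    ∫ x, g x * w x = ∫ x in unitCube d, g x * periodization w x := by
  obtain ⟨N, hN⟩ := exists_nat_gt R
  rw [integral_eq_sum_latticeBox hgw hN fun ξ hξ => by rw [hR ξ hξ, mul_zero],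
    ← integral_finsetSum _ fun k _ => (hgw.comp_add_right (intVec k)).integrableOn]
  refine setIntegral_congr_fun measurableSet_unitCube fun x hx => ?_
  simp only [hg, periodization_eq_sum_of_mem_unitCube hN hR hx, Finset.mul_sum]

theorem integral_planeWave_mul_eq_setIntegral_periodization {w : Rd d → ℂ}
    (hw : MemLp w 2 volume) {R : ℝ} (hR : ∀ ξ, R < ‖ξ‖ → w ξ = 0) (z : Fin d → ℤ) :
    ∫ x, planeWave (intVec z) x * w x
      = ∫ x in unitCube d, planeWave (intVec z) x * periodization w x :=
  integral_periodic_mul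
    (fun x k => by rw [planeWave_add_right, planeWave_intVec_intVec, mul_one])
    ((integrable_of_memLp_two_of_bounded_support hw hR).bdd_mul (c := 1)
      (by fun_prop) (.of_forall fun x => (norm_planeWave _ x).le)) hR

theorem setIntegral_periodization_mul_conj {u v : Rd d → ℂ} (hu : MemLp u 2 volume)
    (hv : MemLp v 2 volume) {R : ℝ} (hRu : ∀ ξ, R < ‖ξ‖ → u ξ = 0)
    (hRv : ∀ ξ, R < ‖ξ‖ → v ξ = 0) :
    ∫ x in unitCube d, periodization u x * conj (periodization v x)
      = ∑' l : Fin d → ℤ, ∫ ξ, u (ξ + intVec l) * conj (v ξ) := by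
  obtain ⟨N, hN⟩ := exists_nat_gt (R + R)
  have hfinite : ∀ ξ, periodization u ξ * conj (v ξ)
      = ∑ l ∈ latticeBox d N, u (ξ + intVec l) * conj (v ξ) := fun ξ => by
    rcases lt_or_ge R ‖ξ‖ with hξ | hξ
    · simp [hRv ξ hξ]
    · rw [periodization_eq_sum_of_norm_le hN.le hRu hξ, Finset.sum_mul]
  have hint : ∀ l ∈ latticeBox d N, Integrable fun ξ => u (ξ + intVec l) * conj (v ξ) :=
    fun l _ => (memLp_comp_add_right hu (intVec l)).integrable_mul hv.star
  have hconj : ∀ x, conj (periodization v x) = periodization (fun ξ => conj (v ξ)) x :=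
    fun x => Complex.conjCLE.map_tsum
  simp only [hconj]
  rw [← integral_periodic_mul (periodization_add_intVec u)
      (by simp only [hfinite]; exact integrable_finsetSum _ hint)
      (fun ξ hξ => by rw [hRv ξ hξ, map_zero])]
  simp only [hfinite]
  rw [integral_finsetSum _ hint, tsum_eq_sum fun l hl => ?_]
  have hlarge : R + R < ‖intVec l‖ := by
    by_contra! hle
    exact hl (mem_latticeBox_of_norm_le (hle.trans hN.le))
  simp [mul_conj_eq_zero_of_add_lt_norm hRu hRv hlarge]

theorem hasSum_integral_planeWave_mul_conj {u v : Rd d → ℂ} (hu : MemLp u 2 volume)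
    (hv : MemLp v 2 volume) {R : ℝ} (hRu : ∀ ξ, R < ‖ξ‖ → u ξ = 0)
    (hRv : ∀ ξ, R < ‖ξ‖ → v ξ = 0) :
    HasSum (fun z : Fin d → ℤ => (∫ x, planeWave (intVec z) x * u x)
      * conj (∫ x, planeWave (intVec z) x * v x))
      (∑' l : Fin d → ℤ, ∫ ξ, u (ξ + intVec l) * conj (v ξ)) := by
  simp only [← setIntegral_periodization_mul_conj hu hv hRu hRv,
    integral_planeWave_mul_eq_setIntegral_periodization hu hRu,
    integral_planeWave_mul_eq_setIntegral_periodization hv hRv]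
  exact hasSum_unitCube_parseval (memLp_periodization hu hRu) (memLp_periodization hv hRv)

end Periodization

section BandLimited

variable {d : ℕ}

theorem hasSum_of_eq {ι E : Type*} [AddCommMonoid E] [TopologicalSpace E] {u v : ι → E} {a b : E}
    (h : HasSum u a) (huv : ∀ i, v i = u i) (hab : a = b) : HasSum v b :=
  hab ▸ h.congr_fun huv

/-- A function in `L²` whose Fourier transform is bounded with bounded support. -/
def IsBandLimited (f : L2 d) : Prop :=
  ∃ (h : Rd d → ℂ) (R C : ℝ), Measurable h ∧ (∀ ξ, ‖h ξ‖ ≤ C) ∧ (∀ ξ, R < ‖ξ‖ → h ξ = 0) ∧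
    (𝓕 f : L2 d) =ᵐ[volume] h

theorem memLp_of_bounded_of_bounded_support {h : Rd d → ℂ} {R C : ℝ} (hm : Measurable h)
    (hC : ∀ ξ, ‖h ξ‖ ≤ C) (hR : ∀ ξ, R < ‖ξ‖ → h ξ = 0) : MemLp h 2 volume := by
  have hsupport : Function.support h ⊆ Metric.closedBall 0 R := by
    intro x hx
    by_contra hxR
    exact hx (hR x (by simpa using hxR))
  rw [← Set.indicator_eq_self.2 hsupport, memLp_indicator_iff_restrict measurableSet_closedBall]
  have : Fact (volume (Metric.closedBall (0 : Rd d) R) < ∞) := ⟨measure_closedBall_lt_top⟩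
  exact MemLp.of_bound hm.aestronglyMeasurable C (.of_forall hC)

theorem exists_fourier_ae_eq {h : Rd d → ℂ} (hh : MemLp h 2 volume) :
    ∃ f : L2 d, (𝓕 f : L2 d) =ᵐ[volume] h := by
  refine ⟨(Lp.fourierTransformₗᵢ (Rd d) ℂ).symm hh.toLp, ?_⟩
  have hsymm : (𝓕 ((Lp.fourierTransformₗᵢ (Rd d) ℂ).symm hh.toLp) : L2 d) = hh.toLp :=
    (Lp.fourierTransformₗᵢ (Rd d) ℂ).apply_symm_apply _
  rw [hsymm]
  exact hh.coeFn_toLp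

theorem exists_isBandLimited_fourier_ae_eq {h : Rd d → ℂ} {R C : ℝ} (hm : Measurable h)
    (hC : ∀ ξ, ‖h ξ‖ ≤ C) (hR : ∀ ξ, R < ‖ξ‖ → h ξ = 0) :
    ∃ f : L2 d, IsBandLimited f ∧ (𝓕 f : L2 d) =ᵐ[volume] h := by
  obtain ⟨f, hf⟩ := exists_fourier_ae_eq (memLp_of_bounded_of_bounded_support hm hC hR)
  exact ⟨f, ⟨h, R, C, hm, hC, hR, hf⟩, hf⟩

theorem isBandLimited_of_hasCompactSupport {f : L2 d} {h : Rd d → ℂ} (hcont : Continuous h)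
    (hsupp : HasCompactSupport h) (hf : (𝓕 f : L2 d) =ᵐ[volume] h) : IsBandLimited f := by
  obtain ⟨C, hC⟩ := hcont.bounded_above_of_compact_support hsupp
  obtain ⟨R, hR⟩ := hsupp.isCompact.isBounded.subset_closedBall 0
  refine ⟨h, R, C, hcont.measurable, hC, fun ξ hξ => ?_, hf⟩
  by_contra hne
  have hξR := hR (subset_tsupport h hne)
  rw [mem_closedBall_zero_iff] at hξR
  linarith

theorem dense_isBandLimited : Dense {f : L2 d | IsBandLimited f} := by
  refine Metric.dense_iff.2 fun f ε hε => ?_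
  obtain ⟨h, hsupp, hle, hcont, hmem⟩ :=
    (Lp.memLp (𝓕 f : L2 d)).exists_hasCompactSupport_eLpNorm_sub_le (p := 2) (by norm_num)
      (ε := ENNReal.ofReal (ε / 2)) (by simpa using hε)
  obtain ⟨g, hg⟩ := exists_fourier_ae_eq hmem
  refine ⟨g, ?_, isBandLimited_of_hasCompactSupport hcont hsupp hg⟩
  have hdist : dist g f = (eLpNorm (⇑(𝓕 f : L2 d) - h) 2 volume).toReal := by
    rw [dist_comm, ← (Lp.fourierTransformₗᵢ (Rd d) ℂ).dist_map, Lp.dist_def]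
    exact congrArg _ (eLpNorm_congr_ae ((ae_eq_refl _).sub hg))
  rw [Metric.mem_ball, hdist]
  refine (ENNReal.toReal_mono ENNReal.ofReal_ne_top hle).trans_lt ?_
  rw [ENNReal.toReal_ofReal (by positivity)]
  linarith

theorem IsBandLimited.translation {f : L2 d} (hf : IsBandLimited f) (β : Rd d) :
    IsBandLimited (translation β f) := by
  obtain ⟨h, R, C, hm, hC, hR, hfh⟩ := hf
  refine ⟨fun ξ => planeWave (-β) ξ * h ξ, R, C, (continuous_planeWave _).measurable.mul hm,
    fun ξ => ?_, fun ξ hξ => by simp only [hR ξ hξ, mul_zero], ?_⟩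
  · rw [norm_mul, norm_planeWave, one_mul]
    exact hC ξ
  · filter_upwards [fourier_translation_ae β f, hfh] with ξ htrans hξ
    rw [htrans, hξ]

theorem exists_norm_adjPow_le (A : GL (Fin d) ℝ) (n : ℤ) :
    ∃ K, 0 < K ∧ ∀ ξ, ‖adjPow A n ξ‖ ≤ K * ‖ξ‖ :=
  (LinearMap.toContinuousLinearMap
    (matAct ((A ^ n).val.transpose))).isBoundedLinearMap.bound

theorem IsBandLimited.dilation_zpow {f : L2 d} (hf : IsBandLimited f) (A : GL (Fin d) ℝ) (n : ℤ) :
    IsBandLimited ((dilation A ^ n) f) := by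
  obtain ⟨h, R, C, hm, hC, hR, hfh⟩ := hf
  set c : ℂ := (((Real.sqrt |(A ^ n).val.det|)⁻¹ : ℝ) : ℂ)
  obtain ⟨K, hK0, hK⟩ := exists_norm_adjPow_le A n
  refine ⟨fun ξ => c * h (adjPow A (-n) ξ), K * R, ‖c‖ * C,
    (hm.comp (continuous_adjPow A (-n)).measurable).const_mul c, fun ξ => ?_, fun ξ hξ => ?_, ?_⟩
  · rw [norm_mul]
    exact mul_le_mul_of_nonneg_left (hC _) (norm_nonneg _)
  · refine mul_eq_zero_of_right _ (hR _ (lt_of_mul_lt_mul_left (hξ.trans_le ?_) hK0.le))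
    simpa only [adjPow_adjPow, add_neg_cancel, adjPow_zero] using hK (adjPow A (-n) ξ)
  · filter_upwards [fourier_dilation_zpow_ae A n f,
      (quasiMeasurePreserving_adjPow A (-n)).ae_eq_comp hfh] with ξ hdil hξ
    rw [hdil]
    exact congrArg (c * ·) hξ

/-- The frequency-domain pairing of `f` and `g` at the scale `n` and the frequency shift `a`. -/
def shiftPairing (A : GL (Fin d) ℝ) (ψ φ f g : L2 d) (n : ℤ) (a : Rd d) : ℂ :=
  ∫ ξ, conj (crossTerm A φ ψ (-n) ξ (ξ + a)) * ((𝓕 f : L2 d) (ξ + a) * conj ((𝓕 g : L2 d) ξ))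

theorem ae_comp_add_right {E : Type*} {u v : Rd d → E} (h : u =ᵐ[volume] v) (a : Rd d) :
    (fun ξ => u (ξ + a)) =ᵐ[volume] fun ξ => v (ξ + a) :=
  (measurePreserving_add_right volume a).quasiMeasurePreserving.ae_eq_comp h

theorem shiftPairing_translation (A : GL (Fin d) ℝ) (ψ φ f g : L2 d) (n : ℤ) (a β : Rd d) :
    shiftPairing A ψ φ (translation β f) (translation β g) n a
      = planeWave (-β) a * shiftPairing A ψ φ f g n a := by
  rw [shiftPairing, shiftPairing, ← integral_const_mul]
  refine integral_congr_ae ?_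
  filter_upwards [ae_comp_add_right (fourier_translation_ae β f) a,
    fourier_translation_ae β g] with ξ hf hg
  rw [hf, hg, map_mul, planeWave_add_right]
  linear_combination (conj (crossTerm A φ ψ (-n) ξ (ξ + a)) * ((𝓕 f : L2 d) (ξ + a)
    * conj ((𝓕 g : L2 d) ξ)) * planeWave (-β) a) * planeWave_mul_conj (-β) ξ

theorem crossTerm_adjPow (A : GL (Fin d) ℝ) (f g : L2 d) (j m : ℤ) (ξ η : Rd d) :
    crossTerm A f g j (adjPow A m ξ) (adjPow A m η) = crossTerm A f g (j + m) ξ η := by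
  simp only [crossTerm, adjPow_adjPow]

theorem abs_det_zpow_neg (A : GL (Fin d) ℝ) (m : ℤ) :
    |(A ^ (-m)).val.det| = |(A ^ m).val.det|⁻¹ := by
  have hmul : (A ^ (-m)).val.det * (A ^ m).val.det = 1 := by
    rw [← Matrix.det_mul, ← Units.val_mul, ← zpow_add, neg_add_cancel, zpow_zero, Units.val_one,
      Matrix.det_one]
  rw [← abs_inv, eq_inv_of_mul_eq_one_left hmul]

theorem shiftPairing_dilation (A : GL (Fin d) ℝ) (ψ φ f g : L2 d) (n m : ℤ) (a : Rd d) :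
    shiftPairing A ψ φ ((dilation A ^ m) f) ((dilation A ^ m) g) n (adjPow A m a)
      = shiftPairing A ψ φ f g (n - m) a := by
  set c : ℝ := (Real.sqrt |(A ^ m).val.det|)⁻¹ with hc
  let G : Rd d → ℂ := fun ξ => conj (crossTerm A φ ψ (-(n - m)) ξ (ξ + a))
    * ((𝓕 f : L2 d) (ξ + a) * conj ((𝓕 g : L2 d) ξ))
  have hpull : shiftPairing A ψ φ ((dilation A ^ m) f) ((dilation A ^ m) g) n (adjPow A m a)
      = ∫ ξ, ((c * c : ℝ) : ℂ) * G (adjPow A (-m) ξ) := by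
    refine integral_congr_ae ?_
    filter_upwards [ae_comp_add_right (fourier_dilation_zpow_ae A m f) (adjPow A m a),
      fourier_dilation_zpow_ae A m g] with ξ hf hg
    have hshift : adjPow A (-m) (ξ + adjPow A m a) = adjPow A (-m) ξ + a := by
      rw [adjPow_add, adjPow_adjPow, neg_add_cancel, adjPow_zero]
    have hcross : crossTerm A φ ψ (-(n - m)) (adjPow A (-m) ξ) (adjPow A (-m) ξ + a)
        = crossTerm A φ ψ (-n) ξ (ξ + adjPow A m a) := by
      rw [← hshift, crossTerm_adjPow]
      congr 1
      ring
    simp only [G, hcross]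
    rw [hf, hg, hshift, map_mul, Complex.conj_ofReal, ← hc, Complex.ofReal_mul]
    ring
  rw [hpull, integral_const_mul, integral_comp_adjPow, abs_det_zpow_neg, inv_inv,
    Complex.real_smul, ← mul_assoc, ← Complex.ofReal_mul, hc, ← mul_inv,
    Real.mul_self_sqrt (abs_nonneg _), inv_mul_cancel₀ (abs_det_ne_zero _), Complex.ofReal_one,
    one_mul]
  rfl

theorem shiftPairing_eq_zero_of_add_lt_norm {ψ φ f g : L2 d} {h h' : Rd d → ℂ} {R R' : ℝ}
    (hR : ∀ ξ, R < ‖ξ‖ → h ξ = 0) (hfh : (𝓕 f : L2 d) =ᵐ[volume] h)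
    (hR' : ∀ ξ, R' < ‖ξ‖ → h' ξ = 0) (hgh' : (𝓕 g : L2 d) =ᵐ[volume] h')
    (A : GL (Fin d) ℝ) (n : ℤ) {a : Rd d} (ha : R + R' < ‖a‖) :
    shiftPairing A ψ φ f g n a = 0 := by
  refine integral_eq_zero_of_ae ?_
  filter_upwards [ae_comp_add_right hfh a, hgh'] with ξ hf hg
  rw [hf, hg, mul_conj_eq_zero_of_add_lt_norm hR hR' ha ξ, mul_zero, Pi.zero_apply]

theorem memLp_conj_fourier_mul {h : Rd d → ℂ} {C : ℝ} (ψ : L2 d) (hm : Measurable h)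
    (hC : ∀ ξ, ‖h ξ‖ ≤ C) : MemLp (fun ξ => conj ((𝓕 ψ : L2 d) ξ) * h ξ) 2 volume :=
  (memLp_top_of_bound hm.aestronglyMeasurable C (.of_forall hC)).mul (Lp.memLp (𝓕 ψ : L2 d)).star

theorem inner_translation_eq_integral_planeWave {f : L2 d} {h : Rd d → ℂ} (ψ : L2 d) (α : Rd d)
    (hfh : (𝓕 f : L2 d) =ᵐ[volume] h) :
    ⟪translation α ψ, f⟫_ℂ = ∫ ξ, planeWave α ξ * (conj ((𝓕 ψ : L2 d) ξ) * h ξ) := by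
  rw [inner_eq_integral_fourier]
  refine integral_congr_ae ?_
  filter_upwards [fourier_translation_ae α ψ, hfh] with ξ hψ hf
  rw [hψ, hf, map_mul, ← planeWave_neg_left, neg_neg, mul_assoc]

theorem hasSum_inner_translation_mul {ψ φ f g : L2 d} (hf : IsBandLimited f)
    (hg : IsBandLimited g) :
    HasSum (fun z : Fin d → ℤ => ⟪translation (intVec z) ψ, f⟫_ℂ * ⟪g, translation (intVec z) φ⟫_ℂ)
      (∑' l : Fin d → ℤ, ∫ ξ, conj ((𝓕 ψ : L2 d) (ξ + intVec l)) * (𝓕 φ : L2 d) ξ *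
        ((𝓕 f : L2 d) (ξ + intVec l) * conj ((𝓕 g : L2 d) ξ))) := by
  obtain ⟨h, R, C, hm, hC, hR, hfh⟩ := hf
  obtain ⟨h', R', C', hm', hC', hR', hgh'⟩ := hg
  refine hasSum_of_eq (hasSum_integral_planeWave_mul_conj (R := max R R')
    (memLp_conj_fourier_mul ψ hm hC) (memLp_conj_fourier_mul φ hm' hC')
    (fun ξ hξ => by rw [hR ξ ((le_max_left _ _).trans_lt hξ), mul_zero])
    (fun ξ hξ => by rw [hR' ξ ((le_max_right _ _).trans_lt hξ), mul_zero])) (fun z => ?_) ?_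
  · rw [inner_translation_eq_integral_planeWave ψ _ hfh, ← inner_conj_symm g,
      inner_translation_eq_integral_planeWave φ _ hgh']
  · refine tsum_congr fun l => integral_congr_ae (μ := (volume : Measure (Rd d))) ?_
    filter_upwards [ae_comp_add_right hfh (intVec l), hgh'] with ξ hf hg
    rw [hf, hg, map_mul, Complex.conj_conj]
    ring

theorem hasSum_inner_translation_dilationR_mul (A : GL (Fin d) ℝ) {ψ φ f g : L2 d}
    (hf : IsBandLimited f) (hg : IsBandLimited g) (n : ℤ) :
    HasSum (fun z : Fin d → ℤ => ⟪translation (intVec z) ((dilationR A ^ n) ψ), f⟫_ℂ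
        * ⟪g, translation (intVec z) ((dilationR A ^ n) φ)⟫_ℂ)
      (∑' l : Fin d → ℤ, shiftPairing A ψ φ f g n (intVec l)) := by
  refine hasSum_of_eq (hasSum_inner_translation_mul hf hg) (fun _ => rfl)
    (tsum_congr fun l => integral_congr_ae ?_)
  filter_upwards [ae_comp_add_right (fourier_dilationR_zpow_ae A n ψ) (intVec l),
    fourier_dilationR_zpow_ae A n φ] with ξ hψ hφ
  rw [hψ, hφ, crossTerm, map_mul, Complex.conj_conj, mul_comm (conj _) ((𝓕 φ : L2 d) _)]

theorem hasSum_inner_dilation_translation_mul (A : GL (Fin d) ℝ) {ψ φ f g : L2 d}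
    (hf : IsBandLimited f) (hg : IsBandLimited g) (n : ℤ) :
    HasSum (fun z : Fin d → ℤ => ⟪(dilation A ^ n) (translation (intVec z) ψ), f⟫_ℂ
        * ⟪g, (dilation A ^ n) (translation (intVec z) φ)⟫_ℂ)
      (∑' l : Fin d → ℤ, shiftPairing A ψ φ f g n (adjPow A n (intVec l))) := by
  refine hasSum_of_eq (hasSum_inner_translation_dilationR_mul A (ψ := ψ) (φ := φ)
    (hf.dilation_zpow A (-n)) (hg.dilation_zpow A (-n)) 0) (fun z => ?_) (tsum_congr fun l => ?_)
  · simp only [dilation_zpow]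
    rw [inner_dilation_left (A ^ n), inner_dilation_right (A ^ n), ← zpow_neg]
    rfl
  · have hdil := shiftPairing_dilation A ψ φ f g 0 (-n) (adjPow A n (intVec l))
    rw [adjPow_adjPow, neg_add_cancel, adjPow_zero] at hdil
    rw [hdil, zero_sub, neg_neg]

end BandLimited

section BesselSum

variable {H : Type*} [NormedAddCommGroup H] [InnerProductSpace ℂ H] {J : Type*}

/-- The sum of the squared moduli of the coefficients of `v` against a family `x`. -/
def besselSum (x : J → H) (v : H) : ℝ≥0∞ := ∑' j, ‖⟪x j, v⟫_ℂ‖ₑ ^ 2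

theorem enorm_sq_eq_ofReal {E : Type*} [NormedAddCommGroup E] (a : E) :
    ‖a‖ₑ ^ 2 = ENNReal.ofReal (‖a‖ ^ 2) := by
  rw [← ofReal_norm, ENNReal.ofReal_pow (norm_nonneg a)]

theorem isBesselSeq_iff_besselSum_le (x : J → H) :
    IsBesselSeq x ↔ ∃ C : NNReal, ∀ v, besselSum x v ≤ C * ‖v‖ₑ ^ 2 := by
  constructor
  · rintro ⟨M, hM⟩
    refine ⟨M.toNNReal, fun v => ?_⟩
    simp only [besselSum, enorm_sq_eq_ofReal]
    rw [← ENNReal.ofReal_tsum_of_nonneg (fun j => by positivity) (hM v).1,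
      show ((M.toNNReal : NNReal) : ℝ≥0∞) = ENNReal.ofReal M from rfl,
      ← ENNReal.ofReal_mul' (by positivity)]
    exact ENNReal.ofReal_le_ofReal (hM v).2
  · rintro ⟨C, hC⟩
    refine ⟨C, fun v => ?_⟩
    have hv := hC v
    simp only [besselSum, enorm_sq_eq_ofReal] at hv
    rw [← ENNReal.ofReal_coe_nnreal, ← ENNReal.ofReal_mul C.coe_nonneg] at hv
    have hsum : Summable fun j => ‖⟪x j, v⟫_ℂ‖ ^ 2 := by
      have := ENNReal.summable_toReal (ne_top_of_le_ne_top ENNReal.ofReal_ne_top hv)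
      simpa only [ENNReal.toReal_ofReal (sq_nonneg _)] using this
    refine ⟨hsum, ?_⟩
    rw [← ENNReal.ofReal_tsum_of_nonneg (fun j => by positivity) hsum] at hv
    exact (ENNReal.ofReal_le_ofReal_iff (by positivity)).1 hv

end BesselSum

/-! ### The Bessel bound of the quasi-affine system -/

section QuasiBessel

variable {d : ℕ}

theorem IsIntegralMatrix.exists_intMatrix {A : GL (Fin d) ℝ} (hA : IsIntegralMatrix A) :
    ∃ M : Matrix (Fin d) (Fin d) ℤ, A.val = M.map (Int.cast : ℤ → ℝ) := by
  choose M hM using hA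
  exact ⟨Matrix.of M, by ext i j; simp [hM]⟩

theorem matAct_intVec (M : Matrix (Fin d) (Fin d) ℤ) (k : Fin d → ℤ) :
    matAct (M.map (Int.cast : ℤ → ℝ)) (intVec k) = intVec (M.mulVec k) := by
  ext i
  simp [matAct, intVec, Matrix.toLpLin_apply, Matrix.mulVec, dotProduct]

theorem mulVec_injective_of_det_ne_zero {M : Matrix (Fin d) (Fin d) ℤ} (hM : M.det ≠ 0) :
    Function.Injective M.mulVec := by
  intro x y hxy
  have hsub : M.mulVec (x - y) = 0 := by rw [Matrix.mulVec_sub, sub_eq_zero]; exact hxy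
  exact sub_eq_zero.1 (Matrix.eq_zero_of_mulVec_eq_zero hM hsub)

theorem index_range_mulVecLin (M : Matrix (Fin d) (Fin d) ℤ) (hM : Function.Injective M.mulVec) :
    (M.mulVecLin.range.toAddSubgroup).index = M.det.natAbs := by
  have hindex := Submodule.natAbs_det_equiv M.mulVecLin.range
    (LinearEquiv.ofInjective M.mulVecLin hM)
  have hcomp : M.mulVecLin.range.subtype ∘ₗ
      AddMonoidHom.toIntLinearMap ((LinearEquiv.ofInjective M.mulVecLin hM : _ →+ _))
      = M.mulVecLin := by
    ext x
    rfl
  rw [hcomp, show LinearMap.det M.mulVecLin = M.det from LinearMap.det_toLin' M] at hindex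
  exact hindex.symm

theorem exists_digits (M : Matrix (Fin d) (Fin d) ℤ) (hM : M.det ≠ 0) :
    ∃ (ι : Type) (_ : Fintype ι) (δ : ι → Fin d → ℤ), Fintype.card ι = M.det.natAbs ∧
      Function.Bijective fun p : ι × (Fin d → ℤ) => δ p.1 + M.mulVec p.2 := by
  have hinj := mulVec_injective_of_det_ne_zero hM
  set K := M.mulVecLin.range.toAddSubgroup
  have hindex := index_range_mulVecLin M hinj
  have hfin : K.FiniteIndex := ⟨by rw [hindex]; exact Int.natAbs_ne_zero.2 hM⟩
  have : Fintype ((Fin d → ℤ) ⧸ K) := K.fintypeQuotientOfFiniteIndex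
  have hmk : ∀ (a : (Fin d → ℤ) ⧸ K) (x : Fin d → ℤ),
      (QuotientAddGroup.mk (Quotient.out a + M.mulVec x) : (Fin d → ℤ) ⧸ K) = a := fun a x => by
    have hx : M.mulVec x ∈ K := ⟨x, rfl⟩
    rw [QuotientAddGroup.mk_add, (QuotientAddGroup.eq_zero_iff _).2 hx, add_zero]
    exact QuotientAddGroup.out_eq' a
  refine ⟨(Fin d → ℤ) ⧸ K, this, Quotient.out, ?_, ?_, fun w => ?_⟩
  · rw [← hindex, ← Nat.card_eq_fintype_card]
    rfl
  · rintro ⟨a, x⟩ ⟨b, y⟩ hab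
    obtain rfl : a = b := by rw [← hmk a x, ← hmk b y]; exact congrArg _ hab
    obtain rfl : x = y := hinj (add_left_cancel hab)
    rfl
  · obtain ⟨x, hx⟩ : -Quotient.out (QuotientAddGroup.mk w : (Fin d → ℤ) ⧸ K) + w ∈ K :=
      QuotientAddGroup.eq.1 (QuotientAddGroup.out_eq' _)
    replace hx : M.mulVec x = _ := hx
    exact ⟨⟨QuotientAddGroup.mk w, x⟩, by simp only [hx, add_neg_cancel_left]⟩

/-- The squared coefficients of `f` at the scale `n` of the affine system of `ψ`. -/
def affineLayer (A : GL (Fin d) ℝ) (ψ : L2 d) (n : ℤ) (f : L2 d) : ℝ≥0∞ :=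
  besselSum (fun z : Fin d → ℤ => (dilation A ^ n) (translation (intVec z) ψ)) f

/-- The squared coefficients of `f` at the scale `n` of the system `T_z (dilationR A)^n ψ`, which
for `n < 0` is the quasi-affine system of `ψ`. -/
def quasiLayer (A : GL (Fin d) ℝ) (ψ : L2 d) (n : ℤ) (f : L2 d) : ℝ≥0∞ :=
  besselSum (fun z : Fin d → ℤ => translation (intVec z) ((dilationR A ^ n) ψ)) f

theorem quasiLayer_zero (A : GL (Fin d) ℝ) (ψ : L2 d) (f : L2 d) :
    quasiLayer A ψ 0 f = affineLayer A ψ 0 f := rfl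

theorem affineLayer_add_dilation (A : GL (Fin d) ℝ) (ψ f : L2 d) (n m : ℤ) :
    affineLayer A ψ (n + m) ((dilation A ^ m) f) = affineLayer A ψ n f := by
  refine tsum_congr fun z => ?_
  rw [add_comm, zpow_add]
  change ‖⟪(dilation A ^ m) ((dilation A ^ n) _), _⟫_ℂ‖ₑ ^ 2 = _
  rw [dilation_zpow A m, inner_dilation_dilation]

theorem affineLayer_translation (A : GL (Fin d) ℝ) (ψ f : L2 d) (n : ℤ) (k : Fin d → ℤ) (a : Rd d)
    (ha : matAct (A ^ n).val a = intVec k) :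
    affineLayer A ψ n (translation (-a) f) = affineLayer A ψ n f := by
  rw [affineLayer, besselSum, affineLayer, besselSum,
    ← (Equiv.addLeft k).tsum_eq fun z => ‖⟪(dilation A ^ n) (translation (intVec z) ψ), f⟫_ℂ‖ₑ ^ 2]
  refine tsum_congr fun z => ?_
  rw [← inner_translation_left, dilation_zpow, translation_dilation, translation_translation, ha,
    Equiv.coe_addLeft, intVec_add]

theorem dilationR_zpow_succ (A : GL (Fin d) ℝ) (ψ : L2 d) (n : ℤ) :
    (dilationR A ^ (n + 1)) ψ
      = ((Real.sqrt |A.val.det| : ℝ) : ℂ) • dilation A ((dilationR A ^ n) ψ) := by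
  rw [← dilationR_eq, add_comm, zpow_add, zpow_one]
  rfl

/-- `D_A f` translated by `-A⁻¹ δ`, which shifts the coefficients of a system from the lattice to
its coset with the digit `δ`. -/
def digitShift (A : GL (Fin d) ℝ) (δ : Fin d → ℤ) (f : L2 d) : L2 d :=
  translation (-matAct (A⁻¹).val (intVec δ)) (dilation A f)

theorem enorm_digitShift (A : GL (Fin d) ℝ) (δ : Fin d → ℤ) (f : L2 d) :
    ‖digitShift A δ f‖ₑ = ‖f‖ₑ := by
  rw [← ofReal_norm, ← ofReal_norm, digitShift, norm_translation, norm_dilation]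

theorem abs_det_mul_quasiLayer {A : GL (Fin d) ℝ} {M : Matrix (Fin d) (Fin d) ℤ}
    (hA : A.val = M.map (Int.cast : ℤ → ℝ)) {ι : Type} [Fintype ι] {δ : ι → Fin d → ℤ}
    (hδ : Function.Bijective fun p : ι × (Fin d → ℤ) => δ p.1 + M.mulVec p.2)
    (ψ f : L2 d) (n : ℤ) :
    ENNReal.ofReal |A.val.det| * quasiLayer A ψ n f
      = ∑ i, quasiLayer A ψ (n + 1) (digitShift A (δ i) f) := by
  rw [quasiLayer, besselSum, ← (Equiv.ofBijective _ hδ).tsum_eq, ENNReal.tsum_prod',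
    tsum_fintype, Finset.mul_sum]
  refine Finset.sum_congr rfl fun i _ => ?_
  rw [quasiLayer, besselSum, ← ENNReal.tsum_mul_left]
  refine tsum_congr fun z => ?_
  have hcancel : matAct (A⁻¹).val (intVec (M.mulVec z)) = intVec z := by
    rw [← matAct_intVec, ← hA, matAct_inv_matAct]
  rw [digitShift, ← inner_translation_left, translation_translation, dilationR_zpow_succ,
    map_smul, inner_smul_left, Equiv.ofBijective_apply, ← inner_dilation_dilation A,
    dilation_translation, intVec_add, map_add, hcancel, enorm_mul, mul_pow]
  congr 1
  rw [Complex.conj_ofReal, enorm_sq_eq_ofReal, Complex.norm_real, Real.norm_eq_abs, sq_abs,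
    Real.sq_sqrt (abs_nonneg _)]

theorem affineLayer_succ_digitShift {A : GL (Fin d) ℝ} {M : Matrix (Fin d) (Fin d) ℤ}
    (hA : A.val = M.map (Int.cast : ℤ → ℝ)) (ψ f : L2 d) (δ : Fin d → ℤ) (n : ℕ) :
    affineLayer A ψ (n + 1 : ℕ) (digitShift A δ f) = affineLayer A ψ n f := by
  have hint : matAct (A ^ ((n + 1 : ℕ) : ℤ)).val (matAct (A⁻¹).val (intVec δ))
      = intVec ((M ^ n).mulVec δ) := by
    rw [zpow_natCast, pow_succ, Units.val_mul, matAct_mul_apply, matAct_matAct_inv,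
      Units.val_pow_eq_pow_val, hA, ← matAct_intVec]
    congr 2
    exact (map_pow (Int.castRingHom ℝ).mapMatrix M n).symm
  rw [digitShift, affineLayer_translation A ψ _ _ _ _ hint]
  simpa only [zpow_one, Nat.cast_add, Nat.cast_one] using affineLayer_add_dilation A ψ f n 1

theorem abs_det_eq_natAbs {A : GL (Fin d) ℝ} {M : Matrix (Fin d) (Fin d) ℤ}
    (hA : A.val = M.map (Int.cast : ℤ → ℝ)) : |A.val.det| = (M.det.natAbs : ℝ) := by
  have hdet : A.val.det = ((M.det : ℤ) : ℝ) := by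
    rw [hA]
    exact ((Int.castRingHom ℝ).map_det M).symm
  rw [hdet, Nat.cast_natAbs, Int.cast_abs]

theorem det_ne_zero_of_eq_map {A : GL (Fin d) ℝ} {M : Matrix (Fin d) (Fin d) ℤ}
    (hA : A.val = M.map (Int.cast : ℤ → ℝ)) : M.det ≠ 0 := by
  intro hdet
  have habs := abs_det_eq_natAbs hA
  rw [hdet, Int.natAbs_zero, Nat.cast_zero] at habs
  exact abs_det_ne_zero A habs

/-- The squared coefficients of `f` at the scales `n > -(N + 1)` of the quasi-affine system. -/
def truncatedQuasiSum (A : GL (Fin d) ℝ) (ψ : L2 d) (N : ℕ) (f : L2 d) : ℝ≥0∞ :=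
  ∑' n : ℕ, affineLayer A ψ n f + ∑ m ∈ Finset.range N, quasiLayer A ψ (-(m + 1 : ℕ)) f

theorem card_mul_truncatedQuasiSum_succ {A : GL (Fin d) ℝ} {M : Matrix (Fin d) (Fin d) ℤ}
    (hA : A.val = M.map (Int.cast : ℤ → ℝ)) {ι : Type} [Fintype ι] {δ : ι → Fin d → ℤ}
    (hcard : Fintype.card ι = M.det.natAbs)
    (hδ : Function.Bijective fun p : ι × (Fin d → ℤ) => δ p.1 + M.mulVec p.2)
    (ψ f : L2 d) (N : ℕ) :
    (Fintype.card ι : ℝ≥0∞) * truncatedQuasiSum A ψ (N + 1) f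
      = ∑ i, truncatedQuasiSum A ψ N (digitShift A (δ i) f) := by
  have hquasi : ∀ m : ℕ, (Fintype.card ι : ℝ≥0∞) * quasiLayer A ψ (-(m + 1 : ℕ)) f
      = ∑ i, quasiLayer A ψ (-m) (digitShift A (δ i) f) := fun m => by
    rw [hcard, ← ENNReal.ofReal_natCast, ← abs_det_eq_natAbs hA, abs_det_mul_quasiLayer hA hδ]
    simp only [Nat.cast_add, Nat.cast_one, neg_add_rev, neg_add_cancel_comm]
  have haffine : ∀ i, ∑' n : ℕ, affineLayer A ψ n (digitShift A (δ i) f)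
      = affineLayer A ψ 0 (digitShift A (δ i) f) + ∑' n : ℕ, affineLayer A ψ n f := fun i => by
    rw [tsum_eq_zero_add' ENNReal.summable]
    simp only [affineLayer_succ_digitShift hA, Nat.cast_zero]
  simp only [truncatedQuasiSum, haffine, mul_add, Finset.mul_sum, hquasi, Finset.sum_add_distrib,
    Finset.sum_const, Finset.card_univ, nsmul_eq_mul]
  rw [Finset.sum_range_succ', Finset.sum_comm]
  simp only [Nat.cast_zero, neg_zero, quasiLayer_zero]
  ring

/- Averaging over the digits of `A` trades one more scale of the quasi-affine system for a
dilation of `f`, so the affine bound propagates to all negative scales. -/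
theorem truncatedQuasiSum_le {A : GL (Fin d) ℝ} (hint : IsIntegralMatrix A) {ψ : L2 d} {C : NNReal}
    (hC : ∀ f, ∑' n : ℕ, affineLayer A ψ n f ≤ C * ‖f‖ₑ ^ 2) (N : ℕ) (f : L2 d) :
    truncatedQuasiSum A ψ N f ≤ C * ‖f‖ₑ ^ 2 := by
  obtain ⟨M, hM⟩ := hint.exists_intMatrix
  obtain ⟨ι, hι, δ, hcard, hδ⟩ := exists_digits M (det_ne_zero_of_eq_map hM)
  have hcard0 : (Fintype.card ι : ℝ≥0∞) ≠ 0 := by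
    rw [hcard, Nat.cast_ne_zero, Int.natAbs_ne_zero]
    exact det_ne_zero_of_eq_map hM
  induction N generalizing f with
  | zero => simpa [truncatedQuasiSum] using hC f
  | succ N ih =>
    refine (ENNReal.mul_le_mul_iff_right hcard0 (ENNReal.natCast_ne_top _)).1 ?_
    rw [card_mul_truncatedQuasiSum_succ hM hcard hδ]
    refine (Finset.sum_le_sum fun i _ => ih (digitShift A (δ i) f)).trans_eq ?_
    simp [enorm_digitShift]

variable {r : ℕ}

theorem besselSum_affineSystem (A : GL (Fin d) ℝ) (Ψ : Fin r → L2 d) (f : L2 d) :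
    besselSum (affineSystem A Ψ) f = ∑ i, ∑' n : ℤ, affineLayer A (Ψ i) n f := by
  rw [besselSum, ENNReal.tsum_prod', ← tsum_fintype (L := .unconditional _)
    (fun i => ∑' n : ℤ, affineLayer A (Ψ i) n f),
    ENNReal.tsum_comm (f := fun i n => affineLayer A (Ψ i) n f)]
  refine tsum_congr fun n => ?_
  rw [ENNReal.tsum_prod', ENNReal.tsum_comm]
  rfl

theorem besselSum_quasiAffineSystem (A : GL (Fin d) ℝ) (Ψ : Fin r → L2 d) (f : L2 d) :
    besselSum (quasiAffineSystem A Ψ) f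
      = ∑ i, ∑' n : ℤ, if 0 ≤ n then affineLayer A (Ψ i) n f else quasiLayer A (Ψ i) n f := by
  rw [besselSum, ENNReal.tsum_prod', ← tsum_fintype (L := .unconditional _) (fun i => ∑' n : ℤ,
    if 0 ≤ n then affineLayer A (Ψ i) n f else quasiLayer A (Ψ i) n f),
    ENNReal.tsum_comm (f := fun i n =>
      if 0 ≤ n then affineLayer A (Ψ i) n f else quasiLayer A (Ψ i) n f)]
  refine tsum_congr fun n => ?_
  rw [ENNReal.tsum_prod', ENNReal.tsum_comm]
  refine tsum_congr fun i => ?_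
  simp only [affineLayer, quasiLayer, besselSum, quasiAffineSystem]
  split_ifs <;> rfl

theorem tsum_affineLayer_natCast_le (A : GL (Fin d) ℝ) (Ψ : Fin r → L2 d) (i : Fin r) (f : L2 d) :
    ∑' n : ℕ, affineLayer A (Ψ i) n f ≤ besselSum (affineSystem A Ψ) f := by
  rw [besselSum_affineSystem]
  refine le_trans ?_ (Finset.single_le_sum (f := fun i => ∑' n : ℤ, affineLayer A (Ψ i) n f)
    (fun _ _ => zero_le) (Finset.mem_univ i))
  exact ENNReal.tsum_comp_le_tsum_of_injective Nat.cast_injective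
    (fun n : ℤ => affineLayer A (Ψ i) n f)

theorem tsum_ite_affineLayer_quasiLayer (A : GL (Fin d) ℝ) (ψ f : L2 d) :
    (∑' n : ℤ, if 0 ≤ n then affineLayer A ψ n f else quasiLayer A ψ n f)
      = ⨆ N, truncatedQuasiSum A ψ N f := by
  have hneg : ∀ n : ℕ, ¬ (0 : ℤ) ≤ -(n + 1 : ℤ) := fun n => by omega
  rw [tsum_of_nat_of_neg_add_one ENNReal.summable ENNReal.summable]
  simp only [Int.natCast_nonneg, if_true, hneg, if_false]
  rw [ENNReal.tsum_eq_iSup_nat (f := fun n : ℕ => quasiLayer A ψ (-(n + 1 : ℤ)) f),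
    ENNReal.add_iSup]
  rfl

theorem isBesselSeq_quasiAffineSystem {A : GL (Fin d) ℝ} (hint : IsIntegralMatrix A)
    {Ψ : Fin r → L2 d} (h : IsBesselSeq (affineSystem A Ψ)) :
    IsBesselSeq (quasiAffineSystem A Ψ) := by
  rw [isBesselSeq_iff_besselSum_le] at h ⊢
  obtain ⟨C, hC⟩ := h
  refine ⟨r * C, fun f => ?_⟩
  simp only [besselSum_quasiAffineSystem, tsum_ite_affineLayer_quasiLayer]
  refine (Finset.sum_le_sum fun i _ => iSup_le fun N => truncatedQuasiSum_le hint
    (fun g => (tsum_affineLayer_natCast_le A Ψ i g).trans (hC g)) N f).trans_eq ?_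
  simp [mul_assoc]

end QuasiBessel

section Calderon

variable {d : ℕ}

theorem memLp_fourier_adjPow (A : GL (Fin d) ℝ) (ψ : L2 d) (j : ℤ) :
    MemLp (fun ξ => (𝓕 ψ : L2 d) (adjPow A j ξ)) 2 volume :=
  memLp_comp_matAct (glTranspose (A ^ j)) (𝓕 ψ : L2 d)

theorem measurable_fourier_adjPow (A : GL (Fin d) ℝ) (ψ : L2 d) (j : ℤ) :
    Measurable (fun ξ => (𝓕 ψ : L2 d) (adjPow A j ξ)) :=
  (Lp.stronglyMeasurable (𝓕 ψ : L2 d)).measurable.comp (continuous_adjPow A j).measurable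

theorem inner_mul_inner_swap_eq_ofReal {H : Type*} [NormedAddCommGroup H]
    [InnerProductSpace ℂ H] (x y : H) : ⟪x, y⟫_ℂ * ⟪y, x⟫_ℂ = ((‖⟪x, y⟫_ℂ‖ ^ 2 : ℝ) : ℂ) := by
  rw [← inner_conj_symm y x, Complex.mul_conj, Complex.normSq_eq_norm_sq]

theorem add_intVec_notMem_latticeCell {k l : Fin d → ℤ} (hl : l ≠ 0) {ξ : Rd d}
    (hξ : ξ ∈ latticeCell k) : ξ + intVec l ∉ latticeCell k := by
  intro hshift
  have hkl : k ≠ k - l := fun h => hl (by simpa using h.symm)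
  refine Set.disjoint_left.1 (pairwise_disjoint_latticeCell hkl) hξ ?_
  simpa only [latticeCell, Set.mem_preimage, intVec_sub, sub_sub_eq_add_sub] using hshift

theorem shiftPairing_eq_zero_of_indicator (A : GL (Fin d) ℝ) (ψ φ : L2 d) (n : ℤ)
    {E : Set (Rd d)} {k l : Fin d → ℤ} (hk : E ⊆ latticeCell k) (hl : l ≠ 0) {f : L2 d}
    (hfE : (𝓕 f : L2 d) =ᵐ[volume] E.indicator fun _ => 1) :
    shiftPairing A ψ φ f f n (intVec l) = 0 := by
  refine integral_eq_zero_of_ae ?_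
  filter_upwards [ae_comp_add_right hfE (intVec l), hfE] with ξ hshift hξ
  rw [hshift, hξ]
  by_cases hmem : ξ ∈ E
  · have hnot : ξ + intVec l ∉ E := fun h => add_intVec_notMem_latticeCell hl (hk hmem) (hk h)
    simp [hnot]
  · simp [hmem]

theorem shiftPairing_zero_of_indicator (A : GL (Fin d) ℝ) (ψ : L2 d) (n : ℤ) {E : Set (Rd d)}
    (hE : MeasurableSet E) {f : L2 d}
    (hfE : (𝓕 f : L2 d) =ᵐ[volume] E.indicator fun _ => 1) :
    shiftPairing A ψ ψ f f n 0
      = ((∫ ξ in E, ‖(𝓕 ψ : L2 d) (adjPow A (-n) ξ)‖ ^ 2 : ℝ) : ℂ) := by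
  rw [← integral_indicator hE, ← integral_complex_ofReal, shiftPairing]
  refine integral_congr_ae ?_
  filter_upwards [hfE] with ξ hξ
  simp only [add_zero]
  rw [hξ]
  by_cases hmem : ξ ∈ E
  · simp [hmem, crossTerm, Complex.mul_conj, Complex.normSq_eq_norm_sq]
  · simp [hmem]

/- Distinct integer translates of a subset of a lattice cell are disjoint, so only the unshifted
pairing survives. -/
theorem quasiLayer_of_indicator (A : GL (Fin d) ℝ) (ψ : L2 d) (n : ℤ) {E : Set (Rd d)}
    (hE : MeasurableSet E) {k : Fin d → ℤ} (hk : E ⊆ latticeCell k) {f : L2 d}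
    (hf : IsBandLimited f) (hfE : (𝓕 f : L2 d) =ᵐ[volume] E.indicator fun _ => 1) :
    quasiLayer A ψ n f = ∫⁻ ξ in E, ‖(𝓕 ψ : L2 d) (adjPow A (-n) ξ)‖ₑ ^ 2 := by
  have hsum := hasSum_inner_translation_dilationR_mul A (ψ := ψ) (φ := ψ) hf hf n
  rw [tsum_eq_single 0 fun l hl => shiftPairing_eq_zero_of_indicator A ψ ψ n hk hl hfE,
    intVec_zero, shiftPairing_zero_of_indicator A ψ n hE hfE] at hsum
  simp only [inner_mul_inner_swap_eq_ofReal] at hsum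
  have hreal := Complex.hasSum_ofReal.1 hsum
  rw [quasiLayer, besselSum]
  simp only [enorm_sq_eq_ofReal]
  rw [← ENNReal.ofReal_tsum_of_nonneg (fun _ => by positivity) hreal.summable, hreal.tsum_eq,
    ofReal_integral_eq_lintegral_ofReal _ (.of_forall fun _ => by positivity)]
  exact ((memLp_two_iff_integrable_sq_norm
    (measurable_fourier_adjPow A ψ (-n)).aestronglyMeasurable).1
    (memLp_fourier_adjPow A ψ (-n))).integrableOn

theorem isBounded_unitCube : Bornology.IsBounded (unitCube d) := by
  refine (Metric.isBounded_closedBall (x := (0 : Rd d)) (r := Real.sqrt d)).subset fun x hx => ?_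
  rw [mem_closedBall_zero_iff, EuclideanSpace.norm_eq]
  refine Real.sqrt_le_sqrt ((Finset.sum_le_sum (g := fun _ => (1 : ℝ)) fun i _ => ?_).trans_eq
    (by simp))
  obtain ⟨hpos, hle⟩ := hx i
  rw [Real.norm_eq_abs, sq_abs]
  nlinarith

theorem exists_norm_le_of_mem_latticeCell (k : Fin d → ℤ) :
    ∃ R : ℝ, ∀ x ∈ latticeCell k, ‖x‖ ≤ R := by
  obtain ⟨R, hR⟩ := isBounded_unitCube.exists_norm_le (s := unitCube d)
  refine ⟨R + ‖intVec k‖, fun x hx => ?_⟩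
  calc ‖x‖ = ‖x - intVec k + intVec k‖ := by rw [sub_add_cancel]
    _ ≤ ‖x - intVec k‖ + ‖intVec k‖ := norm_add_le _ _
    _ ≤ R + ‖intVec k‖ := by gcongr; exact hR _ hx

theorem ae_of_ae_restrict_latticeCell {p : Rd d → Prop}
    (h : ∀ k : Fin d → ℤ, ∀ᵐ x ∂volume.restrict (latticeCell k), p x) : ∀ᵐ x, p x := by
  rw [← Measure.restrict_univ (μ := (volume : Measure (Rd d))), ← iUnion_latticeCell,
    ae_restrict_iUnion_iff]
  exact h

theorem exists_isBandLimited_fourier_ae_indicator {E : Set (Rd d)} (hE : MeasurableSet E)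
    {R : ℝ} (hR : ∀ x ∈ E, ‖x‖ ≤ R) :
    ∃ f : L2 d, IsBandLimited f ∧ (𝓕 f : L2 d) =ᵐ[volume] E.indicator fun _ => 1 := by
  refine exists_isBandLimited_fourier_ae_eq (C := 1) (R := R) (measurable_const.indicator hE)
    (fun ξ => ?_) fun ξ hξ => Set.indicator_of_notMem (fun hmem => (hR ξ hmem).not_gt hξ) _
  by_cases hξ : ξ ∈ E <;> simp [hξ]

theorem enorm_sq_eq_volume_of_fourier_ae_indicator {E : Set (Rd d)} (hE : MeasurableSet E)
    {f : L2 d} (hfE : (𝓕 f : L2 d) =ᵐ[volume] E.indicator fun _ => 1) :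
    ‖f‖ₑ ^ 2 = volume E := by
  rw [← ofReal_norm, ← Lp.norm_fourier_eq f, ofReal_norm, Lp.enorm_def, eLpNorm_congr_ae hfE,
    eLpNorm_indicator_const hE (by norm_num) (by norm_num), enorm_one, one_mul,
    ← ENNReal.rpow_natCast, ← ENNReal.rpow_mul]
  norm_num

theorem setLIntegral_tsum_natCast_enorm_sq_le {A : GL (Fin d) ℝ} {ψ : L2 d} {C : NNReal}
    (hC : ∀ f, ∑' m : ℕ, quasiLayer A ψ (-m) f ≤ C * ‖f‖ₑ ^ 2) {E : Set (Rd d)}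
    (hE : MeasurableSet E) {k : Fin d → ℤ} (hk : E ⊆ latticeCell k) :
    ∫⁻ ξ in E, ∑' m : ℕ, ‖(𝓕 ψ : L2 d) (adjPow A m ξ)‖ₑ ^ 2 ≤ C * volume E := by
  obtain ⟨R, hR⟩ := exists_norm_le_of_mem_latticeCell k
  obtain ⟨f, hf, hfE⟩ := exists_isBandLimited_fourier_ae_indicator hE fun x hx => hR x (hk hx)
  calc ∫⁻ ξ in E, ∑' m : ℕ, ‖(𝓕 ψ : L2 d) (adjPow A m ξ)‖ₑ ^ 2
      = ∑' m : ℕ, ∫⁻ ξ in E, ‖(𝓕 ψ : L2 d) (adjPow A m ξ)‖ₑ ^ 2 :=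
        lintegral_tsum fun m =>
          ((measurable_fourier_adjPow A ψ m).enorm.pow_const 2).aemeasurable
    _ = ∑' m : ℕ, quasiLayer A ψ (-m) f := tsum_congr fun m => by
        rw [quasiLayer_of_indicator A ψ (-m) hE hk hf hfE, neg_neg]
    _ ≤ C * ‖f‖ₑ ^ 2 := hC f
    _ = C * volume E := by rw [enorm_sq_eq_volume_of_fourier_ae_indicator hE hfE]

theorem ae_tsum_natCast_enorm_sq_le {A : GL (Fin d) ℝ} {ψ : L2 d} {C : NNReal}
    (hC : ∀ f, ∑' m : ℕ, quasiLayer A ψ (-m) f ≤ C * ‖f‖ₑ ^ 2) :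
    ∀ᵐ ξ : Rd d, ∑' m : ℕ, ‖(𝓕 ψ : L2 d) (adjPow A m ξ)‖ₑ ^ 2 ≤ C := by
  refine ae_of_ae_restrict_latticeCell fun k => ?_
  have hmeas : Measurable fun ξ => ∑' m : ℕ, ‖(𝓕 ψ : L2 d) (adjPow A m ξ)‖ₑ ^ 2 :=
    Measurable.tsum fun m => (measurable_fourier_adjPow A ψ m).enorm.pow_const 2
  refine ae_le_of_forall_setLIntegral_le_of_sigmaFinite hmeas fun s hs _ => ?_
  rw [lintegral_const, Measure.restrict_apply_univ, Measure.restrict_restrict hs,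
    Measure.restrict_apply hs]
  exact setLIntegral_tsum_natCast_enorm_sq_le hC (hs.inter (measurableSet_latticeCell k))
    Set.inter_subset_right

theorem tsum_natCast_add_sum_range_eq (g : ℤ → ℝ≥0∞) (N : ℕ) :
    ∑' m : ℕ, g m + ∑ m ∈ Finset.range N, g (-(m + 1 : ℤ)) = ∑' m : ℕ, g (m - N) := by
  induction N with
  | zero => simp
  | succ N ih =>
    rw [Finset.sum_range_succ, ← add_assoc, ih,
      tsum_eq_zero_add' (f := fun m : ℕ => g (m - (N + 1 : ℕ))) ENNReal.summable, add_comm]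
    push_cast
    simp

theorem tsum_int_eq_iSup_tsum_nat_sub (g : ℤ → ℝ≥0∞) :
    ∑' j, g j = ⨆ N : ℕ, ∑' m : ℕ, g (m - N) := by
  rw [tsum_of_nat_of_neg_add_one (f := g) ENNReal.summable ENNReal.summable,
    ENNReal.tsum_eq_iSup_nat (f := fun n : ℕ => g (-(n + 1 : ℤ))), ENNReal.add_iSup]
  exact iSup_congr (tsum_natCast_add_sum_range_eq g)

theorem ae_tsum_intCast_enorm_sq_le {A : GL (Fin d) ℝ} {ψ : L2 d} {C : NNReal}
    (hC : ∀ f, ∑' m : ℕ, quasiLayer A ψ (-m) f ≤ C * ‖f‖ₑ ^ 2) :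
    ∀ᵐ ξ : Rd d, ∑' j : ℤ, ‖(𝓕 ψ : L2 d) (adjPow A j ξ)‖ₑ ^ 2 ≤ C := by
  have hshift : ∀ᵐ ξ : Rd d, ∀ N : ℕ,
      ∑' m : ℕ, ‖(𝓕 ψ : L2 d) (adjPow A m (adjPow A (-N) ξ))‖ₑ ^ 2 ≤ C :=
    ae_all_iff.2 fun N =>
      (quasiMeasurePreserving_adjPow A (-N)).ae (ae_tsum_natCast_enorm_sq_le hC)
  filter_upwards [hshift] with ξ hξ
  rw [tsum_int_eq_iSup_tsum_nat_sub]
  refine iSup_le fun N => ?_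
  simpa only [adjPow_adjPow, ← sub_eq_add_neg] using hξ N

end Calderon

/-! ### Frequency-shift components -/

section Frequency

variable {d r : ℕ}

theorem adjPow_natCast_intVec {A : GL (Fin d) ℝ} (hint : IsIntegralMatrix A) (n : ℕ) :
    ∃ m : (Fin d → ℤ) → Fin d → ℤ, ∀ l, adjPow A n (intVec l) = intVec (m l) := by
  obtain ⟨M, hM⟩ := hint.exists_intMatrix
  refine ⟨(M ^ n).transpose.mulVec, fun l => ?_⟩
  rw [← matAct_intVec, adjPow]
  congr 2
  rw [zpow_natCast, Units.val_pow_eq_pow_val, hM, Matrix.transpose_map]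
  exact congrArg Matrix.transpose (map_pow (Int.castRingHom ℝ).mapMatrix M n).symm

theorem enorm_mul_le_add_sq (a b : ℂ) : ‖a * b‖ₑ ≤ ‖a‖ₑ ^ 2 + ‖b‖ₑ ^ 2 := by
  rw [enorm_mul]
  rcases le_total ‖a‖ₑ ‖b‖ₑ with hab | hba
  · calc ‖a‖ₑ * ‖b‖ₑ ≤ ‖b‖ₑ * ‖b‖ₑ := by gcongr
      _ ≤ ‖a‖ₑ ^ 2 + ‖b‖ₑ ^ 2 := by rw [← sq]; exact le_add_self
  · calc ‖a‖ₑ * ‖b‖ₑ ≤ ‖a‖ₑ * ‖a‖ₑ := by gcongr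
      _ ≤ ‖a‖ₑ ^ 2 + ‖b‖ₑ ^ 2 := by rw [← sq]; exact le_self_add

theorem ae_tsum_crossTerm_le {A : GL (Fin d) ℝ} {φ ψ : L2 d} {C C' : NNReal}
    (hφ : ∀ᵐ ξ : Rd d, ∑' j : ℤ, ‖(𝓕 φ : L2 d) (adjPow A j ξ)‖ₑ ^ 2 ≤ C)
    (hψ : ∀ᵐ ξ : Rd d, ∑' j : ℤ, ‖(𝓕 ψ : L2 d) (adjPow A j ξ)‖ₑ ^ 2 ≤ C') (a : Rd d) :
    ∀ᵐ ξ : Rd d, ∑' j : ℤ, ‖crossTerm A φ ψ j ξ (ξ + a)‖ₑ ≤ C + C' := by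
  filter_upwards [hφ, (measurePreserving_add_right volume a).quasiMeasurePreserving.ae hψ]
    with ξ hφξ hψξ
  refine le_trans ?_ (add_le_add hφξ hψξ)
  rw [← ENNReal.tsum_add]
  refine ENNReal.tsum_le_tsum fun j => (enorm_mul_le_add_sq _ _).trans_eq ?_
  rw [RCLike.enorm_conj]

theorem summable_of_tsum_enorm_le {ι : Type*} {u : ι → ℂ} {C : NNReal}
    (h : ∑' j, ‖u j‖ₑ ≤ C) : Summable u :=
  Summable.of_norm (by
    simpa only [toReal_enorm] using
      ENNReal.summable_toReal (ne_top_of_le_ne_top ENNReal.coe_ne_top h))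

theorem measurable_crossTerm (A : GL (Fin d) ℝ) (φ ψ : L2 d) (j : ℤ) (a : Rd d) :
    Measurable fun ξ => crossTerm A φ ψ j ξ (ξ + a) :=
  (Complex.continuous_conj.measurable.comp (measurable_fourier_adjPow A φ j)).mul
    ((measurable_fourier_adjPow A ψ j).comp (measurable_add_const a))

theorem integrable_shift_mul_conj (f g : L2 d) (a : Rd d) :
    Integrable fun ξ => (𝓕 f : L2 d) (ξ + a) * conj ((𝓕 g : L2 d) ξ) :=
  ((Lp.memLp (𝓕 f : L2 d)).comp_measurePreserving
    (measurePreserving_add_right volume a)).integrable_mul (Lp.memLp (𝓕 g : L2 d)).star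

theorem hasSum_integral_mul_of_tsum_enorm_le {α ι : Type*} [MeasurableSpace α] {μ : Measure α}
    [Countable ι] {u : ι → α → ℂ} {w : α → ℂ} {C : NNReal}
    (hu : ∀ j, AEStronglyMeasurable (u j) μ) (hle : ∀ᵐ x ∂μ, ∑' j, ‖u j x‖ₑ ≤ C)
    (hw : Integrable w μ) :
    HasSum (fun j => ∫ x, u j x * w x ∂μ) (∫ x, (∑' j, u j x) * w x ∂μ) := by
  have hmeas : ∀ j, AEStronglyMeasurable (fun x => u j x * w x) μ := fun j => (hu j).mul hw.1
  have hfin : ∑' j, ∫⁻ x, ‖u j x * w x‖ₑ ∂μ ≠ ∞ := by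
    rw [← lintegral_tsum fun j => (hmeas j).enorm]
    have hbound : ∫⁻ x, ∑' j, ‖u j x * w x‖ₑ ∂μ ≤ ∫⁻ x, C * ‖w x‖ₑ ∂μ := by
      refine lintegral_mono_ae ?_
      filter_upwards [hle] with x hx
      simp only [enorm_mul]
      rw [ENNReal.tsum_mul_right]
      gcongr
    refine ne_top_of_le_ne_top ?_ hbound
    rw [lintegral_const_mul' _ _ ENNReal.coe_ne_top]
    exact ENNReal.mul_ne_top ENNReal.coe_ne_top hw.2.ne
  have hintegrable : ∀ j, Integrable (fun x => u j x * w x) μ := fun j =>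
    ⟨hmeas j, (ne_top_of_le_ne_top hfin (ENNReal.le_tsum j)).lt_top⟩
  have hsummable : Summable fun j => ∫ x, ‖u j x * w x‖ ∂μ :=
    (ENNReal.summable_toReal hfin).congr fun j => by
      rw [integral_norm_eq_lintegral_enorm (hmeas j)]
  simpa only [tsum_mul_right] using
    hasSum_integral_of_summable_integral_norm hintegrable hsummable

theorem hasSum_indicator_shiftPairing {A : GL (Fin d) ℝ} {φ ψ : L2 d} {C : NNReal} {a : Rd d}
    (h : ∀ᵐ ξ : Rd d, ∑' j : ℤ, ‖crossTerm A φ ψ j ξ (ξ + a)‖ₑ ≤ C) (f g : L2 d) (s : Set ℤ) :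
    HasSum (s.indicator fun n => shiftPairing A ψ φ f g n a)
      (∫ ξ, (∑' n : ℤ, s.indicator (fun n => conj (crossTerm A φ ψ (-n) ξ (ξ + a))) n)
        * ((𝓕 f : L2 d) (ξ + a) * conj ((𝓕 g : L2 d) ξ))) := by
  refine hasSum_of_eq (hasSum_integral_mul_of_tsum_enorm_le (C := C)
    (u := fun n ξ => s.indicator (fun n => conj (crossTerm A φ ψ (-n) ξ (ξ + a))) n)
    (fun n => ?_) ?_ (integrable_shift_mul_conj f g a)) (fun n => ?_) rfl
  · by_cases hn : n ∈ s
    · simp only [Set.indicator_of_mem hn]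
      exact (Complex.continuous_conj.measurable.comp
        (measurable_crossTerm A φ ψ (-n) a)).aestronglyMeasurable
    · simp only [Set.indicator_of_notMem hn]
      exact aestronglyMeasurable_const
  · filter_upwards [h] with ξ hξ
    rw [← (Equiv.neg ℤ).tsum_eq] at hξ
    refine (ENNReal.tsum_le_tsum fun n => ?_).trans hξ
    exact (enorm_indicator_le_enorm_self _ _).trans_eq (RCLike.enorm_conj _)
  · by_cases hn : n ∈ s
    · simp only [Set.indicator_of_mem hn, shiftPairing]
    · simp only [Set.indicator_of_notMem hn, zero_mul, integral_zero]

/-- The scales `n` at which the quasi-affine system carries the frequency shift `k`. -/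
def activeScales (A : GL (Fin d) ℝ) (k : Fin d → ℤ) : Set ℤ :=
  {n | n ≤ 0 ∨ ∃ l, adjPow A n (intVec l) = intVec k}

/-- The frequency-shift component of the quasi-affine mixed Gramian at the shift `k`. -/
def shiftComponent (A : GL (Fin d) ℝ) (Ψ Φ : Fin r → L2 d) (f g : L2 d) (k : Fin d → ℤ) : ℂ :=
  ∑' n : ℤ, (activeScales A k).indicator
    (fun n => ∑ i, shiftPairing A (Ψ i) (Φ i) f g n (intVec k)) n

theorem shiftComponent_translation (A : GL (Fin d) ℝ) (Ψ Φ : Fin r → L2 d) (f g : L2 d)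
    (k : Fin d → ℤ) (β : Rd d) :
    shiftComponent A Ψ Φ (translation β f) (translation β g) k
      = planeWave (-β) (intVec k) * shiftComponent A Ψ Φ f g k := by
  rw [shiftComponent, shiftComponent, ← tsum_mul_left]
  refine tsum_congr fun n => ?_
  by_cases hn : n ∈ activeScales A k
  · simp only [Set.indicator_of_mem hn, shiftPairing_translation, Finset.mul_sum]
  · simp only [Set.indicator_of_notMem hn, mul_zero]

theorem adjPow_intVec_eq_iff_of_adjPow_eq {A : GL (Fin d) ℝ} {N : ℕ} {k k' : Fin d → ℤ}
    (hk : adjPow A N (intVec k) = intVec k') (n : ℤ) (l : Fin d → ℤ) :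
    adjPow A n (intVec l) = intVec k' ↔ adjPow A (n - N) (intVec l) = intVec k := by
  rw [← hk, ← (adjPow_injective A N).eq_iff (a := adjPow A (n - N) (intVec l)), adjPow_adjPow,
    add_sub_cancel]

theorem mem_activeScales_of_adjPow_eq {A : GL (Fin d) ℝ} (hint : IsIntegralMatrix A) {N : ℕ}
    {k k' : Fin d → ℤ} (hk : adjPow A N (intVec k) = intVec k') (n : ℤ) :
    n ∈ activeScales A k' ↔ n - N ∈ activeScales A k := by
  simp only [activeScales, Set.mem_ofPred_eq, adjPow_intVec_eq_iff_of_adjPow_eq hk]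
  refine ⟨Or.imp_left fun _ => by omega, ?_⟩
  rintro (hnN | hl)
  · obtain ⟨m, hm⟩ := adjPow_natCast_intVec hint (N - n).toNat
    refine Or.inr ⟨m k, ?_⟩
    rw [← hm, adjPow_adjPow, Int.toNat_of_nonneg (by omega),
      show n - N + (N - n) = 0 by ring, adjPow_zero]
  · exact Or.inr hl

theorem shiftComponent_dilation {A : GL (Fin d) ℝ} (hint : IsIntegralMatrix A) {N : ℕ}
    {k k' : Fin d → ℤ} (hk : adjPow A N (intVec k) = intVec k') (Ψ Φ : Fin r → L2 d)
    (f g : L2 d) :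
    shiftComponent A Ψ Φ ((dilation A ^ (N : ℤ)) f) ((dilation A ^ (N : ℤ)) g) k'
      = shiftComponent A Ψ Φ f g k := by
  have hmem := mem_activeScales_of_adjPow_eq hint hk
  rw [shiftComponent, shiftComponent, ← (Equiv.subRight (N : ℤ)).tsum_eq fun n =>
    (activeScales A k).indicator (fun n => ∑ i, shiftPairing A (Ψ i) (Φ i) f g n (intVec k)) n]
  refine tsum_congr fun n => ?_
  rw [Equiv.subRight_apply]
  by_cases hn : n ∈ activeScales A k'
  · rw [Set.indicator_of_mem hn, Set.indicator_of_mem ((hmem n).1 hn)]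
    simp only [← hk, shiftPairing_dilation]
  · rw [Set.indicator_of_notMem hn, Set.indicator_of_notMem (mt (hmem n).2 hn)]

theorem hasSum_inner_mixedGramian {H J : Type*} [NormedAddCommGroup H] [InnerProductSpace ℂ H]
    [CompleteSpace H] {x y : J → H} (hx : IsBesselSeq x) (hy : IsBesselSeq y) (f g : H) :
    HasSum (fun j => ⟪x j, f⟫_ℂ * ⟪g, y j⟫_ℂ) ⟪g, mixedGramian hx hy f⟫_ℂ := by
  simpa [inner_smul_right] using (hasSum_mixedGramian hx hy f).mapL (innerSL ℂ g)

theorem hasSum_sum_of_hasSum_middle {ι κ : Type*} {c : ι × κ × Fin r → ℂ} {T : ℂ}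
    {L : ι → Fin r → ℂ} (h : HasSum c T) (hL : ∀ n i, HasSum (fun z => c (n, z, i)) (L n i)) :
    HasSum (fun n => ∑ i, L n i) T := by
  let reorder : (ι × Fin r) × κ ≃ ι × κ × Fin r :=
    { toFun := fun p => (p.1.1, p.2, p.1.2)
      invFun := fun p => ((p.1, p.2.2), p.2.1)
      left_inv := fun _ => rfl
      right_inv := fun _ => rfl }
  have hpairs := (reorder.hasSum_iff.2 h).prod_fiberwise (g := fun p : ι × Fin r => L p.1 p.2)
    fun p => hL p.1 p.2
  exact hpairs.prod_fiberwise fun n => hasSum_fintype _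

theorem tsum_adjPow_natCast_eq_tsum_indicator_activeScales {A : GL (Fin d) ℝ}
    (hint : IsIntegralMatrix A) (n : ℕ) (p : Rd d → ℂ) :
    ∑' l, p (adjPow A n (intVec l))
      = ∑' k, (activeScales A k).indicator (fun _ => p (intVec k)) n := by
  obtain ⟨m, hm⟩ := adjPow_natCast_intVec hint n
  have hinj : Function.Injective m := fun a b hab =>
    intVec_injective (adjPow_injective A n (by rw [hm, hm, hab]))
  rw [← hinj.tsum_eq (f := fun k => (activeScales A k).indicator (fun _ => p (intVec k)) (n : ℤ))]
  · refine tsum_congr fun l => ?_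
    rw [Set.indicator_of_mem (show (n : ℤ) ∈ activeScales A (m l) from Or.inr ⟨l, hm l⟩), hm]
  · intro k hk
    rcases Set.mem_of_indicator_ne_zero hk with hn | ⟨l, hl⟩
    · obtain rfl : n = 0 := by omega
      exact ⟨k, intVec_injective (by rw [← hm, Nat.cast_zero, adjPow_zero])⟩
    · exact ⟨l, intVec_injective (by rw [← hm, hl])⟩

theorem hasSum_inner_quasiAffineSystem_mul {A : GL (Fin d) ℝ} (hint : IsIntegralMatrix A)
    (Ψ Φ : Fin r → L2 d) {f g : L2 d} (hf : IsBandLimited f) (hg : IsBandLimited g) (n : ℤ)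
    (i : Fin r) :
    HasSum (fun z => ⟪quasiAffineSystem A Ψ (n, z, i), f⟫_ℂ
        * ⟪g, quasiAffineSystem A Φ (n, z, i)⟫_ℂ)
      (∑' k, (activeScales A k).indicator
        (fun n => shiftPairing A (Ψ i) (Φ i) f g n (intVec k)) n) := by
  rcases lt_or_ge n 0 with hn | hn
  · refine hasSum_of_eq (hasSum_inner_translation_dilationR_mul A (ψ := Ψ i) (φ := Φ i) hf hg n)
      (fun z => ?_) (tsum_congr fun l => ?_)
    · simp [quasiAffineSystem, not_le.2 hn]
    · rw [Set.indicator_of_mem (show n ∈ activeScales A l from Or.inl hn.le)]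
  · refine hasSum_of_eq (hasSum_inner_dilation_translation_mul A (ψ := Ψ i) (φ := Φ i) hf hg n)
      (fun z => ?_) ?_
    · simp [quasiAffineSystem, hn]
    · lift n to ℕ using hn
      exact tsum_adjPow_natCast_eq_tsum_indicator_activeScales hint n
        (shiftPairing A (Ψ i) (Φ i) f g n)

theorem exists_finset_shiftPairing_eq_zero (A : GL (Fin d) ℝ) (Ψ Φ : Fin r → L2 d) {f g : L2 d}
    (hf : IsBandLimited f) (hg : IsBandLimited g) :
    ∃ S : Finset (Fin d → ℤ),
      ∀ k ∉ S, ∀ n i, shiftPairing A (Ψ i) (Φ i) f g n (intVec k) = 0 := by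
  obtain ⟨h, R, C, -, -, hR, hfh⟩ := hf
  obtain ⟨h', R', C', -, -, hR', hgh'⟩ := hg
  obtain ⟨N, hN⟩ := exists_nat_gt (R + R')
  refine ⟨latticeBox d N, fun k hk n i =>
    shiftPairing_eq_zero_of_add_lt_norm hR hfh hR' hgh' A n ?_⟩
  contrapose! hk
  exact mem_latticeBox_of_norm_le (hk.trans hN.le)

/-- Uniform boundedness of the Calderón sums of a finite system. -/
def HasCalderonBound (A : GL (Fin d) ℝ) (Ψ : Fin r → L2 d) : Prop :=
  ∃ C : NNReal, ∀ᵐ ξ : Rd d, ∀ i, ∑' j : ℤ, ‖(𝓕 (Ψ i) : L2 d) (adjPow A j ξ)‖ₑ ^ 2 ≤ C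

theorem tsum_quasiLayer_neg_natCast_le_besselSum (A : GL (Fin d) ℝ) (Ψ : Fin r → L2 d)
    (i : Fin r) (f : L2 d) :
    ∑' m : ℕ, quasiLayer A (Ψ i) (-m) f ≤ besselSum (quasiAffineSystem A Ψ) f := by
  rw [besselSum_quasiAffineSystem]
  calc ∑' m : ℕ, quasiLayer A (Ψ i) (-m) f
      = ∑' m : ℕ, if 0 ≤ -(m : ℤ) then affineLayer A (Ψ i) (-m) f
          else quasiLayer A (Ψ i) (-m) f := tsum_congr fun m => by
        rcases Nat.eq_zero_or_pos m with rfl | hm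
        · simp [quasiLayer_zero]
        · simp [Nat.pos_iff_ne_zero.1 hm]
    _ ≤ ∑' n : ℤ, if 0 ≤ n then affineLayer A (Ψ i) n f else quasiLayer A (Ψ i) n f :=
        ENNReal.tsum_comp_le_tsum_of_injective (f := fun m : ℕ => -(m : ℤ))
          (neg_injective.comp Nat.cast_injective) _
    _ ≤ _ := Finset.single_le_sum (f := fun i => ∑' n : ℤ,
          if 0 ≤ n then affineLayer A (Ψ i) n f else quasiLayer A (Ψ i) n f)
          (fun _ _ => zero_le) (Finset.mem_univ i)

theorem hasCalderonBound_of_isBesselSeq {A : GL (Fin d) ℝ} {Ψ : Fin r → L2 d}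
    (h : IsBesselSeq (quasiAffineSystem A Ψ)) : HasCalderonBound A Ψ := by
  obtain ⟨C, hC⟩ := (isBesselSeq_iff_besselSum_le _).1 h
  exact ⟨C, ae_all_iff.2 fun i => ae_tsum_intCast_enorm_sq_le fun f =>
    (tsum_quasiLayer_neg_natCast_le_besselSum A Ψ i f).trans (hC f)⟩

theorem HasCalderonBound.exists_tsum_crossTerm_le {A : GL (Fin d) ℝ} {Ψ Φ : Fin r → L2 d}
    (hΨ : HasCalderonBound A Ψ) (hΦ : HasCalderonBound A Φ) :
    ∃ C : NNReal, ∀ a : Rd d, ∀ᵐ ξ : Rd d, ∀ i,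
      ∑' j : ℤ, ‖crossTerm A (Φ i) (Ψ i) j ξ (ξ + a)‖ₑ ≤ C := by
  obtain ⟨C, hC⟩ := hΨ
  obtain ⟨C', hC'⟩ := hΦ
  refine ⟨C' + C, fun a => ae_all_iff.2 fun i => ?_⟩
  exact_mod_cast ae_tsum_crossTerm_le (ae_all_iff.1 hC' i) (ae_all_iff.1 hC i) a

theorem HasCalderonBound.ae_summable_crossTerm {A : GL (Fin d) ℝ} {Ψ Φ : Fin r → L2 d}
    (hΨ : HasCalderonBound A Ψ) (hΦ : HasCalderonBound A Φ) (a : Rd d) :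
    ∀ᵐ ξ : Rd d, ∀ i, Summable fun j : ℤ => crossTerm A (Φ i) (Ψ i) j ξ (ξ + a) := by
  obtain ⟨C, hC⟩ := hΨ.exists_tsum_crossTerm_le hΦ
  filter_upwards [hC a] with ξ hξ i
  exact summable_of_tsum_enorm_le (hξ i)

theorem summable_indicator_shiftPairing {A : GL (Fin d) ℝ} {Ψ Φ : Fin r → L2 d}
    (hΨ : HasCalderonBound A Ψ) (hΦ : HasCalderonBound A Φ) (f g : L2 d) (a : Rd d) (s : Set ℤ)
    (i : Fin r) : Summable (s.indicator fun n => shiftPairing A (Ψ i) (Φ i) f g n a) := by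
  obtain ⟨C, hC⟩ := hΨ.exists_tsum_crossTerm_le hΦ
  exact (hasSum_indicator_shiftPairing (ae_all_iff.1 (hC a) i) f g s).summable

theorem indicator_sum_apply {ι κ E : Type*} [AddCommMonoid E] [Fintype κ] (s : Set ι)
    (u : κ → ι → E) (n : ι) :
    s.indicator (fun n => ∑ i, u i n) n = ∑ i, s.indicator (u i) n := by
  by_cases hn : n ∈ s <;> simp [hn]

theorem inner_quasiGramian_eq_sum_shiftComponent {A : GL (Fin d) ℝ} (hint : IsIntegralMatrix A)
    {Ψ Φ : Fin r → L2 d} (hΨ : IsBesselSeq (quasiAffineSystem A Ψ))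
    (hΦ : IsBesselSeq (quasiAffineSystem A Φ)) {f g : L2 d} (hf : IsBandLimited f)
    (hg : IsBandLimited g) {S : Finset (Fin d → ℤ)}
    (hS : ∀ k ∉ S, ∀ n i, shiftPairing A (Ψ i) (Φ i) f g n (intVec k) = 0) :
    ⟪g, mixedGramian hΨ hΦ f⟫_ℂ = ∑ k ∈ S, shiftComponent A Ψ Φ f g k := by
  have hscales := hasSum_sum_of_hasSum_middle (hasSum_inner_mixedGramian hΨ hΦ f g)
    fun n i => hasSum_inner_quasiAffineSystem_mul hint Ψ Φ hf hg n i
  refine hscales.unique ?_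
  have hcomponent : ∀ k ∈ S, HasSum (fun n => (activeScales A k).indicator
      (fun n => ∑ i, shiftPairing A (Ψ i) (Φ i) f g n (intVec k)) n)
      (shiftComponent A Ψ Φ f g k) := by
    intro k _
    refine Summable.hasSum ?_
    simp only [indicator_sum_apply]
    exact summable_sum fun i _ => summable_indicator_shiftPairing
      (hasCalderonBound_of_isBesselSeq hΨ) (hasCalderonBound_of_isBesselSeq hΦ) f g _ _ i
  refine hasSum_of_eq (hasSum_sum hcomponent) (fun n => ?_) rfl
  simp only [indicator_sum_apply]
  rw [Finset.sum_comm]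
  refine Finset.sum_congr rfl fun i _ => tsum_eq_sum fun k hk => ?_
  simp [hS k hk]

theorem shiftComponent_eq_zero {A : GL (Fin d) ℝ} {Ψ Φ : Fin r → L2 d} {f g : L2 d}
    {k : Fin d → ℤ} (hk : ∀ n i, shiftPairing A (Ψ i) (Φ i) f g n (intVec k) = 0) :
    shiftComponent A Ψ Φ f g k = 0 := by
  simp [shiftComponent, hk]

theorem inner_quasiGramian_translation {A : GL (Fin d) ℝ} (hint : IsIntegralMatrix A)
    {Ψ Φ : Fin r → L2 d} (hΨ : IsBesselSeq (quasiAffineSystem A Ψ))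
    (hΦ : IsBesselSeq (quasiAffineSystem A Φ)) {f g : L2 d} (hf : IsBandLimited f)
    (hg : IsBandLimited g) {S : Finset (Fin d → ℤ)}
    (hS : ∀ k ∉ S, ∀ n i, shiftPairing A (Ψ i) (Φ i) f g n (intVec k) = 0) (β : Rd d) :
    ⟪translation β g, mixedGramian hΨ hΦ (translation β f)⟫_ℂ
      = ∑ k ∈ S, planeWave (-β) (intVec k) * shiftComponent A Ψ Φ f g k := by
  rw [inner_quasiGramian_eq_sum_shiftComponent hint hΨ hΦ (hf.translation β) (hg.translation β)
    (S := S)]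
  · simp only [shiftComponent_translation]
  · intro k hk n i
    rw [shiftPairing_translation, hS k hk, mul_zero]

/- The components are the Fourier coefficients of the `ℤᵈ`-periodic function
`β ↦ ⟪T_β g, θ^q T_β f⟫`. -/
theorem integral_inner_quasiGramian {A : GL (Fin d) ℝ} (hint : IsIntegralMatrix A)
    {Ψ Φ : Fin r → L2 d} (hΨ : IsBesselSeq (quasiAffineSystem A Ψ))
    (hΦ : IsBesselSeq (quasiAffineSystem A Φ)) {f g : L2 d} (hf : IsBandLimited f)
    (hg : IsBandLimited g) (k : Fin d → ℤ) :
    ∫ β in unitCube d, planeWave (intVec k) β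
        * ⟪translation β g, mixedGramian hΨ hΦ (translation β f)⟫_ℂ
      = shiftComponent A Ψ Φ f g k := by
  classical
  obtain ⟨S, hS⟩ := exists_finset_shiftPairing_eq_zero A Ψ Φ hf hg
  have hintegrable : ∀ (l : Fin d → ℤ) (c : ℂ),
      Integrable (fun β => planeWave (intVec l) β * c) (volume.restrict (unitCube d)) :=
    fun l c => (Integrable.of_bound (by fun_prop) 1
      (.of_forall fun β => (norm_planeWave _ β).le)).mul_const c
  have hexpand : ∀ β : Rd d, planeWave (intVec k) β
        * ⟪translation β g, mixedGramian hΨ hΦ (translation β f)⟫_ℂ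
      = ∑ l ∈ S, planeWave (intVec (k - l)) β * shiftComponent A Ψ Φ f g l := by
    intro β
    rw [inner_quasiGramian_translation hint hΨ hΦ hf hg hS, Finset.mul_sum]
    refine Finset.sum_congr rfl fun l _ => ?_
    rw [← mul_assoc, planeWave_comm (-β), sub_eq_add_neg, intVec_add, intVec_neg,
      planeWave_add_left, planeWave_neg_left, planeWave_neg_right]
  simp only [hexpand]
  rw [integral_finsetSum _ fun l _ => hintegrable _ _]
  simp only [integral_mul_const, integral_unitCube_planeWave, sub_eq_zero, ite_mul, one_mul,
    zero_mul, Finset.sum_ite_eq]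
  split_ifs with hk
  · rfl
  · exact (shiftComponent_eq_zero (hS k hk)).symm

theorem shiftComponent_eq_integral {A : GL (Fin d) ℝ} {Ψ Φ : Fin r → L2 d}
    (hΨ : HasCalderonBound A Ψ) (hΦ : HasCalderonBound A Φ) (f g : L2 d) (k : Fin d → ℤ) :
    shiftComponent A Ψ Φ f g k = ∑ i, ∫ ξ, (∑' n : ℤ, (activeScales A k).indicator
        (fun n => conj (crossTerm A (Φ i) (Ψ i) (-n) ξ (ξ + intVec k))) n)
        * ((𝓕 f : L2 d) (ξ + intVec k) * conj ((𝓕 g : L2 d) ξ)) := by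
  obtain ⟨C, hC⟩ := hΨ.exists_tsum_crossTerm_le hΦ
  have hsum := hasSum_sum fun (i : Fin r) (_ : i ∈ Finset.univ) =>
    hasSum_indicator_shiftPairing (ae_all_iff.1 (hC (intVec k)) i) f g (activeScales A k)
  rw [shiftComponent, ← hsum.tsum_eq]
  simp only [indicator_sum_apply]

end Frequency

/-! ### Expansive matrices -/

section Expansive

open Filter Topology

theorem tendsto_pow_nhds_zero_of_norm_spectrum_lt_one {R : Type*} [NormedRing R]
    [NormedAlgebra ℂ R] [CompleteSpace R] {a : R} (ha : ∀ z ∈ spectrum ℂ a, ‖z‖ < 1) :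
    Tendsto (fun n : ℕ => a ^ n) atTop (𝓝 0) := by
  rcases subsingleton_or_nontrivial R with _ | _
  · simp [Subsingleton.elim _ (0 : R)]
  have hradius : spectralRadius ℂ a < (1 : NNReal) :=
    spectrum.spectralRadius_lt_of_forall_lt a fun z hz => by exact_mod_cast ha z hz
  obtain ⟨c, hac, hc⟩ := ENNReal.lt_iff_exists_nnreal_btwn.1 hradius
  have hroot := (spectrum.pow_nnnorm_pow_one_div_tendsto_nhds_spectralRadius a).eventually_lt_const
    hac
  refine squeeze_zero_norm' ?_ (tendsto_pow_atTop_nhds_zero_of_lt_one c.2 (by exact_mod_cast hc))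
  filter_upwards [hroot, eventually_gt_atTop 0] with n hn hn0
  have hpow := ENNReal.rpow_le_rpow hn.le (z := (n : ℝ)) (by positivity)
  rw [← ENNReal.rpow_mul, one_div, inv_mul_cancel₀ (by positivity), ENNReal.rpow_one,
    ENNReal.rpow_natCast] at hpow
  exact_mod_cast hpow

attribute [local instance] Matrix.linftyOpNormedRing Matrix.linftyOpNormedAlgebra

variable {d : ℕ}

theorem IsExpansive.tendsto_zpow_neg {A : GL (Fin d) ℝ} (hA : IsExpansive A) :
    Tendsto (fun n : ℕ => (A ^ (-(n : ℤ))).val) atTop (𝓝 0) := by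
  set F : Matrix (Fin d) (Fin d) ℝ →+* Matrix (Fin d) (Fin d) ℂ := Complex.ofRealHom.mapMatrix
  set a : (Matrix (Fin d) (Fin d) ℂ)ˣ := Units.map (F : _ →* _) A with ha
  have hspec : ∀ z ∈ spectrum ℂ (a⁻¹).val, ‖z‖ < 1 := by
    intro z hz
    have hz' : z⁻¹ ∈ spectrum ℂ (Matrix.toLin' a.val) := by
      rw [Matrix.spectrum_toLin']
      exact spectrum.inv₀_mem_inv_iff.1 (by rwa [inv_inv])
    have hlt := hA _ (Module.End.hasEigenvalue_iff_mem_spectrum.2 hz')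
    rw [norm_inv] at hlt
    exact (one_lt_inv_iff₀.1 hlt).2
  have : CompleteSpace (Matrix (Fin d) (Fin d) ℂ) := FiniteDimensional.complete ℂ _
  have hpow : ∀ n : ℕ, (a⁻¹).val ^ n = F (A ^ (-(n : ℤ))).val := fun n => by
    rw [← Units.val_pow_eq_pow_val, inv_pow, ← zpow_natCast, ← zpow_neg, ha, ← map_zpow]
    rfl
  have hre := ((continuous_id.matrix_map Complex.continuous_re).tendsto _).comp
    (tendsto_pow_nhds_zero_of_norm_spectrum_lt_one hspec)
  convert hre using 2 with n
  · ext i j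
    simp only [Function.comp_apply, hpow, id]
    simp [F]
  · exact (Matrix.map_zero _ Complex.zero_re).symm

end Expansive

section Contraction

open Filter Topology

variable {d : ℕ} {A : GL (Fin d) ℝ}

theorem IsExpansive.exists_contraction (hA : IsExpansive A) :
    ∃ ε : ℕ → ℝ, Tendsto ε atTop (𝓝 0) ∧ (∀ n, 0 ≤ ε n) ∧
      ∀ (n : ℕ) x, ‖matAct (A ^ (-(n : ℤ))).val x‖ ≤ ε n * ‖x‖ := by
  let L : Matrix (Fin d) (Fin d) ℝ →ₗ[ℝ] Rd d →L[ℝ] Rd d :=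
    LinearMap.toContinuousLinearMap.toLinearMap ∘ₗ
      (Matrix.toEuclideanLin (𝕜 := ℝ) (m := Fin d) (n := Fin d)).toLinearMap
  have hL := (LinearMap.continuous_of_finiteDimensional L).continuousAt.tendsto.comp
    hA.tendsto_zpow_neg
  rw [map_zero] at hL
  exact ⟨fun n => ‖L (A ^ (-(n : ℤ))).val‖, by simpa using hL.norm, fun n => norm_nonneg _,
    fun n x => (L (A ^ (-(n : ℤ))).val).le_opNorm x⟩

theorem IsExpansive.one_lt_abs_det (hA : IsExpansive A) (hd : d ≠ 0) : 1 < |A.val.det| := by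
  have : Nonempty (Fin d) := ⟨⟨0, Nat.pos_of_ne_zero hd⟩⟩
  have hdet := ((continuous_id.matrix_det.tendsto _).comp hA.tendsto_zpow_neg).abs
  simp only [id, Function.comp_def, Matrix.det_zero, abs_zero, abs_det_zpow_neg, zpow_natCast,
    Units.val_pow_eq_pow_val, Matrix.det_pow, abs_pow, ← inv_pow,
    tendsto_pow_atTop_nhds_zero_iff, abs_inv, abs_abs] at hdet
  exact (inv_lt_one_iff₀.1 hdet).resolve_left (not_le.2 (abs_det_pos A))

theorem norm_matAct_transpose_le {M : Matrix (Fin d) (Fin d) ℝ} {C : ℝ}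
    (hM : ∀ x, ‖matAct M x‖ ≤ C * ‖x‖) (ξ : Rd d) : ‖matAct M.transpose ξ‖ ≤ C * ‖ξ‖ := by
  set v := matAct M.transpose ξ
  rcases (norm_nonneg v).eq_or_lt with hv0 | hvpos
  · rw [← hv0]
    by_contra! hneg
    have := (norm_nonneg _).trans (hM ξ)
    linarith
  · refine le_of_mul_le_mul_right ?_ hvpos
    calc ‖v‖ * ‖v‖ = ⟪matAct M v, ξ⟫_ℝ := by
          rw [← real_inner_self_eq_norm_mul_norm, inner_matAct_left M v ξ]
      _ ≤ ‖matAct M v‖ * ‖ξ‖ := real_inner_le_norm _ _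
      _ ≤ C * ‖v‖ * ‖ξ‖ := by gcongr; exact hM v
      _ = C * ‖ξ‖ * ‖v‖ := by ring

theorem intVec_eq_zero_of_norm_lt_one {k : Fin d → ℤ} (hk : ‖intVec k‖ < 1) : k = 0 := by
  ext i
  have hi : |(k i : ℝ)| < 1 := (abs_coord_le_norm (intVec k) i).trans_lt hk
  exact Int.abs_lt_one_iff.1 (by exact_mod_cast hi)

theorem exists_adjPow_natCast_eq_of_forall_mem_dualLattice {v : Rd d} (hv : v ∈ Set.range intVec)
    (hmem : ∀ (m : ℕ) q, adjPow A m (intVec q) = v → intVec q ∈ dualLattice A) (m : ℕ) :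
    ∃ q, adjPow A m (intVec q) = v := by
  induction m with
  | zero => simpa [adjPow_zero] using hv
  | succ m ih =>
    obtain ⟨q, hq⟩ := ih
    obtain ⟨q', hq'⟩ := hmem m q hq
    exact ⟨q', by rw [Nat.cast_succ, ← adjPow_adjPow, ← hq]; exact congrArg _ hq'⟩

/- Otherwise `k` would be divisible by all powers of `A^*`, although `A^*⁻ᵐ k → 0` leaves the
integer lattice. -/
theorem IsExpansive.exists_adjPow_notMem_dualLattice (hA : IsExpansive A) {k : Fin d → ℤ}
    (hk : k ≠ 0) :
    ∃ (m : ℕ) (q : Fin d → ℤ), intVec q ∉ dualLattice A ∧ adjPow A m (intVec q) = intVec k := by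
  by_contra! hcon
  obtain ⟨ε, hε, -, hεA⟩ := hA.exists_contraction
  have hlim : Tendsto (fun m => ε m * ‖intVec k‖) atTop (𝓝 0) := by
    simpa using hε.mul_const ‖intVec k‖
  obtain ⟨m, hm⟩ := (hlim.eventually_lt_const one_pos).exists
  obtain ⟨q, hq⟩ := exists_adjPow_natCast_eq_of_forall_mem_dualLattice ⟨k, rfl⟩
    (fun m q hq => not_not.1 fun h => hcon m q h hq) m
  have hqk : intVec q = adjPow A (-(m : ℤ)) (intVec k) := by
    rw [← hq, adjPow_adjPow, neg_add_cancel, adjPow_zero]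
  have hq0 : q = 0 := intVec_eq_zero_of_norm_lt_one <| by
    rw [hqk]
    exact (norm_matAct_transpose_le (hεA m) _).trans_lt hm
  refine hk (intVec_injective ?_)
  rw [← hq, hq0, intVec_zero]
  exact map_zero _

end Contraction

section Concentration

open Filter Topology Metric

theorem tendsto_tsum_indicator_closedBall {X J : Type*} [MetricSpace X] {w : J → ℝ≥0∞} {x : J → X}
    {b : X} {ε : ℕ → ℝ} (hε : Tendsto ε atTop (𝓝 0)) {ε₀ : ℝ} (hε₀ : 0 < ε₀)
    (hfin : ∑' j, (closedBall b ε₀).indicator (fun _ => w j) (x j) ≠ ∞) (hne : ∀ j, x j ≠ b) :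
    Tendsto (fun N => ∑' j, (closedBall b (ε N)).indicator (fun _ => w j) (x j)) atTop (𝓝 0) := by
  let _ : MeasurableSpace J := ⊤
  have hlim := tendsto_lintegral_filter_of_dominated_convergence (μ := (Measure.count : Measure J))
    (l := atTop) (F := fun N j => (closedBall b (ε N)).indicator (fun _ => w j) (x j))
    (f := fun _ => 0) (fun j => (closedBall b ε₀).indicator (fun _ => w j) (x j))
    (.of_forall fun N => measurable_from_top) ?_ (by rwa [lintegral_count]) ?_
  · simpa only [lintegral_count, tsum_zero] using hlim
  · filter_upwards [hε.eventually_lt_const hε₀] with N hN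
    exact .of_forall fun j => Set.indicator_le_indicator_of_subset
      (closedBall_subset_closedBall hN.le) (fun _ => zero_le) _
  · refine .of_forall fun j => tendsto_const_nhds.congr' ?_
    filter_upwards [hε.eventually_lt_const (dist_pos.2 (hne j))] with N hN
    rw [Set.indicator_of_notMem]
    simpa using hN

variable {d : ℕ}

theorem enorm_sq_eq_lintegral (f : L2 d) : ‖f‖ₑ ^ 2 = ∫⁻ x, ‖f x‖ₑ ^ 2 := by
  rw [Lp.enorm_def]
  simpa using eLpNorm_nnreal_pow_eq_lintegral (f := f) (μ := (volume : Measure (Rd d))) (p := 2)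
    two_ne_zero

theorem enorm_sq_toLp_indicator (f : L2 d) {E : Set (Rd d)} (hE : MeasurableSet E) :
    ‖((Lp.memLp f).indicator hE).toLp‖ₑ ^ 2 = ∫⁻ x in E, ‖f x‖ₑ ^ 2 := by
  rw [enorm_sq_eq_lintegral, ← lintegral_indicator hE]
  refine lintegral_congr_ae ?_
  filter_upwards [((Lp.memLp f).indicator hE).coeFn_toLp] with x hx
  rw [hx]
  by_cases hxE : x ∈ E <;> simp [hxE]

theorem inner_toLp_indicator (f : L2 d) {g : L2 d} {E : Set (Rd d)} (hE : MeasurableSet E)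
    (hg : ∀ᵐ x, x ∉ E → g x = 0) : ⟪((Lp.memLp f).indicator hE).toLp, g⟫_ℂ = ⟪f, g⟫_ℂ := by
  rw [L2.inner_def, L2.inner_def]
  refine integral_congr_ae ?_
  filter_upwards [((Lp.memLp f).indicator hE).coeFn_toLp, hg] with x hx hgx
  rw [hx]
  by_cases hxE : x ∈ E
  · rw [Set.indicator_of_mem hxE]
  · rw [hgx hxE, inner_zero_right, inner_zero_right]

theorem enorm_inner_sq_le_setLIntegral (f : L2 d) {g : L2 d} {E : Set (Rd d)}
    (hE : MeasurableSet E) (hg : ∀ᵐ x, x ∉ E → g x = 0) :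
    ‖⟪f, g⟫_ℂ‖ₑ ^ 2 ≤ ‖g‖ₑ ^ 2 * ∫⁻ x in E, ‖f x‖ₑ ^ 2 := by
  rw [← inner_toLp_indicator f hE hg, ← enorm_sq_toLp_indicator f hE, mul_comm, ← mul_pow]
  gcongr
  rw [← ofReal_norm, ← ofReal_norm, ← ofReal_norm, ← ENNReal.ofReal_mul (norm_nonneg _)]
  exact ENNReal.ofReal_le_ofReal (norm_inner_le_norm _ _)

theorem enorm_sq_sqrt_abs_mul (t : ℝ) (z : ℂ) :
    ‖(Real.sqrt |t| : ℂ) * z‖ₑ ^ 2 = ENNReal.ofReal |t| * ‖z‖ₑ ^ 2 := by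
  rw [enorm_mul, mul_pow, enorm_sq_eq_ofReal (_ : ℂ), Complex.norm_real, Real.norm_eq_abs, sq_abs,
    Real.sq_sqrt (abs_nonneg _)]

theorem setLIntegral_dilation_translation (B : GL (Fin d) ℝ) (a : Rd d) (ψ : L2 d) {E : Set (Rd d)}
    (hE : MeasurableSet E) :
    ∫⁻ x in E, ‖dilation B (translation a ψ) x‖ₑ ^ 2
      = ∫⁻ y, E.indicator (fun _ => 1) (matAct (B⁻¹).val (y + a)) * ‖ψ y‖ₑ ^ 2 := by
  set u : Rd d → ℝ≥0∞ := fun w =>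
    E.indicator (fun _ => 1) (matAct (B⁻¹).val w) * ‖ψ (w - a)‖ₑ ^ 2 with hu
  calc ∫⁻ x in E, ‖dilation B (translation a ψ) x‖ₑ ^ 2
      = ∫⁻ x, ENNReal.ofReal |B.val.det| * u (matAct B.val x) := by
        rw [← lintegral_indicator hE]
        refine lintegral_congr_ae ?_
        filter_upwards [dilation_ae B (translation a ψ),
          (quasiMeasurePreserving_matAct B).ae (translation_ae a ψ)] with x hdil htrans
        by_cases hx : x ∈ E
        · simp only [hu, Set.indicator_of_mem hx, matAct_inv_matAct, one_mul]
          rw [hdil, htrans, enorm_sq_sqrt_abs_mul]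
        · simp only [hu, Set.indicator_of_notMem hx, matAct_inv_matAct, zero_mul, mul_zero]
    _ = ∫⁻ w, u w := by
        rw [lintegral_const_mul' _ _ ENNReal.ofReal_ne_top, lintegral_comp_matAct B u, ← mul_assoc,
          ← ENNReal.ofReal_mul (abs_nonneg _), mul_inv_cancel₀ (abs_det_pos B).ne',
          ENNReal.ofReal_one, one_mul]
    _ = _ := by
        rw [← lintegral_add_right_eq_self _ a]
        simp only [hu, add_sub_cancel_right]

theorem setLIntegral_translation_dilationR (B : GL (Fin d) ℝ) (a : Rd d) (ψ : L2 d)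
    {E : Set (Rd d)} (hE : MeasurableSet E) :
    ∫⁻ x in E, ‖translation a (dilationR B ψ) x‖ₑ ^ 2
      = ∫⁻ y, E.indicator (fun _ => ENNReal.ofReal |B.val.det|) (matAct (B⁻¹).val y + a)
          * ‖ψ y‖ₑ ^ 2 := by
  calc ∫⁻ x in E, ‖translation a (dilationR B ψ) x‖ₑ ^ 2
      = ENNReal.ofReal |B.val.det|
        * ∫⁻ x in E, ‖dilation B (translation (matAct B.val a) ψ) x‖ₑ ^ 2 := by
        rw [← lintegral_const_mul' _ _ ENNReal.ofReal_ne_top]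
        refine lintegral_congr_ae (ae_restrict_of_ae ?_)
        rw [dilationR_eq, map_smul, translation_dilation]
        filter_upwards [Lp.coeFn_smul (Real.sqrt |B.val.det| : ℂ)
          (dilation B (translation (matAct B.val a) ψ))] with x hx
        rw [hx, Pi.smul_apply, smul_eq_mul, enorm_sq_sqrt_abs_mul]
    _ = ∫⁻ y, ENNReal.ofReal |B.val.det|
        * (E.indicator (fun _ => 1) (matAct (B⁻¹).val y + a) * ‖ψ y‖ₑ ^ 2) := by
        rw [setLIntegral_dilation_translation _ _ _ hE,
          lintegral_const_mul' _ _ ENNReal.ofReal_ne_top]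
        simp only [map_add, matAct_inv_matAct]
    _ = _ := by
        simp only [← mul_assoc, ← Set.indicator_const_mul, mul_one]

theorem tendsto_lintegral_tsum_indicator_closedBall {J : Type*} [Countable J] {w : J → ℝ≥0∞}
    {τ : J → Rd d → Rd d} (hτ : ∀ j, Measurable (τ j)) {β : Rd d} (ψ : L2 d) {ε : ℕ → ℝ}
    (hε : Tendsto ε atTop (𝓝 0)) {ε₀ : ℝ} (hε₀ : 0 < ε₀) {K : NNReal}
    (hK : ∀ y, ∑' j, (closedBall β ε₀).indicator (fun _ => w j) (τ j y) ≤ K)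
    (hne : ∀ j, ∀ᵐ y, τ j y ≠ β) :
    Tendsto (fun N => ∫⁻ y,
        ∑' j, (closedBall β (ε N)).indicator (fun _ => w j) (τ j y) * ‖ψ y‖ₑ ^ 2)
      atTop (𝓝 0) := by
  have hψ : Measurable fun y => ‖ψ y‖ₑ ^ 2 := (Lp.stronglyMeasurable ψ).measurable.enorm.pow_const 2
  have hlim := tendsto_lintegral_filter_of_dominated_convergence (μ := (volume : Measure (Rd d)))
    (l := atTop) (F := fun N y => ∑' j, (closedBall β (ε N)).indicator (fun _ => w j) (τ j y)
      * ‖ψ y‖ₑ ^ 2) (f := fun _ => 0) (fun y => K * ‖ψ y‖ₑ ^ 2) ?_ ?_ ?_ ?_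
  · simpa using hlim
  · refine .of_forall fun N => Measurable.tsum fun j => Measurable.mul ?_ hψ
    exact (measurable_const.indicator isClosed_closedBall.measurableSet).comp (hτ j)
  · filter_upwards [hε.eventually_lt_const hε₀] with N hN
    refine .of_forall fun y => ?_
    rw [ENNReal.tsum_mul_right]
    gcongr
    exact (ENNReal.tsum_le_tsum fun j => Set.indicator_le_indicator_of_subset
      (closedBall_subset_closedBall hN.le) (fun _ => zero_le) _).trans (hK y)
  · rw [lintegral_const_mul _ hψ, ← enorm_sq_eq_lintegral]
    exact ENNReal.mul_ne_top ENNReal.coe_ne_top (by simp)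
  · filter_upwards [ae_all_iff.2 hne] with y hy
    have hpt := tendsto_tsum_indicator_closedBall hε hε₀
      (ne_top_of_le_ne_top ENNReal.coe_ne_top (hK y)) hy
    simpa only [ENNReal.tsum_mul_right, zero_mul] using
      ENNReal.Tendsto.mul_const (b := ‖ψ y‖ₑ ^ 2) hpt (.inr (by simp))

end Concentration

section Counting

open Filter Topology Metric

theorem tsum_indicator_one_le_card {ι : Type*} {S : Set ι} {s : Finset ι} (h : S ⊆ s) :
    ∑' j, S.indicator (fun _ => (1 : ℝ≥0∞)) j ≤ s.card := by
  rw [tsum_eq_sum (s := s) fun j hj => Set.indicator_of_notMem (fun hS => hj (h hS)) _]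
  refine (Finset.sum_le_card_nsmul s _ 1 fun j _ => ?_).trans (by simp)
  exact Set.indicator_le_self' (fun _ _ => zero_le) j

theorem tsum_indicator_one_le_of_gap {S : Set ℕ} {p : ℕ}
    (h : ∀ m ∈ S, ∀ n ∈ S, m ≤ n → n < m + p) :
    ∑' m, S.indicator (fun _ => (1 : ℝ≥0∞)) m ≤ p := by
  classical
  rcases S.eq_empty_or_nonempty with rfl | hne
  · simp
  · have hfind := Nat.find_spec hne
    have hsub : S ⊆ (Finset.Ico (Nat.find hne) (Nat.find hne + p) : Finset ℕ) := fun n hn =>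
      have hle := Nat.find_min' hne hn
      Finset.mem_coe.2 (Finset.mem_Ico.2 ⟨hle, h _ hfind n hn hle⟩)
    simpa using tsum_indicator_one_le_card hsub

variable {d : ℕ}

theorem half_norm_le_of_mem_closedBall {b u : Rd d} (h : u ∈ closedBall b (‖b‖ / 2)) :
    ‖b‖ / 2 ≤ ‖u‖ := by
  rw [mem_closedBall, dist_eq_norm'] at h
  linarith [norm_sub_norm_le b u]

theorem norm_le_of_mem_closedBall_half {b u : Rd d} (h : u ∈ closedBall b (‖b‖ / 2)) :
    ‖u‖ ≤ 3 / 2 * ‖b‖ := by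
  rw [mem_closedBall, dist_eq_norm] at h
  linarith [norm_sub_norm_le u b]

theorem IsExpansive.exists_norm_le_mul_norm_matAct_pow {A : GL (Fin d) ℝ} (hA : IsExpansive A) :
    ∃ ε : ℕ → ℝ, Tendsto ε atTop (𝓝 0) ∧ (∀ n, 0 ≤ ε n) ∧
      ∀ (n : ℕ) x, ‖x‖ ≤ ε n * ‖matAct (A ^ n).val x‖ := by
  obtain ⟨ε, hε, hε0, hεA⟩ := hA.exists_contraction
  refine ⟨ε, hε, hε0, fun n x => ?_⟩
  have h := hεA n (matAct (A ^ n).val x)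
  rwa [zpow_neg, zpow_natCast, matAct_inv_matAct] at h

/- The norms grow geometrically along an orbit, which therefore stays only boundedly long in the
annulus containing the ball; orbits entering that annulus start near the origin. -/
theorem IsExpansive.exists_tsum_indicator_matAct_pow_le {A : GL (Fin d) ℝ} (hA : IsExpansive A)
    {b : Rd d} (hb : b ≠ 0) : ∃ (p : ℕ) (R : ℝ), ∀ v,
      ∑' m : ℕ, (closedBall b (‖b‖ / 2)).indicator (fun _ => (1 : ℝ≥0∞)) (matAct (A ^ m).val v)
        ≤ (closedBall 0 R).indicator (fun _ => (p : ℝ≥0∞)) v := by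
  obtain ⟨ε, hε, hε0, hεA⟩ := hA.exists_norm_le_mul_norm_matAct_pow
  obtain ⟨C, hC⟩ := hε.bddAbove_range
  obtain ⟨p, hp⟩ := eventually_atTop.1 (hε.eventually_lt_const (show (0 : ℝ) < 1 / 3 by norm_num))
  have hb0 : 0 < ‖b‖ := norm_pos_iff.2 hb
  refine ⟨p, C * (3 / 2 * ‖b‖), fun v => ?_⟩
  set S : Set ℕ := {m | matAct (A ^ m).val v ∈ closedBall b (‖b‖ / 2)}
  change ∑' m, S.indicator (fun _ => (1 : ℝ≥0∞)) m ≤ _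
  rcases S.eq_empty_or_nonempty with hS | ⟨m, hm⟩
  · simp [hS]
  have hv : v ∈ closedBall 0 (C * (3 / 2 * ‖b‖)) := mem_closedBall_zero_iff.2 <|
    calc ‖v‖ ≤ ε m * ‖matAct (A ^ m).val v‖ := hεA m v
      _ ≤ C * (3 / 2 * ‖b‖) := mul_le_mul (hC ⟨m, rfl⟩) (norm_le_of_mem_closedBall_half hm)
        (norm_nonneg _) ((hε0 m).trans (hC ⟨m, rfl⟩))
  rw [Set.indicator_of_mem hv]
  refine tsum_indicator_one_le_of_gap fun m hm n hn hmn => ?_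
  by_contra! hgap
  have hgrow := hεA (n - m) (matAct (A ^ m).val v)
  rw [← matAct_mul_apply, ← Units.val_mul, ← pow_add, Nat.sub_add_cancel hmn] at hgrow
  have hn' := norm_le_of_mem_closedBall_half hn
  have := hp (n - m) (by omega)
  nlinarith [half_norm_le_of_mem_closedBall hm, mul_le_mul_of_nonneg_left hn' (hε0 (n - m))]

theorem tsum_indicator_closedBall_add_intVec_le {R : ℝ} {N : ℕ} (hN : R + R ≤ N) (c : ℝ≥0∞)
    (y : Rd d) :
    ∑' z, (closedBall (0 : Rd d) R).indicator (fun _ => c) (y + intVec z)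
      ≤ c * (latticeBox d N).card := by
  classical
  set Z : Set (Fin d → ℤ) := {z | y + intVec z ∈ closedBall (0 : Rd d) R} with hZ
  have hind : ∀ z, (closedBall (0 : Rd d) R).indicator (fun _ => c) (y + intVec z)
      = c * Z.indicator (fun _ => 1) z := fun z => by
    rw [← Set.indicator_const_mul, mul_one]
    rfl
  simp only [hind, ENNReal.tsum_mul_left]
  gcongr
  rcases Z.eq_empty_or_nonempty with hne | ⟨z₀, hz₀⟩
  · simp [hne]
  have hsub : Z ⊆ ((latticeBox d N).image (· + z₀) : Finset _) := fun z hz => by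
    refine Finset.mem_coe.2 (Finset.mem_image.2 ⟨z - z₀, mem_latticeBox_of_norm_le ?_, by simp⟩)
    rw [hZ, Set.mem_ofPred_eq, mem_closedBall_zero_iff] at hz hz₀
    calc ‖intVec (z - z₀)‖ = ‖(y + intVec z) - (y + intVec z₀)‖ := by
          rw [intVec_sub, add_sub_add_left_eq_sub]
      _ ≤ ‖y + intVec z‖ + ‖y + intVec z₀‖ := norm_sub_le _ _
      _ ≤ N := (add_le_add hz hz₀).trans hN
  exact (tsum_indicator_one_le_card hsub).trans (by exact_mod_cast Finset.card_image_le)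

theorem IsExpansive.exists_tsum_indicator_matAct_pow_add_intVec_le {A : GL (Fin d) ℝ}
    (hA : IsExpansive A) {b : Rd d} (hb : b ≠ 0) :
    ∃ K : NNReal, ∀ y, ∑' p : ℕ × (Fin d → ℤ),
      (closedBall b (‖b‖ / 2)).indicator (fun _ => (1 : ℝ≥0∞))
        (matAct (A ^ (p.1 + 1)).val (y + intVec p.2)) ≤ K := by
  obtain ⟨p, R, hpR⟩ := hA.exists_tsum_indicator_matAct_pow_le hb
  obtain ⟨N, hN⟩ := exists_nat_ge (R + R)
  refine ⟨p * (latticeBox d N).card, fun y => ?_⟩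
  rw [ENNReal.tsum_prod', ENNReal.tsum_comm]
  refine le_trans (ENNReal.tsum_le_tsum fun z => ?_)
    ((tsum_indicator_closedBall_add_intVec_le hN p y).trans (by simp))
  exact (ENNReal.tsum_comp_le_tsum_of_injective (add_left_injective 1) fun m =>
    (closedBall b (‖b‖ / 2)).indicator (fun _ => (1 : ℝ≥0∞))
      (matAct (A ^ m).val (y + intVec z))).trans (hpR _)

theorem tsum_indicator_closedBall_quarter_add_intVec_le (b v : Rd d) (c : ℝ≥0∞) :
    ∑' z, (closedBall b (1 / 4)).indicator (fun _ => c) (v + intVec z) ≤ c := by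
  by_cases hne : ∃ z, v + intVec z ∈ closedBall b (1 / 4)
  · obtain ⟨z₀, hz₀⟩ := hne
    rw [tsum_eq_single z₀]
    · exact Set.indicator_le_self' (fun _ _ => zero_le) _
    refine fun z hz => Set.indicator_of_notMem (fun hzE => hz ?_) _
    rw [mem_closedBall] at hz₀ hzE
    refine sub_eq_zero.1 (intVec_eq_zero_of_norm_lt_one ?_)
    calc ‖intVec (z - z₀)‖ = dist (v + intVec z) (v + intVec z₀) := by
          rw [intVec_sub, dist_add_left, dist_eq_norm]
      _ ≤ dist (v + intVec z) b + dist (v + intVec z₀) b := dist_triangle_right _ _ _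
      _ < 1 := by linarith
  · rw [not_exists] at hne
    simp only [Set.indicator_of_notMem (hne _), tsum_zero, zero_le]

theorem IsExpansive.exists_tsum_abs_det_indicator_le {A : GL (Fin d) ℝ} (hA : IsExpansive A)
    (hd : d ≠ 0) (b : Rd d) : ∃ K : NNReal, ∀ y, ∑' p : ℕ × (Fin d → ℤ),
      (closedBall b (1 / 4)).indicator (fun _ => ENNReal.ofReal (|A.val.det|⁻¹ ^ (p.1 + 1)))
        (matAct (A ^ (p.1 + 1)).val y + intVec p.2) ≤ K := by
  have hlt : |A.val.det|⁻¹ < 1 := inv_lt_one_of_one_lt₀ (hA.one_lt_abs_det hd)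
  have hsum : Summable fun m : ℕ => |A.val.det|⁻¹ ^ (m + 1) :=
    (summable_nat_add_iff 1).2 (summable_geometric_of_lt_one (by positivity) hlt)
  refine ⟨(∑' m : ℕ, |A.val.det|⁻¹ ^ (m + 1)).toNNReal, fun y => ?_⟩
  change _ ≤ ENNReal.ofReal _
  rw [ENNReal.tsum_prod', ENNReal.ofReal_tsum_of_nonneg (fun n => by positivity) hsum]
  exact ENNReal.tsum_le_tsum fun m =>
    tsum_indicator_closedBall_quarter_add_intVec_le b (matAct (A ^ (m + 1)).val y) _

end Counting

/-! ### Comparison of the two mixed Gramians -/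

section Layers

open Filter Topology Metric

variable {d : ℕ}

theorem lintegral_tsum_indicator_mul {J : Type*} [Countable J] (w : J → ℝ≥0∞)
    {τ : J → Rd d → Rd d} (hτ : ∀ j, Measurable (τ j)) {E : Set (Rd d)} (hE : MeasurableSet E)
    (ψ : L2 d) :
    ∫⁻ y, ∑' j, E.indicator (fun _ => w j) (τ j y) * ‖ψ y‖ₑ ^ 2
      = ∑' j, ∫⁻ y, E.indicator (fun _ => w j) (τ j y) * ‖ψ y‖ₑ ^ 2 :=
  lintegral_tsum fun j => (((measurable_const.indicator hE).comp (hτ j)).mul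
    ((Lp.stronglyMeasurable ψ).measurable.enorm.pow_const 2)).aemeasurable

theorem tsum_affineLayer_neg_le (A : GL (Fin d) ℝ) (ψ : L2 d) {h : L2 d} {E : Set (Rd d)}
    (hE : MeasurableSet E) (hh : ∀ᵐ y, y ∉ E → h y = 0) :
    ∑' m : ℕ, affineLayer A ψ (-((m + 1 : ℕ) : ℤ)) h
      ≤ ‖h‖ₑ ^ 2 * ∫⁻ y, ∑' p : ℕ × (Fin d → ℤ), E.indicator (fun _ => (1 : ℝ≥0∞))
        (matAct (A ^ (p.1 + 1)).val (y + intVec p.2)) * ‖ψ y‖ₑ ^ 2 := by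
  rw [lintegral_tsum_indicator_mul (fun _ : ℕ × (Fin d → ℤ) => 1)
      (τ := fun p y => matAct (A ^ (p.1 + 1)).val (y + intVec p.2))
      (fun p => (measurable_matAct _).comp (measurable_add_const _)) hE,
    ← ENNReal.tsum_mul_left, ENNReal.tsum_prod']
  refine ENNReal.tsum_le_tsum fun m => ENNReal.tsum_le_tsum fun z => ?_
  rw [← inv_inv (A ^ (m + 1)), ← setLIntegral_dilation_translation _ _ _ hE, dilation_zpow,
    zpow_neg, zpow_natCast]
  exact enorm_inner_sq_le_setLIntegral _ hE hh

theorem tsum_quasiLayer_neg_le (A : GL (Fin d) ℝ) (ψ : L2 d) {h : L2 d} {E : Set (Rd d)}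
    (hE : MeasurableSet E) (hh : ∀ᵐ y, y ∉ E → h y = 0) :
    ∑' m : ℕ, quasiLayer A ψ (-((m + 1 : ℕ) : ℤ)) h
      ≤ ‖h‖ₑ ^ 2 * ∫⁻ y, ∑' p : ℕ × (Fin d → ℤ), E.indicator
        (fun _ => ENNReal.ofReal (|A.val.det|⁻¹ ^ (p.1 + 1)))
        (matAct (A ^ (p.1 + 1)).val y + intVec p.2) * ‖ψ y‖ₑ ^ 2 := by
  rw [lintegral_tsum_indicator_mul
      (fun p : ℕ × (Fin d → ℤ) => ENNReal.ofReal (|A.val.det|⁻¹ ^ (p.1 + 1)))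
      (τ := fun p y => matAct (A ^ (p.1 + 1)).val y + intVec p.2)
      (fun p => (measurable_matAct _).add_const _) hE,
    ← ENNReal.tsum_mul_left, ENNReal.tsum_prod']
  refine ENNReal.tsum_le_tsum fun m => ENNReal.tsum_le_tsum fun z => ?_
  have hdet : |A.val.det|⁻¹ ^ (m + 1) = |(A ^ (m + 1))⁻¹.val.det| := by
    rw [← zpow_natCast A, ← zpow_neg, abs_det_zpow_neg, zpow_natCast, Units.val_pow_eq_pow_val,
      Matrix.det_pow, abs_pow, inv_pow]
  rw [← inv_inv (A ^ (m + 1)), hdet, ← setLIntegral_translation_dilationR _ _ _ hE,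
    dilationR_zpow, zpow_neg, zpow_natCast]
  exact enorm_inner_sq_le_setLIntegral _ hE hh

/-- The function `f` vanishes almost everywhere outside of some ball. -/
def HasBoundedSupport (f : L2 d) : Prop := ∃ ρ : ℝ, ∀ᵐ x, ρ < ‖x‖ → f x = 0

theorem hasBoundedSupport_toLp {g : Rd d → ℂ} (hgm : MemLp g 2) (hg : HasCompactSupport g) :
    HasBoundedSupport hgm.toLp := by
  obtain ⟨ρ, hρ⟩ := hg.isCompact.isBounded.subset_closedBall (0 : Rd d)
  refine ⟨ρ, ?_⟩
  filter_upwards [hgm.coeFn_toLp] with x hx hxρ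
  rw [hx]
  refine image_eq_zero_of_notMem_tsupport fun hmem => hxρ.not_ge ?_
  exact mem_closedBall_zero_iff.1 (hρ hmem)

theorem dense_hasBoundedSupport : Dense {f : L2 d | HasBoundedSupport f} := by
  intro f
  rw [Metric.mem_closure_iff]
  intro ε hε
  obtain ⟨g, hgs, hg, -, hgm⟩ := (Lp.memLp f).exists_hasCompactSupport_eLpNorm_sub_le (by norm_num)
    (ε := ENNReal.ofReal (ε / 2)) (by simpa using hε)
  refine ⟨hgm.toLp, hasBoundedSupport_toLp hgm hgs, ?_⟩
  have hdist : edist f hgm.toLp ≤ ENNReal.ofReal (ε / 2) := by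
    rwa [← Lp.toLp_coeFn f (Lp.memLp f), Lp.edist_toLp_toLp]
  rw [edist_dist, ENNReal.ofReal_le_ofReal_iff (by positivity)] at hdist
  linarith

theorem HasBoundedSupport.exists_support_translation_dilation {f : L2 d} (hf : HasBoundedSupport f)
    {A : GL (Fin d) ℝ} (hA : IsExpansive A) (b : Rd d) :
    ∃ ε : ℕ → ℝ, Tendsto ε atTop (𝓝 0) ∧ ∀ N : ℕ, ∀ᵐ y, y ∉ closedBall b (ε N) →
      translation b ((dilation A ^ (N : ℤ)) f) y = 0 := by
  obtain ⟨ρ, hρ⟩ := hf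
  obtain ⟨ε, hε, hε0, hεA⟩ := hA.exists_norm_le_mul_norm_matAct_pow
  refine ⟨fun N => ε N * ρ, by simpa using hε.mul_const ρ, fun N => ?_⟩
  have hdil : ∀ᵐ x, x ∉ closedBall 0 (ε N * ρ) → (dilation A ^ (N : ℤ)) f x = 0 := by
    rw [dilation_zpow, zpow_natCast]
    filter_upwards [dilation_ae (A ^ N) f, (quasiMeasurePreserving_matAct (A ^ N)).ae hρ]
      with x hx hfx hxball
    rw [hx, hfx, mul_zero]
    by_contra! hle
    exact hxball (mem_closedBall_zero_iff.2
      ((hεA N x).trans (mul_le_mul_of_nonneg_left hle (hε0 N))))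
  filter_upwards [translation_ae b ((dilation A ^ (N : ℤ)) f),
    (measurePreserving_sub_right volume b).quasiMeasurePreserving.ae hdil] with y hy hdily hyball
  rw [hy]
  refine hdily fun hmem => hyball ?_
  rwa [mem_closedBall_zero_iff, ← dist_eq_norm] at hmem

theorem ae_ne_of_injective (hd : d ≠ 0) {τ : Rd d → Rd d} (hτ : Function.Injective τ) (b : Rd d) :
    ∀ᵐ y, τ y ≠ b := by
  have : Nonempty (Fin d) := ⟨⟨0, Nat.pos_of_ne_zero hd⟩⟩
  have hsub : {y | τ y = b}.Subsingleton := fun x hx y hy => hτ (hx.trans hy.symm)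
  rw [ae_iff]
  simpa using hsub.measure_zero volume

theorem matAct_injective (A : GL (Fin d) ℝ) : Function.Injective (matAct A.val) :=
  (matActCLE A).injective

theorem enorm_translation_dilation (A : GL (Fin d) ℝ) (b : Rd d) (n : ℤ) (f : L2 d) :
    ‖translation b ((dilation A ^ n) f)‖ₑ = ‖f‖ₑ := by
  rw [← ofReal_norm, norm_translation, dilation_zpow, norm_dilation, ofReal_norm]

/- As `N → ∞` the dilates concentrate at `b`, so that only the mass of `S` near `b` counts. -/
theorem tendsto_of_le_lintegral_tsum_indicator {J : Type*} [Countable J] {A : GL (Fin d) ℝ}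
    (hA : IsExpansive A) {S : L2 d → ℝ≥0∞} {ψ : L2 d} {w : J → ℝ≥0∞} {τ : J → Rd d → Rd d}
    (hτ : ∀ j, Measurable (τ j)) {b : Rd d} (hne : ∀ j, ∀ᵐ y, τ j y ≠ b)
    (hS : ∀ {h : L2 d} {E : Set (Rd d)}, MeasurableSet E → (∀ᵐ y, y ∉ E → h y = 0) →
      S h ≤ ‖h‖ₑ ^ 2 * ∫⁻ y, ∑' j, E.indicator (fun _ => w j) (τ j y) * ‖ψ y‖ₑ ^ 2)
    {ε₀ : ℝ} (hε₀ : 0 < ε₀) {K : NNReal}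
    (hK : ∀ y, ∑' j, (closedBall b ε₀).indicator (fun _ => w j) (τ j y) ≤ K)
    {f : L2 d} (hf : HasBoundedSupport f) :
    Tendsto (fun N : ℕ => S (translation b ((dilation A ^ (N : ℤ)) f))) atTop (𝓝 0) := by
  obtain ⟨ε, hε, hsupp⟩ := hf.exists_support_translation_dilation hA b
  have hlim := ENNReal.Tendsto.const_mul (a := ‖f‖ₑ ^ 2)
    (tendsto_lintegral_tsum_indicator_closedBall hτ ψ hε hε₀ hK hne) (.inr (by simp))
  rw [mul_zero] at hlim
  refine tendsto_of_tendsto_of_tendsto_of_le_of_le tendsto_const_nhds hlim (fun _ => zero_le)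
    fun N => ?_
  simpa only [enorm_translation_dilation] using
    hS isClosed_closedBall.measurableSet (hsupp N)

theorem tendsto_tsum_quasiLayer_neg {A : GL (Fin d) ℝ} (hA : IsExpansive A) (hd : d ≠ 0) (ψ : L2 d)
    {f : L2 d} (hf : HasBoundedSupport f) (b : Rd d) :
    Tendsto (fun N : ℕ => ∑' m : ℕ, quasiLayer A ψ (-((m + 1 : ℕ) : ℤ))
      (translation b ((dilation A ^ (N : ℤ)) f))) atTop (𝓝 0) := by
  obtain ⟨K, hK⟩ := hA.exists_tsum_abs_det_indicator_le hd b
  exact tendsto_of_le_lintegral_tsum_indicator hA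
    (τ := fun p : ℕ × (Fin d → ℤ) => fun y => matAct (A ^ (p.1 + 1)).val y + intVec p.2)
    (fun p => (measurable_matAct _).add_const _)
    (fun p => ae_ne_of_injective hd ((add_left_injective _).comp (matAct_injective _)) b)
    (tsum_quasiLayer_neg_le A ψ) (by norm_num) hK hf

theorem tendsto_tsum_affineLayer_neg_dilation {A : GL (Fin d) ℝ} {ψ f : L2 d}
    (hψ : ∑' n : ℤ, affineLayer A ψ n f ≠ ∞) :
    Tendsto (fun N : ℕ => ∑' m : ℕ, affineLayer A ψ (-((m + 1 : ℕ) : ℤ))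
      ((dilation A ^ (N : ℤ)) f)) atTop (𝓝 0) := by
  have hinj : Function.Injective fun m : ℕ => -((m + 1 : ℕ) : ℤ) := fun a b h => by
    simp only at h
    omega
  refine (ENNReal.tendsto_sum_nat_add (fun m : ℕ => affineLayer A ψ (-((m + 1 : ℕ) : ℤ)) f)
    (ne_top_of_le_ne_top hψ (ENNReal.tsum_comp_le_tsum_of_injective hinj _))).congr
    fun N => tsum_congr fun m => ?_
  rw [← affineLayer_add_dilation A ψ f _ N]
  congr 1
  push_cast
  ring

theorem tendsto_tsum_affineLayer_neg {A : GL (Fin d) ℝ} (hA : IsExpansive A) (hd : d ≠ 0)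
    {ψ f : L2 d} (hψ : ∑' n : ℤ, affineLayer A ψ n f ≠ ∞) (hf : HasBoundedSupport f) (b : Rd d) :
    Tendsto (fun N : ℕ => ∑' m : ℕ, affineLayer A ψ (-((m + 1 : ℕ) : ℤ))
      (translation b ((dilation A ^ (N : ℤ)) f))) atTop (𝓝 0) := by
  rcases eq_or_ne b 0 with rfl | hb
  · simpa only [translation_zero] using tendsto_tsum_affineLayer_neg_dilation hψ
  · obtain ⟨K, hK⟩ := hA.exists_tsum_indicator_matAct_pow_add_intVec_le hb
    exact tendsto_of_le_lintegral_tsum_indicator hA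
      (τ := fun p : ℕ × (Fin d → ℤ) => fun y => matAct (A ^ (p.1 + 1)).val (y + intVec p.2))
      (fun p => (measurable_matAct _).comp (measurable_add_const _))
      (fun p => ae_ne_of_injective hd ((matAct_injective _).comp (add_left_injective _)) b)
      (tsum_affineLayer_neg_le A ψ) (half_pos (norm_pos_iff.2 hb)) hK hf

end Layers

section Difference

open Filter Topology

variable {d r : ℕ}

theorem tsum_prod_fin_eq_sum_tsum (u : ℕ → (Fin d → ℤ) × Fin r → ℝ≥0∞) :
    ∑' (m) (p), u m p = ∑ i, ∑' (m) (z), u m (z, i) := by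
  rw [← tsum_fintype (L := .unconditional _) (fun i => ∑' (m) (z), u m (z, i)),
    ENNReal.tsum_comm (f := fun i m => ∑' z, u m (z, i))]
  refine tsum_congr fun m => ?_
  rw [ENNReal.tsum_prod', ENNReal.tsum_comm]

theorem tsum_enorm_eq_of_forall_nonneg_eq_zero {D : ℤ × (Fin d → ℤ) × Fin r → ℂ}
    (hD : ∀ n : ℤ, 0 ≤ n → ∀ p, D (n, p) = 0) :
    ∑' q, ‖D q‖ₑ = ∑ i, ∑' (m : ℕ) (z), ‖D (-((m + 1 : ℕ) : ℤ), z, i)‖ₑ := by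
  have hinj : Function.Injective fun m : ℕ => -((m + 1 : ℕ) : ℤ) := fun a b h => by
    simp only at h
    omega
  have hsupp : (Function.support fun n => ∑' p, ‖D (n, p)‖ₑ)
      ⊆ Set.range fun m : ℕ => -((m + 1 : ℕ) : ℤ) := fun n hn => by
    have hneg : n < 0 := by
      by_contra! hnonneg
      exact hn (by simp [hD n hnonneg])
    exact ⟨(-n - 1).toNat, by simp only; omega⟩
  rw [ENNReal.tsum_prod', ← hinj.tsum_eq hsupp, tsum_prod_fin_eq_sum_tsum]

theorem enorm_inner_mul_inner_le (x y f g : L2 d) :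
    ‖⟪x, f⟫_ℂ * ⟪g, y⟫_ℂ‖ₑ ≤ ‖⟪x, f⟫_ℂ‖ₑ ^ 2 + ‖⟪y, g⟫_ℂ‖ₑ ^ 2 := by
  have hsymm : ‖⟪y, g⟫_ℂ‖ₑ = ‖⟪g, y⟫_ℂ‖ₑ := by rw [← ofReal_norm, norm_inner_symm, ofReal_norm]
  rw [hsymm]
  exact enorm_mul_le_add_sq _ _

theorem enorm_inner_sub_mixedGramian_le {A : GL (Fin d) ℝ} {Ψ Φ : Fin r → L2 d}
    (hΨ : IsBesselSeq (affineSystem A Ψ)) (hΦ : IsBesselSeq (affineSystem A Φ))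
    (hΨq : IsBesselSeq (quasiAffineSystem A Ψ)) (hΦq : IsBesselSeq (quasiAffineSystem A Φ))
    (f g : L2 d) :
    ‖⟪g, (mixedGramian hΨ hΦ - mixedGramian hΨq hΦq) f⟫_ℂ‖ₑ
      ≤ ∑ i, (∑' m : ℕ, affineLayer A (Ψ i) (-((m + 1 : ℕ) : ℤ)) f
        + ∑' m : ℕ, affineLayer A (Φ i) (-((m + 1 : ℕ) : ℤ)) g
        + (∑' m : ℕ, quasiLayer A (Ψ i) (-((m + 1 : ℕ) : ℤ)) f
        + ∑' m : ℕ, quasiLayer A (Φ i) (-((m + 1 : ℕ) : ℤ)) g)) := by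
  have hsum := (hasSum_inner_mixedGramian hΨ hΦ f g).sub (hasSum_inner_mixedGramian hΨq hΦq f g)
  rw [sub_apply, inner_sub_right, ← hsum.tsum_eq]
  refine enorm_tsum_le_tsum_enorm.trans ?_
  rw [tsum_enorm_eq_of_forall_nonneg_eq_zero fun n hn p => by
    simp [affineSystem, quasiAffineSystem, hn]]
  refine Finset.sum_le_sum fun i _ => ?_
  simp only [affineLayer, quasiLayer, besselSum, ← ENNReal.tsum_add]
  refine ENNReal.tsum_le_tsum fun m => ENNReal.tsum_le_tsum fun z => ?_
  have hneg : ¬ (0 : ℤ) ≤ -((m + 1 : ℕ) : ℤ) := by omega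
  simp only [affineSystem, quasiAffineSystem, if_neg hneg]
  exact enorm_sub_le.trans
    (add_le_add (enorm_inner_mul_inner_le _ _ _ _) (enorm_inner_mul_inner_le _ _ _ _))

theorem tendsto_zero_of_dense {E : Type*} [PseudoMetricSpace E] {l : ℕ → E → ℂ} {C : NNReal}
    (hl : ∀ N, LipschitzWith C (l N)) {s : Set E} (hs : Dense s)
    (h : ∀ f ∈ s, Tendsto (fun N => l N f) atTop (𝓝 0)) (f : E) :
    Tendsto (fun N => l N f) atTop (𝓝 0) :=
  have hequi : Equicontinuous l := (LipschitzWith.uniformEquicontinuous l C hl).equicontinuous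
  hs.induction h (hequi.isClosed_setOfPred_tendsto continuous_const) f

theorem tendsto_inner_zero_of_dense {H : Type*} [NormedAddCommGroup H] [InnerProductSpace ℂ H]
    {U : ℕ → H →L[ℂ] H} (hU : ∀ N v, ‖U N v‖ = ‖v‖) (R : H →L[ℂ] H) {s : Set H} (hs : Dense s)
    (h : ∀ f ∈ s, ∀ g ∈ s, Tendsto (fun N => ⟪U N g, R (U N f)⟫_ℂ) atTop (𝓝 0)) (f g : H) :
    Tendsto (fun N => ⟪U N g, R (U N f)⟫_ℂ) atTop (𝓝 0) := by
  have hbound : ∀ N f g, ‖⟪U N g, R (U N f)⟫_ℂ‖ ≤ ‖g‖ * (‖R‖ * ‖f‖) := fun N f g =>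
    (norm_inner_le_norm _ _).trans (by
      rw [hU]
      gcongr
      exact (R.le_opNorm _).trans_eq (by rw [hU]))
  refine tendsto_zero_of_dense (l := fun N f => ⟪U N g, R (U N f)⟫_ℂ) (C := ‖g‖₊ * ‖R‖₊)
    (fun N => LipschitzWith.of_dist_le_mul fun f f' => ?_) hs (fun f hf => ?_) f
  · rw [dist_eq_norm, dist_eq_norm, ← inner_sub_right, ← map_sub, ← map_sub]
    exact (hbound N _ g).trans_eq (mul_assoc _ _ _).symm
  refine tendsto_zero_of_dense (l := fun N g => ⟪U N g, R (U N f)⟫_ℂ) (C := ‖R‖₊ * ‖f‖₊)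
    (fun N => LipschitzWith.of_dist_le_mul fun g g' => ?_) hs (fun g hg => h f hf g hg) g
  rw [dist_eq_norm, dist_eq_norm, ← inner_sub_left, ← map_sub]
  exact (hbound N f _).trans_eq (mul_comm _ _)

theorem quasiAffineSystem_eq_of_dim_zero (hd : d = 0) (A : GL (Fin d) ℝ) (Ψ : Fin r → L2 d) :
    quasiAffineSystem A Ψ = affineSystem A Ψ := by
  subst hd
  have htranslation (z : Fin 0 → ℤ) (f : L2 0) : translation (intVec z) f = f := by
    rw [Subsingleton.elim z 0, intVec_zero, translation_zero]
  have hdilationR (f : L2 0) : dilationR (1 : GL (Fin 0) ℝ) f = f := by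
    rw [dilationR_eq, dilation_one]
    simp
  obtain rfl : A = 1 := Units.ext (Subsingleton.elim _ _)
  funext p
  rw [affineSystem, quasiAffineSystem]
  split_ifs
  · rfl
  · rw [dilation_zpow, dilationR_zpow, one_zpow, htranslation, htranslation, dilation_one,
      hdilationR]

theorem mixedGramian_sub_eq_zero_of_dim_zero (hd : d = 0) {A : GL (Fin d) ℝ} {Ψ Φ : Fin r → L2 d}
    (hΨ : IsBesselSeq (affineSystem A Ψ)) (hΦ : IsBesselSeq (affineSystem A Φ))
    (hΨq : IsBesselSeq (quasiAffineSystem A Ψ)) (hΦq : IsBesselSeq (quasiAffineSystem A Φ)) :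
    mixedGramian hΨ hΦ - mixedGramian hΨq hΦq = 0 := by
  simp only [quasiAffineSystem_eq_of_dim_zero hd, sub_self]

theorem tsum_affineLayer_ne_top {A : GL (Fin d) ℝ} {Ψ : Fin r → L2 d}
    (h : IsBesselSeq (affineSystem A Ψ)) (i : Fin r) (f : L2 d) :
    ∑' n : ℤ, affineLayer A (Ψ i) n f ≠ ∞ := by
  obtain ⟨C, hC⟩ := (isBesselSeq_iff_besselSum_le _).1 h
  refine ne_top_of_le_ne_top (b := C * ‖f‖ₑ ^ 2) (ENNReal.mul_ne_top (by simp) (by simp))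
    (le_trans ?_ (hC f))
  rw [besselSum_affineSystem]
  exact Finset.single_le_sum (f := fun i => ∑' n : ℤ, affineLayer A (Ψ i) n f)
    (fun _ _ => zero_le) (Finset.mem_univ i)

theorem tendsto_inner_sub_mixedGramian_of_hasBoundedSupport {A : GL (Fin d) ℝ}
    (hA : IsExpansive A) (hd : d ≠ 0) {Ψ Φ : Fin r → L2 d}
    (hΨ : IsBesselSeq (affineSystem A Ψ)) (hΦ : IsBesselSeq (affineSystem A Φ))
    (hΨq : IsBesselSeq (quasiAffineSystem A Ψ)) (hΦq : IsBesselSeq (quasiAffineSystem A Φ))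
    (β : Rd d) {f g : L2 d} (hf : HasBoundedSupport f) (hg : HasBoundedSupport g) :
    Tendsto (fun N : ℕ => ⟪translation β ((dilation A ^ (N : ℤ)) g),
      (mixedGramian hΨ hΦ - mixedGramian hΨq hΦq)
        (translation β ((dilation A ^ (N : ℤ)) f))⟫_ℂ) atTop (𝓝 0) := by
  have hlayers := tendsto_finsetSum (Finset.univ : Finset (Fin r)) fun i _ =>
    ((tendsto_tsum_affineLayer_neg hA hd (tsum_affineLayer_ne_top hΨ i f) hf β).add
      (tendsto_tsum_affineLayer_neg hA hd (tsum_affineLayer_ne_top hΦ i g) hg β)).add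
    ((tendsto_tsum_quasiLayer_neg hA hd (Ψ i) hf β).add
      (tendsto_tsum_quasiLayer_neg hA hd (Φ i) hg β))
  simp only [add_zero, Finset.sum_const_zero] at hlayers
  exact tendsto_zero_iff_enorm_tendsto_zero.2 <|
    tendsto_of_tendsto_of_tendsto_of_le_of_le tendsto_const_nhds hlayers (fun _ => zero_le)
      fun N => enorm_inner_sub_mixedGramian_le hΨ hΦ hΨq hΦq _ _

theorem tendsto_inner_sub_mixedGramian {A : GL (Fin d) ℝ} (hA : IsExpansive A)
    {Ψ Φ : Fin r → L2 d}
    (hΨ : IsBesselSeq (affineSystem A Ψ)) (hΦ : IsBesselSeq (affineSystem A Φ))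
    (hΨq : IsBesselSeq (quasiAffineSystem A Ψ)) (hΦq : IsBesselSeq (quasiAffineSystem A Φ))
    (β : Rd d) (f g : L2 d) :
    Tendsto (fun N : ℕ => ⟪translation β ((dilation A ^ (N : ℤ)) g),
      (mixedGramian hΨ hΦ - mixedGramian hΨq hΦq)
        (translation β ((dilation A ^ (N : ℤ)) f))⟫_ℂ) atTop (𝓝 0) := by
  rcases eq_or_ne d 0 with hd | hd
  · simp [mixedGramian_sub_eq_zero_of_dim_zero hd hΨ hΦ hΨq hΦq]
  · exact tendsto_inner_zero_of_dense
      (U := fun N : ℕ =>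
        translation β ∘L ((dilation A ^ (N : ℤ) : L2 d ≃L[ℂ] L2 d) : L2 d →L[ℂ] L2 d))
      (fun N v => (norm_translation _ _).trans (by rw [dilation_zpow]; exact norm_dilation _ v)) _
      dense_hasBoundedSupport (fun _ hf _ hg =>
        tendsto_inner_sub_mixedGramian_of_hasBoundedSupport hA hd hΨ hΦ hΨq hΦq β hf hg) f g

end Difference

/-! ### Commutation and symbols -/

section Commutation

open Filter Topology

variable {d r : ℕ}

theorem commute_translation_iff_inner {S : L2 d →L[ℂ] L2 d} (β : Rd d) :
    S * translation β = translation β * S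
      ↔ ∀ f g, ⟪translation β g, S (translation β f)⟫_ℂ = ⟪g, S f⟫_ℂ := by
  constructor
  · intro hS f g
    rw [← inner_translation_translation β g]
    exact congrArg (⟪translation β g, ·⟫_ℂ) (DFunLike.congr_fun hS f)
  · intro hS
    ext1 f
    refine ext_inner_left ℂ fun v => ?_
    have hv : translation β (translation (-β) v) = v := by
      rw [translation_translation, add_neg_cancel, translation_zero]
    change ⟪v, S (translation β f)⟫_ℂ = ⟪v, translation β (S f)⟫_ℂ
    rw [← hv, hS, inner_translation_translation]

theorem inner_eq_of_isBandLimited {P Q U V : L2 d → L2 d} (hP : Continuous P)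
    (hQ : Continuous Q) (hU : Continuous U) (hV : Continuous V)
    (h : ∀ f g, IsBandLimited f → IsBandLimited g → ⟪U g, P f⟫_ℂ = ⟪V g, Q f⟫_ℂ) (f g : L2 d) :
    ⟪U g, P f⟫_ℂ = ⟪V g, Q f⟫_ℂ :=
  dense_isBandLimited.induction (fun f hf => dense_isBandLimited.induction
      (fun g hg => h f g hf hg)
      (isClosed_eq (hU.inner continuous_const) (hV.inner continuous_const)) g)
    (isClosed_eq (continuous_const.inner hP) (continuous_const.inner hQ)) f

theorem affineSystem_succ (A : GL (Fin d) ℝ) (Ψ : Fin r → L2 d) (n : ℤ)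
    (p : (Fin d → ℤ) × Fin r) :
    affineSystem A Ψ (n + 1, p) = dilation A (affineSystem A Ψ (n, p)) := by
  rw [affineSystem, add_comm, zpow_add, zpow_one]
  rfl

theorem inner_mixedGramian_dilation {A : GL (Fin d) ℝ} {Ψ Φ : Fin r → L2 d}
    (hΨ : IsBesselSeq (affineSystem A Ψ)) (hΦ : IsBesselSeq (affineSystem A Φ)) (f g : L2 d) :
    ⟪dilation A g, mixedGramian hΨ hΦ (dilation A f)⟫_ℂ = ⟪g, mixedGramian hΨ hΦ f⟫_ℂ := by
  let e : ℤ × (Fin d → ℤ) × Fin r ≃ ℤ × (Fin d → ℤ) × Fin r :=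
    (Equiv.addRight (1 : ℤ)).prodCongr (Equiv.refl _)
  have hsum := e.hasSum_iff.2 (hasSum_inner_mixedGramian hΨ hΦ (dilation A f) (dilation A g))
  refine hsum.unique (hasSum_of_eq (hasSum_inner_mixedGramian hΨ hΦ f g) (fun ⟨n, p⟩ => ?_) rfl)
  change ⟪affineSystem A Ψ (n + 1, p), dilation A f⟫_ℂ
    * ⟪dilation A g, affineSystem A Φ (n + 1, p)⟫_ℂ = _
  rw [affineSystem_succ, affineSystem_succ, inner_dilation_dilation, inner_dilation_dilation]

theorem inner_dilation_zpow_natCast {A : GL (Fin d) ℝ} {S : L2 d →L[ℂ] L2 d}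
    (hS : ∀ f g, ⟪dilation A g, S (dilation A f)⟫_ℂ = ⟪g, S f⟫_ℂ) (N : ℕ) (f g : L2 d) :
    ⟪(dilation A ^ (N : ℤ)) g, S ((dilation A ^ (N : ℤ)) f)⟫_ℂ = ⟪g, S f⟫_ℂ := by
  induction N with
  | zero =>
    rw [Nat.cast_zero, zpow_zero]
    rfl
  | succ N ih =>
    rw [Nat.cast_succ, add_comm, zpow_add, zpow_one]
    exact (hS _ _).trans ih

theorem exists_norm_sub_intVec_le (d : ℕ) :
    ∃ R : ℝ, ∀ v : Rd d, ∃ z : Fin d → ℤ, ‖v - intVec z‖ ≤ R := by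
  obtain ⟨R, hR⟩ := exists_norm_le_of_mem_latticeCell (d := d) 0
  refine ⟨R, fun v => ?_⟩
  obtain ⟨z, hz⟩ := Set.mem_iUnion.1 ((iUnion_latticeCell (d := d)).symm ▸ Set.mem_univ v)
  exact ⟨z, hR _ (by simpa [latticeCell] using hz)⟩

/- The lattices `A^{-N} ℤᵈ` become arbitrarily fine. -/
theorem IsExpansive.exists_tendsto_matAct_zpow_neg_intVec {A : GL (Fin d) ℝ} (hA : IsExpansive A)
    (β : Rd d) : ∃ z : ℕ → Fin d → ℤ,
      Tendsto (fun N : ℕ => matAct (A ^ (-(N : ℤ))).val (intVec (z N))) atTop (𝓝 β) := by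
  obtain ⟨ε, hε, hε0, hεA⟩ := hA.exists_contraction
  obtain ⟨R, hR⟩ := exists_norm_sub_intVec_le d
  choose z hz using fun N : ℕ => hR (matAct (A ^ (N : ℤ)).val β)
  refine ⟨z, tendsto_iff_norm_sub_tendsto_zero.2 ?_⟩
  refine squeeze_zero (fun _ => norm_nonneg _) (fun N => ?_)
    (by simpa using hε.mul_const R : Tendsto (fun N => ε N * R) atTop (𝓝 0))
  have hβ : matAct (A ^ (-(N : ℤ))).val (matAct (A ^ (N : ℤ)).val β) = β := by
    rw [zpow_neg, matAct_inv_matAct]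
  calc ‖matAct (A ^ (-(N : ℤ))).val (intVec (z N)) - β‖
      = ‖matAct (A ^ (-(N : ℤ))).val (matAct (A ^ (N : ℤ)).val β - intVec (z N))‖ := by
        rw [map_sub, hβ, norm_sub_rev]
    _ ≤ ε N * R := (hεA N _).trans (mul_le_mul_of_nonneg_left (hz N) (hε0 N))

theorem inner_translation_matAct_zpow_neg {A : GL (Fin d) ℝ} {S : L2 d →L[ℂ] L2 d}
    (hS : ∀ f g, ⟪dilation A g, S (dilation A f)⟫_ℂ = ⟪g, S f⟫_ℂ) {α : Rd d}
    (h : S * translation α = translation α * S) (N : ℕ) (f g : L2 d) :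
    ⟪translation (matAct (A ^ (-(N : ℤ))).val α) g,
      S (translation (matAct (A ^ (-(N : ℤ))).val α) f)⟫_ℂ = ⟪g, S f⟫_ℂ := by
  obtain ⟨f, rfl⟩ := (dilation A ^ (N : ℤ)).surjective f
  obtain ⟨g, rfl⟩ := (dilation A ^ (N : ℤ)).surjective g
  have hcomm (u : L2 d) : translation (matAct (A ^ (-(N : ℤ))).val α) ((dilation A ^ (N : ℤ)) u)
      = (dilation A ^ (N : ℤ)) (translation α u) := by
    rw [dilation_zpow, dilation_translation, zpow_neg]
  rw [hcomm, hcomm, inner_dilation_zpow_natCast hS, inner_dilation_zpow_natCast hS]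
  exact (commute_translation_iff_inner α).1 h f g

theorem commute_translation_of_dilation {A : GL (Fin d) ℝ} (hA : IsExpansive A)
    {S : L2 d →L[ℂ] L2 d} (hS : ∀ f g, ⟪dilation A g, S (dilation A f)⟫_ℂ = ⟪g, S f⟫_ℂ)
    (h : ∀ z : Fin d → ℤ, S * translation (intVec z) = translation (intVec z) * S) (β : Rd d) :
    S * translation β = translation β * S := by
  obtain ⟨z, hz⟩ := hA.exists_tendsto_matAct_zpow_neg_intVec β
  refine (commute_translation_iff_inner β).2 fun f g => ?_
  have hcont : Continuous fun α : Rd d => ⟪translation α g, S (translation α f)⟫_ℂ :=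
    (continuous_translation g).inner (S.continuous.comp (continuous_translation f))
  exact tendsto_nhds_unique ((hcont.tendsto β).comp hz) <| tendsto_const_nhds.congr fun N =>
    (inner_translation_matAct_zpow_neg hS (h (z N)) N f g).symm

theorem IsFourierMultiplier.commute_translation {S : L2 d →L[ℂ] L2 d} {s : Rd d → ℂ}
    (hS : IsFourierMultiplier S s) (β : Rd d) : S * translation β = translation β * S := by
  ext1 f
  refine fourier_L2_injective ?_
  change (𝓕 (S (translation β f)) : L2 d) =ᵐ[volume] (𝓕 (translation β (S f)) : L2 d)
  filter_upwards [hS.2 (translation β f), hS.2 f, fourier_translation_ae β f,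
    fourier_translation_ae β (S f)] with ξ hSTf hSf hTf hTSf
  rw [hSTf, hTf, hTSf, hSf]
  ring

theorem IsFourierMultiplier.commute_dilation {A : GL (Fin d) ℝ} {S : L2 d →L[ℂ] L2 d}
    {s : Rd d → ℂ} (hS : IsFourierMultiplier S s) (hs : ∀ ξ, s (adjPow A (-1) ξ) = s ξ)
    (f : L2 d) : S (dilation A f) = dilation A (S f) := by
  refine fourier_L2_injective ?_
  have hdil := fun f => fourier_dilation_zpow_ae A 1 f
  simp only [zpow_one] at hdil
  filter_upwards [hS.2 (dilation A f), hdil f, hdil (S f),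
    (quasiMeasurePreserving_adjPow A (-1)).ae (hS.2 f)] with ξ hSDf hDf hDSf hSf
  rw [hSDf, hDf, hDSf, hSf, hs]
  ring

end Commutation

section Symbols

open Filter Topology

variable {d r : ℕ}

/-- The symbol of the frequency-shift component at a shift outside of `A^* ℤᵈ`, as in
condition 6. -/
def shiftSymbol (A : GL (Fin d) ℝ) (Ψ Φ : Fin r → L2 d) (q : Fin d → ℤ) (ξ : Rd d) : ℂ :=
  ∑ i, ∑' j : ℕ, crossTerm A (Φ i) (Ψ i) j ξ (ξ + intVec q)

/-- The symbol `s` of conditions 7 and 8, which is that of the component at the shift zero. -/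
def diagonalSymbol (A : GL (Fin d) ℝ) (Ψ Φ : Fin r → L2 d) (ξ : Rd d) : ℂ :=
  ∑ i, ∑' j : ℤ, crossTerm A (Ψ i) (Φ i) j ξ ξ

theorem memLp_tsum_crossTerm {A : GL (Fin d) ℝ} {Ψ Φ : Fin r → L2 d}
    (hΨ : HasCalderonBound A Ψ) (hΦ : HasCalderonBound A Φ) {ι : Type*} [Countable ι] {e : ι → ℤ}
    (he : Function.Injective e) (a : Rd d) (i : Fin r) :
    MemLp (fun ξ => ∑' j, crossTerm A (Φ i) (Ψ i) (e j) ξ (ξ + a)) ∞ volume := by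
  obtain ⟨C, hC⟩ := hΨ.exists_tsum_crossTerm_le hΦ
  refine ⟨(Measurable.tsum fun j =>
    measurable_crossTerm A (Φ i) (Ψ i) (e j) a).aestronglyMeasurable, ?_⟩
  refine (essSup_le_of_ae_le (C : ℝ≥0∞) ?_).trans_lt ENNReal.coe_lt_top
  filter_upwards [hC a] with ξ hξ
  exact enorm_tsum_le_tsum_enorm.trans ((ENNReal.tsum_comp_le_tsum_of_injective
    he fun j : ℤ => ‖crossTerm A (Φ i) (Ψ i) j ξ (ξ + a)‖ₑ).trans (hξ i))

theorem memLp_tsum_natCast_crossTerm {A : GL (Fin d) ℝ} {Ψ Φ : Fin r → L2 d}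
    (hΨ : HasCalderonBound A Ψ) (hΦ : HasCalderonBound A Φ) (a : Rd d) (i : Fin r) :
    MemLp (fun ξ => ∑' j : ℕ, crossTerm A (Φ i) (Ψ i) j ξ (ξ + a)) ∞ volume :=
  memLp_tsum_crossTerm hΨ hΦ (Nat.cast_injective (R := ℤ)) a i

theorem memLp_tsum_crossTerm_self {A : GL (Fin d) ℝ} {Ψ Φ : Fin r → L2 d}
    (hΨ : HasCalderonBound A Ψ) (hΦ : HasCalderonBound A Φ) (i : Fin r) :
    MemLp (fun ξ => ∑' j : ℤ, crossTerm A (Ψ i) (Φ i) j ξ ξ) ∞ volume := by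
  simpa only [add_zero, id] using memLp_tsum_crossTerm hΦ hΨ Function.injective_id 0 i

theorem memLp_shiftSymbol {A : GL (Fin d) ℝ} {Ψ Φ : Fin r → L2 d} (hΨ : HasCalderonBound A Ψ)
    (hΦ : HasCalderonBound A Φ) (q : Fin d → ℤ) : MemLp (shiftSymbol A Ψ Φ q) ∞ volume :=
  memLp_finsetSum _ fun i _ => memLp_tsum_natCast_crossTerm hΨ hΦ (intVec q) i

theorem memLp_diagonalSymbol {A : GL (Fin d) ℝ} {Ψ Φ : Fin r → L2 d} (hΨ : HasCalderonBound A Ψ)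
    (hΦ : HasCalderonBound A Φ) : MemLp (diagonalSymbol A Ψ Φ) ∞ volume :=
  memLp_finsetSum _ fun i _ => memLp_tsum_crossTerm_self hΨ hΦ i

theorem diagonalSymbol_adjPow (A : GL (Fin d) ℝ) (Ψ Φ : Fin r → L2 d) (n : ℤ) (ξ : Rd d) :
    diagonalSymbol A Ψ Φ (adjPow A n ξ) = diagonalSymbol A Ψ Φ ξ := by
  refine Finset.sum_congr rfl fun i _ => ?_
  rw [← (Equiv.addRight n).tsum_eq fun j => crossTerm A (Ψ i) (Φ i) j ξ ξ]
  refine tsum_congr fun j => ?_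
  simp only [crossTerm, adjPow_adjPow, Equiv.coe_addRight]

theorem conj_crossTerm_self (A : GL (Fin d) ℝ) (φ ψ : L2 d) (j : ℤ) (ξ : Rd d) :
    conj (crossTerm A φ ψ j ξ ξ) = crossTerm A ψ φ j ξ ξ := by
  simp [crossTerm, mul_comm]

theorem ne_zero_of_intVec_notMem_dualLattice {A : GL (Fin d) ℝ} {q : Fin d → ℤ}
    (hq : intVec q ∉ dualLattice A) : q ≠ 0 := by
  rintro rfl
  exact hq ⟨0, by simp [adjPow]⟩

theorem activeScales_of_intVec_notMem_dualLattice {A : GL (Fin d) ℝ} (hint : IsIntegralMatrix A)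
    {q : Fin d → ℤ} (hq : intVec q ∉ dualLattice A) :
    activeScales A q = Set.range fun j : ℕ => -(j : ℤ) := by
  have hIic : (Set.range fun j : ℕ => -(j : ℤ)) = Set.Iic 0 := by
    ext n
    exact ⟨by rintro ⟨j, rfl⟩; simp, fun hn => ⟨n.natAbs, by grind⟩⟩
  rw [hIic]
  refine Set.Subset.antisymm ?_ fun n hn => Or.inl hn
  rintro n (hn | ⟨l, hl⟩)
  · exact hn
  · by_contra hpos
    obtain ⟨n, rfl⟩ : ∃ m : ℕ, n = 1 + m := ⟨(n - 1).toNat, by grind⟩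
    obtain ⟨m, hm⟩ := adjPow_natCast_intVec hint n
    exact hq ⟨m l, by simp only; rw [← hm, adjPow_adjPow, hl]⟩

theorem activeScales_zero (A : GL (Fin d) ℝ) : activeScales A 0 = Set.univ :=
  Set.eq_univ_of_forall fun _ => Or.inr ⟨0, by simp [adjPow]⟩

theorem shiftComponent_eq_integral_shiftSymbol {A : GL (Fin d) ℝ} (hint : IsIntegralMatrix A)
    {Ψ Φ : Fin r → L2 d} (hΨ : HasCalderonBound A Ψ) (hΦ : HasCalderonBound A Φ) (f g : L2 d)
    {q : Fin d → ℤ} (hq : intVec q ∉ dualLattice A) :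
    shiftComponent A Ψ Φ f g q = ∫ ξ, conj (shiftSymbol A Ψ Φ q ξ)
      * ((𝓕 f : L2 d) (ξ + intVec q) * conj ((𝓕 g : L2 d) ξ)) := by
  have hinj : Function.Injective fun j : ℕ => -(j : ℤ) := neg_injective.comp Nat.cast_injective
  have hscales : ∀ i ξ, ∑' n : ℤ, (activeScales A q).indicator
      (fun n => conj (crossTerm A (Φ i) (Ψ i) (-n) ξ (ξ + intVec q))) n
        = conj (∑' j : ℕ, crossTerm A (Φ i) (Ψ i) j ξ (ξ + intVec q)) := by
    intro i ξ
    rw [activeScales_of_intVec_notMem_dualLattice hint hq, Complex.conj_tsum,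
      ← hinj.tsum_eq Set.support_indicator_subset]
    exact tsum_congr fun j => by rw [Set.indicator_of_mem (Set.mem_range_self j), neg_neg]
  rw [shiftComponent_eq_integral hΨ hΦ, ← integral_finsetSum]
  · simp only [hscales, shiftSymbol, map_sum, Finset.sum_mul]
  · intro i _
    simp only [hscales]
    exact (integrable_shift_mul_conj f g (intVec q)).mul_of_top_right
      (memLp_tsum_natCast_crossTerm hΨ hΦ (intVec q) i).star

theorem shiftComponent_zero_eq_integral {A : GL (Fin d) ℝ}
    {Ψ Φ : Fin r → L2 d} (hΨ : HasCalderonBound A Ψ) (hΦ : HasCalderonBound A Φ) (f g : L2 d) :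
    shiftComponent A Ψ Φ f g 0 = ∫ ξ, diagonalSymbol A Ψ Φ ξ
      * ((𝓕 f : L2 d) ξ * conj ((𝓕 g : L2 d) ξ)) := by
  have hscales : ∀ i ξ, ∑' n : ℤ, (activeScales A 0).indicator
      (fun n => conj (crossTerm A (Φ i) (Ψ i) (-n) ξ ξ)) n
        = ∑' j : ℤ, crossTerm A (Ψ i) (Φ i) j ξ ξ := by
    intro i ξ
    simp only [activeScales_zero, Set.indicator_univ, conj_crossTerm_self]
    exact (Equiv.neg ℤ).tsum_eq fun j => crossTerm A (Ψ i) (Φ i) j ξ ξ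
  have hfg := integrable_shift_mul_conj f g 0
  simp only [add_zero] at hfg
  rw [shiftComponent_eq_integral hΨ hΦ, ← integral_finsetSum]
  · simp only [intVec_zero, add_zero, hscales, diagonalSymbol, Finset.sum_mul]
  · intro i _
    simp only [intVec_zero, add_zero, hscales]
    exact hfg.mul_of_top_right (memLp_tsum_crossTerm_self hΨ hΦ i)

theorem setIntegral_conj_shiftSymbol_eq_zero {A : GL (Fin d) ℝ} (hint : IsIntegralMatrix A)
    {Ψ Φ : Fin r → L2 d} (hΨ : HasCalderonBound A Ψ) (hΦ : HasCalderonBound A Φ)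
    {q : Fin d → ℤ} (hq : intVec q ∉ dualLattice A)
    (h : ∀ f g, IsBandLimited f → IsBandLimited g → shiftComponent A Ψ Φ f g q = 0)
    {E : Set (Rd d)} (hE : MeasurableSet E) {R : ℝ} (hR : ∀ ξ ∈ E, ‖ξ‖ ≤ R) :
    ∫ ξ in E, conj (shiftSymbol A Ψ Φ q ξ) = 0 := by
  obtain ⟨g, hg, hgE⟩ := exists_isBandLimited_fourier_ae_indicator hE hR
  obtain ⟨f, hf, hfE⟩ := exists_isBandLimited_fourier_ae_indicator
    (measurable_sub_const (intVec q) hE) (R := R + ‖intVec q‖) fun ξ hξ => by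
      have := hR _ hξ
      linarith [norm_sub_norm_le ξ (intVec q)]
  rw [← h f g hf hg, shiftComponent_eq_integral_shiftSymbol hint hΨ hΦ f g hq,
    ← integral_indicator hE]
  refine integral_congr_ae ?_
  filter_upwards [ae_comp_add_right hfE (intVec q), hgE] with ξ hfξ hgξ
  rw [hfξ, hgξ]
  by_cases hξ : ξ ∈ E <;> simp [hξ]

theorem shiftSymbol_ae_eq_zero {A : GL (Fin d) ℝ} (hint : IsIntegralMatrix A)
    {Ψ Φ : Fin r → L2 d} (hΨ : HasCalderonBound A Ψ) (hΦ : HasCalderonBound A Φ)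
    {q : Fin d → ℤ} (hq : intVec q ∉ dualLattice A)
    (h : ∀ f g, IsBandLimited f → IsBandLimited g → shiftComponent A Ψ Φ f g q = 0) :
    ∀ᵐ ξ, shiftSymbol A Ψ Φ q ξ = 0 := by
  have hloc : LocallyIntegrable (fun ξ => conj (shiftSymbol A Ψ Φ q ξ)) volume :=
    (memLp_shiftSymbol hΨ hΦ q).star.locallyIntegrable le_top
  have hzero := ae_eq_zero_of_forall_setIntegral_isCompact_eq_zero' hloc fun E hE => by
    obtain ⟨R, hR⟩ := hE.isBounded.exists_norm_le
    exact setIntegral_conj_shiftSymbol_eq_zero hint hΨ hΦ hq h hE.measurableSet hR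
  filter_upwards [hzero] with ξ hξ
  simpa using hξ

theorem isFourierMultiplier_of_isBandLimited {S : L2 d →L[ℂ] L2 d} {s : Rd d → ℂ}
    (hs : MemLp s ∞ volume)
    (h : ∀ f g, IsBandLimited f → IsBandLimited g →
      ⟪g, S f⟫_ℂ = ∫ ξ, s ξ * ((𝓕 f : L2 d) ξ * conj ((𝓕 g : L2 d) ξ))) :
    IsFourierMultiplier S s := by
  have hinner : ∀ f g : L2 d, ⟪(𝓕 g : L2 d), (𝓕 (S f) : L2 d)⟫_ℂ
      = ⟪(𝓕 g : L2 d), mulOp _ hs (𝓕 f : L2 d)⟫_ℂ := by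
    refine inner_eq_of_isBandLimited (continuous_fourier_L2.comp S.continuous)
      ((mulOp _ hs).continuous.comp continuous_fourier_L2) continuous_fourier_L2
      continuous_fourier_L2 fun f g hf hg => ?_
    rw [Lp.inner_fourier_eq, h f g hf hg, L2.inner_def]
    refine integral_congr_ae ?_
    filter_upwards [mulOp_ae _ hs (𝓕 f : L2 d)] with ξ hξ
    rw [hξ, RCLike.inner_apply, mul_assoc]
  refine ⟨hs, fun f => ?_⟩
  have hf : (𝓕 (S f) : L2 d) = mulOp _ hs (𝓕 f : L2 d) := by
    refine ext_inner_left ℂ fun v => ?_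
    obtain ⟨g, rfl⟩ := (Lp.fourierTransformₗᵢ (Rd d) ℂ).surjective v
    exact hinner f g
  rw [hf]
  exact mulOp_ae _ hs _

/- The expansion carries a nonzero shift to one outside of `A^* ℤᵈ`. -/
theorem shiftComponent_eq_zero_of_shiftSymbol {A : GL (Fin d) ℝ} (hexp : IsExpansive A)
    (hint : IsIntegralMatrix A) {Ψ Φ : Fin r → L2 d} (hΨ : HasCalderonBound A Ψ)
    (hΦ : HasCalderonBound A Φ)
    (h : ∀ q : Fin d → ℤ, intVec q ∉ dualLattice A → ∀ᵐ ξ, shiftSymbol A Ψ Φ q ξ = 0)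
    {k : Fin d → ℤ} (hk : k ≠ 0) (f g : L2 d) : shiftComponent A Ψ Φ f g k = 0 := by
  obtain ⟨m, q, hqd, hqk⟩ := hexp.exists_adjPow_notMem_dualLattice hk
  obtain ⟨f, rfl⟩ := (dilation A ^ (m : ℤ)).surjective f
  obtain ⟨g, rfl⟩ := (dilation A ^ (m : ℤ)).surjective g
  rw [shiftComponent_dilation hint hqk,
    shiftComponent_eq_integral_shiftSymbol hint hΨ hΦ f g hqd]
  refine integral_eq_zero_of_ae ?_
  filter_upwards [h q hqd] with ξ hξ
  simp [hξ]

theorem isFourierMultiplier_quasiGramian {A : GL (Fin d) ℝ} (hexp : IsExpansive A)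
    (hint : IsIntegralMatrix A) {Ψ Φ : Fin r → L2 d}
    (hΨ : IsBesselSeq (quasiAffineSystem A Ψ)) (hΦ : IsBesselSeq (quasiAffineSystem A Φ))
    (h : ∀ q : Fin d → ℤ, intVec q ∉ dualLattice A → ∀ᵐ ξ, shiftSymbol A Ψ Φ q ξ = 0) :
    IsFourierMultiplier (mixedGramian hΨ hΦ) (diagonalSymbol A Ψ Φ) := by
  have hΨC := hasCalderonBound_of_isBesselSeq hΨ
  have hΦC := hasCalderonBound_of_isBesselSeq hΦ
  refine isFourierMultiplier_of_isBandLimited (memLp_diagonalSymbol hΨC hΦC) fun f g hf hg => ?_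
  obtain ⟨S, hS⟩ := exists_finset_shiftPairing_eq_zero A Ψ Φ hf hg
  rw [inner_quasiGramian_eq_sum_shiftComponent hint hΨ hΦ hf hg hS,
    Finset.sum_eq_single 0
      (fun k _ hk => shiftComponent_eq_zero_of_shiftSymbol hexp hint hΨC hΦC h hk f g)
      (fun h0 => shiftComponent_eq_zero (hS 0 h0)),
    shiftComponent_zero_eq_integral hΨC hΦC]

theorem continuous_inner_translation (R : L2 d →L[ℂ] L2 d) (f g : L2 d) :
    Continuous fun β : Rd d => ⟪translation β g, R (translation β f)⟫_ℂ :=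
  (continuous_translation g).inner (R.continuous.comp (continuous_translation f))

theorem norm_inner_translation_le (R : L2 d →L[ℂ] L2 d) (f g : L2 d) (β : Rd d) :
    ‖⟪translation β g, R (translation β f)⟫_ℂ‖ ≤ ‖g‖ * (‖R‖ * ‖f‖) := by
  refine (norm_inner_le_norm _ _).trans ?_
  rw [norm_translation]
  gcongr
  exact (R.le_opNorm _).trans_eq (by rw [norm_translation])

theorem integrableOn_planeWave_mul {u : Rd d → ℂ} (hu : Continuous u) {C : ℝ}
    (hC : ∀ β, ‖u β‖ ≤ C) (a : Rd d) :
    IntegrableOn (fun β => planeWave a β * u β) (unitCube d) :=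
  Integrable.of_bound ((continuous_planeWave a).mul hu).aestronglyMeasurable C <|
    .of_forall fun β => by
      rw [norm_mul, norm_planeWave, one_mul]
      exact hC β

theorem tendsto_integral_unitCube_planeWave_mul {u : ℕ → Rd d → ℂ} (hu : ∀ N, Continuous (u N))
    {C : ℝ} (hC : ∀ N β, ‖u N β‖ ≤ C) (hlim : ∀ β, Tendsto (fun N => u N β) atTop (𝓝 0))
    (a : ℕ → Rd d) :
    Tendsto (fun N => ∫ β in unitCube d, planeWave (a N) β * u N β) atTop (𝓝 0) := by
  have hnorm : ∀ N β, ‖planeWave (a N) β * u N β‖ = ‖u N β‖ := fun N β => by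
    rw [norm_mul, norm_planeWave, one_mul]
  rw [← integral_zero (Rd d) ℂ (μ := volume.restrict (unitCube d))]
  refine tendsto_integral_of_dominated_convergence (fun _ => C)
    (fun N => (integrableOn_planeWave_mul (hu N) (hC N) _).aestronglyMeasurable)
    (integrable_const C) (fun N => .of_forall fun β => (hnorm N β).trans_le (hC N β))
    (.of_forall fun β => tendsto_zero_iff_norm_tendsto_zero.2 ?_)
  simpa only [hnorm] using tendsto_zero_iff_norm_tendsto_zero.1 (hlim β)

/- The operator `θ` contributes a constant to `β ↦ ⟪T_β g, θ T_β f⟫`, hence nothing to the Fourier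
coefficient at `q ≠ 0`. -/
theorem shiftComponent_eq_neg_integral_of_commute {A : GL (Fin d) ℝ} (hint : IsIntegralMatrix A)
    {Ψ Φ : Fin r → L2 d}
    (hΨ : IsBesselSeq (quasiAffineSystem A Ψ)) (hΦ : IsBesselSeq (quasiAffineSystem A Φ))
    {θ : L2 d →L[ℂ] L2 d} (h : ∀ β : Rd d, θ * translation β = translation β * θ)
    {q : Fin d → ℤ} (hq : q ≠ 0) {f g : L2 d} (hf : IsBandLimited f) (hg : IsBandLimited g) :
    shiftComponent A Ψ Φ f g q = -∫ β in unitCube d, planeWave (intVec q) β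
      * ⟪translation β g, (θ - mixedGramian hΨ hΦ) (translation β f)⟫_ℂ := by
  have hsplit : ∀ β : Rd d, planeWave (intVec q) β
      * ⟪translation β g, (θ - mixedGramian hΨ hΦ) (translation β f)⟫_ℂ
        = planeWave (intVec q) β * ⟪g, θ f⟫_ℂ - planeWave (intVec q) β
          * ⟪translation β g, mixedGramian hΨ hΦ (translation β f)⟫_ℂ := fun β => by
    rw [sub_apply, inner_sub_right, (commute_translation_iff_inner β).1 (h β), mul_sub]
  simp only [hsplit]
  rw [integral_sub (integrableOn_planeWave_mul continuous_const (fun _ => le_rfl) _)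
      (integrableOn_planeWave_mul (continuous_inner_translation _ f g)
        (norm_inner_translation_le _ f g) _),
    integral_mul_const, integral_unitCube_planeWave, if_neg hq,
    integral_inner_quasiGramian hint hΨ hΦ hf hg, zero_mul, zero_sub, neg_neg]

theorem shiftComponent_eq_zero_of_quasi_commute {A : GL (Fin d) ℝ} (hint : IsIntegralMatrix A)
    {Ψ Φ : Fin r → L2 d}
    (hΨ : IsBesselSeq (quasiAffineSystem A Ψ)) (hΦ : IsBesselSeq (quasiAffineSystem A Φ))
    (h : ∀ β : Rd d, mixedGramian hΨ hΦ * translation β = translation β * mixedGramian hΨ hΦ)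
    {q : Fin d → ℤ} (hq : q ≠ 0) {f g : L2 d} (hf : IsBandLimited f) (hg : IsBandLimited g) :
    shiftComponent A Ψ Φ f g q = 0 := by
  simp [shiftComponent_eq_neg_integral_of_commute hint hΨ hΦ h hq hf hg]

/- Dilating `f` and `g` moves the shift but not the component, while the difference of the two
Gramians vanishes in the limit. -/
theorem shiftComponent_eq_zero_of_affine_commute {A : GL (Fin d) ℝ} (hexp : IsExpansive A)
    (hint : IsIntegralMatrix A) {Ψ Φ : Fin r → L2 d}
    (hΨ : IsBesselSeq (affineSystem A Ψ)) (hΦ : IsBesselSeq (affineSystem A Φ))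
    (hΨq : IsBesselSeq (quasiAffineSystem A Ψ)) (hΦq : IsBesselSeq (quasiAffineSystem A Φ))
    (h : ∀ β : Rd d, mixedGramian hΨ hΦ * translation β = translation β * mixedGramian hΨ hΦ)
    {q : Fin d → ℤ} (hq : q ≠ 0) {f g : L2 d} (hf : IsBandLimited f) (hg : IsBandLimited g) :
    shiftComponent A Ψ Φ f g q = 0 := by
  choose k hk using fun N : ℕ => (adjPow_natCast_intVec hint N).imp fun m hm => hm q
  have hk0 : ∀ N, k N q ≠ 0 := fun N h0 => hq (intVec_injective (adjPow_injective A N (by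
    rw [hk, h0, intVec_zero]
    simp [adjPow])))
  have hnorm : ∀ (N : ℕ) (u : L2 d), ‖(dilation A ^ (N : ℤ)) u‖ = ‖u‖ := fun N u => by
    rw [dilation_zpow, norm_dilation]
  have hlim := (tendsto_integral_unitCube_planeWave_mul
    (fun N : ℕ => continuous_inner_translation (mixedGramian hΨ hΦ - mixedGramian hΨq hΦq)
      ((dilation A ^ (N : ℤ)) f) ((dilation A ^ (N : ℤ)) g))
    (C := ‖g‖ * (‖mixedGramian hΨ hΦ - mixedGramian hΨq hΦq‖ * ‖f‖))
    (fun N β => (norm_inner_translation_le _ _ _ β).trans_eq (by rw [hnorm, hnorm]))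
    (fun β => tendsto_inner_sub_mixedGramian hexp hΨ hΦ hΨq hΦq β f g)
    (fun N => intVec (k N q))).neg
  rw [neg_zero] at hlim
  refine tendsto_nhds_unique (tendsto_const_nhds.congr fun N => ?_) hlim
  rw [← shiftComponent_dilation hint (hk N) Ψ Φ f g]
  exact shiftComponent_eq_neg_integral_of_commute hint hΨq hΦq h (hk0 N)
    (hf.dilation_zpow A N) (hg.dilation_zpow A N)

theorem quasiGramian_commute_intVec {A : GL (Fin d) ℝ} (hint : IsIntegralMatrix A)
    {Ψ Φ : Fin r → L2 d}
    (hΨ : IsBesselSeq (quasiAffineSystem A Ψ)) (hΦ : IsBesselSeq (quasiAffineSystem A Φ))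
    (z : Fin d → ℤ) :
    mixedGramian hΨ hΦ * translation (intVec z) = translation (intVec z) * mixedGramian hΨ hΦ := by
  refine (commute_translation_iff_inner _).2 ?_
  refine inner_eq_of_isBandLimited
    ((mixedGramian hΨ hΦ).continuous.comp (translation (intVec z)).continuous)
    (mixedGramian hΨ hΦ).continuous (translation (intVec z)).continuous continuous_id
    fun f g hf hg => ?_
  obtain ⟨S, hS⟩ := exists_finset_shiftPairing_eq_zero A Ψ Φ hf hg
  rw [inner_quasiGramian_translation hint hΨ hΦ hf hg hS,
    inner_quasiGramian_eq_sum_shiftComponent hint hΨ hΦ hf hg hS]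
  refine Finset.sum_congr rfl fun k _ => ?_
  rw [← intVec_neg, planeWave_intVec_intVec, one_mul]

theorem mixedGramian_eq_of_commute_dilation {A : GL (Fin d) ℝ} (hexp : IsExpansive A)
    {Ψ Φ : Fin r → L2 d}
    (hΨ : IsBesselSeq (affineSystem A Ψ)) (hΦ : IsBesselSeq (affineSystem A Φ))
    (hΨq : IsBesselSeq (quasiAffineSystem A Ψ)) (hΦq : IsBesselSeq (quasiAffineSystem A Φ))
    (h : ∀ f, mixedGramian hΨq hΦq (dilation A f) = dilation A (mixedGramian hΨq hΦq f)) :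
    mixedGramian hΨ hΦ = mixedGramian hΨq hΦq := by
  have hinvariant : ∀ f g,
      ⟪dilation A g, (mixedGramian hΨ hΦ - mixedGramian hΨq hΦq) (dilation A f)⟫_ℂ
        = ⟪g, (mixedGramian hΨ hΦ - mixedGramian hΨq hΦq) f⟫_ℂ := by
    intro f g
    rw [sub_apply, sub_apply, inner_sub_right, inner_sub_right, inner_mixedGramian_dilation, h,
      inner_dilation_dilation]
  rw [← sub_eq_zero]
  ext1 f
  refine ext_inner_left ℂ fun g => ?_
  have hlim := tendsto_inner_sub_mixedGramian hexp hΨ hΦ hΨq hΦq 0 f g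
  simp only [translation_zero, inner_dilation_zpow_natCast hinvariant] at hlim
  rw [tendsto_nhds_unique tendsto_const_nhds hlim, zero_apply, inner_zero_right]

theorem mem_centralizer_range {M ι : Type*} [Mul M] {T : ι → M} {S : M} :
    S ∈ Set.centralizer (Set.range T) ↔ ∀ i, S * T i = T i * S := by
  simp only [Set.mem_centralizer_iff, Set.forall_mem_range, eq_comm]

theorem mem_centralizer_singleton_dilation {A : GL (Fin d) ℝ} {S : L2 d →L[ℂ] L2 d} :
    S ∈ Set.centralizer {(dilation A : L2 d →L[ℂ] L2 d)}
      ↔ ∀ f, S (dilation A f) = dilation A (S f) := by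
  simp only [Set.mem_centralizer_iff, Set.mem_singleton_iff, forall_eq]
  rw [eq_comm, ContinuousLinearMap.ext_iff]
  rfl

theorem ae_summable_natCast_crossTerm {A : GL (Fin d) ℝ} {Ψ Φ : Fin r → L2 d}
    (hΨ : HasCalderonBound A Ψ) (hΦ : HasCalderonBound A Φ) (a : Rd d) :
    ∀ᵐ ξ, ∀ i, Summable fun j : ℕ => crossTerm A (Φ i) (Ψ i) j ξ (ξ + a) := by
  filter_upwards [hΨ.ae_summable_crossTerm hΦ a] with ξ hξ i
  exact (hξ i).comp_injective (i := fun j : ℕ => (j : ℤ)) Nat.cast_injective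

theorem ae_summable_crossTerm_self {A : GL (Fin d) ℝ} {Ψ Φ : Fin r → L2 d}
    (hΨ : HasCalderonBound A Ψ) (hΦ : HasCalderonBound A Φ) :
    ∀ᵐ ξ, ∀ i, Summable fun j : ℤ => crossTerm A (Ψ i) (Φ i) j ξ ξ := by
  simpa only [add_zero] using hΦ.ae_summable_crossTerm hΨ 0

end Symbols

end

theorem theoremT {d r : ℕ} (A : GL (Fin d) ℝ) (hexp : IsExpansive A) (hint : IsIntegralMatrix A)
    (Ψ Φ : Fin r → L2 d)
    (hΨ : IsBesselSeq (affineSystem A Ψ)) (hΦ : IsBesselSeq (affineSystem A Φ)) :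
    ∃ (hΨq : IsBesselSeq (quasiAffineSystem A Ψ)) (hΦq : IsBesselSeq (quasiAffineSystem A Φ)),
      -- the series in the conditions below converge absolutely almost everywhere
      (∀ q : Fin d → ℤ, ∀ᵐ ξ : Rd d, ∀ i,
        Summable fun j : ℕ => crossTerm A (Φ i) (Ψ i) j ξ (ξ + intVec q)) ∧
      (∀ᵐ ξ : Rd d, ∀ i, Summable fun j : ℤ => crossTerm A (Ψ i) (Φ i) j ξ ξ) ∧
      List.TFAE [
        mixedGramian hΨ hΦ ∈
          Set.centralizer (Set.range fun z : Fin d → ℤ => translation (intVec z)),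
        mixedGramian hΨq hΦq ∈
          Set.centralizer {(dilation A : L2 d →L[ℂ] L2 d)},
        mixedGramian hΨ hΦ ∈ Set.centralizer (Set.range fun β : Rd d => translation β),
        mixedGramian hΨq hΦq ∈ Set.centralizer (Set.range fun β : Rd d => translation β),
        mixedGramian hΨ hΦ = mixedGramian hΨq hΦq,
        ∀ q : Fin d → ℤ, intVec q ∉ dualLattice A →
          ∀ᵐ ξ : Rd d, ∑ i, ∑' j : ℕ, crossTerm A (Φ i) (Ψ i) j ξ (ξ + intVec q) = 0,
        IsFourierMultiplier (mixedGramian hΨ hΦ)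
          (fun ξ => ∑ i, ∑' j : ℤ, crossTerm A (Ψ i) (Φ i) j ξ ξ),
        IsFourierMultiplier (mixedGramian hΨq hΦq)
          (fun ξ => ∑ i, ∑' j : ℤ, crossTerm A (Ψ i) (Φ i) j ξ ξ)] := by
  have hΨq := isBesselSeq_quasiAffineSystem hint hΨ
  have hΦq := isBesselSeq_quasiAffineSystem hint hΦ
  have hΨC := hasCalderonBound_of_isBesselSeq hΨq
  have hΦC := hasCalderonBound_of_isBesselSeq hΦq
  refine ⟨hΨq, hΦq, fun q => ae_summable_natCast_crossTerm hΨC hΦC (intVec q),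
    ae_summable_crossTerm_self hΨC hΦC, ?_⟩
  simp only [mem_centralizer_range, mem_centralizer_singleton_dilation]
  tfae_have 1 → 3 := commute_translation_of_dilation hexp (inner_mixedGramian_dilation hΨ hΦ)
  tfae_have 3 → 6 := fun h q hq => shiftSymbol_ae_eq_zero hint hΨC hΦC hq fun _ _ =>
    shiftComponent_eq_zero_of_affine_commute hexp hint hΨ hΦ hΨq hΦq h
      (ne_zero_of_intVec_notMem_dualLattice hq)
  tfae_have 4 → 6 := fun h q hq => shiftSymbol_ae_eq_zero hint hΨC hΦC hq fun _ _ =>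
    shiftComponent_eq_zero_of_quasi_commute hint hΨq hΦq h
      (ne_zero_of_intVec_notMem_dualLattice hq)
  tfae_have 6 → 8 := isFourierMultiplier_quasiGramian hexp hint hΨq hΦq
  tfae_have 8 → 4 := fun h => h.commute_translation
  tfae_have 8 → 2 := fun h => h.commute_dilation (diagonalSymbol_adjPow A Ψ Φ (-1))
  tfae_have 2 → 5 := mixedGramian_eq_of_commute_dilation hexp hΨ hΦ hΨq hΦq
  tfae_have 5 → 1 := fun h => by rw [h]; exact quasiGramian_commute_intVec hint hΨq hΦq
  tfae_have 8 → 7 := fun h => by rw [tfae_2_to_5 (tfae_8_to_2 h)]; exact h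
  tfae_have 7 → 3 := fun h => h.commute_translation
  tfae_finish
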